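/- Let $N\ge 0$ be an integer, let $\alpha\ge 0$, $g\in\mathbb R$ and $0<\Lambda<\infty$, and let $v:\mathbb R^3\to\mathbb R$ and $I:\mathbb R^{3N}\to\mathbb R$ be measurable with $v_+=\max(v,0)$ and $I_+=\max(I,0)$ locally integrable and $I$ symmetric under permutations of $x_1,\dots,x_N$. Put $V(X)=\sum_{j=1}^N v(x_j)$ for $X=(x_1,\dots,x_N)$. Let $\mathcal H$ be the tensor product of the antisymmetric subspace of $\otimes^N L^2(\mathbb R^3;\mathbb C^2)$ with the bosonic Fock space $\mathcal F$ over $L^2(\mathbb R^3;\mathbb C^2)$ (photons with momentum $k$ and polarization $\lambda\in\{1,2\}$). Assume that for every $\varepsilon>0$ there is $a(\varepsilon)\in\mathbb R$ such that the negative parts satisfy $$V_-+I_-\le \varepsilon\sum_{j=1}^N p_j^2+a(\varepsilon),\qquad p_j=-i\nabla_{x_j},$$ as quadratic forms on $\mathcal H$. For $m\ge 0$ let $$H^V_m=\sum_{j=1}^N\Big\{\big(p_j+\sqrt\alpha\,A(x_j)\big)^2+\frac g2\sqrt\alpha\,\sigma_j\cdot B(x_j)\Big\}+V(X)+I(X)+H_f(m),$$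 where $\sigma_j$ are the Pauli matrices of the $j$-th particle, $$H_f(m)=\sum_{\lambda=1,2}\int_{\mathbb R^3}\sqrt{|k|^2+m^2}\;a^*_\lambda(k)a_\lambda(k)\,d^3k,$$ $$A(x)=\sum_{\lambda=1,2}\int_{|k|<\Lambda}\frac{\varepsilon_\lambda(k)}{\sqrt{|k|}}\Big[a_\lambda(k)e^{ik\cdot x}+a^*_\lambda(k)e^{-ik\cdot x}\Big]d^3k,\qquad B=\operatorname{curl}A,$$ with $[a_\lambda(k),a^*_\nu(q)]=\delta_{\lambda\nu}\delta(k-q)$, $[a_\lambda(k),a_\nu(q)]=0$, and $\varepsilon_1(k)=(k_2,-k_1,0)/\sqrt{k_1^2+k_2^2}$, $\varepsilon_2(k)=\frac{k}{|k|}\wedge\varepsilon_1(k)$. The operator $H^V_m$ is the self-adjoint (Friedrichs) operator on $\mathcal H$ defined by the closure of this quadratic form on the vectors for which $\sum_jp_j^2$, $V+I$ and $H_f(m)$ have finite expectation. Let $H^0_m$ be the operator obtained by replacing $V$ by $0$ (keeping $I$), and let $E^V(m,N)$ and $E^0(m,N)$ be the infima of the spectra of $H^V_m$ and $H^0_m$.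 Then for every $m\ge0$ the spectra of $H^V_m$ and $H^0_m$ are non-empty and bounded below, so that $E^V(m,N)$ and $E^0(m,N)$ are finite, and, as $m\to0$ through positive values, $$E^V(m,N)\to E^V(0,N)\qquad\text{and}\qquad E^0(m,N)\to E^0(0,N).$$ -/

import Mathlib

open MeasureTheory Filter Topology
open scoped ContDiff ComplexConjugate

noncomputable section

namespace PauliFierz

/-! ### Self-adjoint operators from quadratic forms, and the bottom of the spectrum -/

section Friedrichs

variable {H : Type*} [NormedAddCommGroup H] [InnerProductSpace ℂ H]

/-- Graph of the operator associated with the closure of the quadratic form `q` (conjugate linear in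
the first argument) with dense domain `Q`, i.e. of the Friedrichs extension: `Φ` lies in its domain
and is mapped to `η` iff `Φ` is the limit of a form-Cauchy sequence `Φ k` in `Q`
(so `Φ` lies in the domain of the closure) and `q(Ψ, Φ) = lim q(Ψ, Φ k) = ⟨Ψ, η⟩` for all
`Ψ ∈ Q`. -/
def friedrichsGraph (Q : Set H) (q : H → H → ℂ) : Set (H × H) :=
  {p | ∃ Φ : ℕ → H, (∀ k, Φ k ∈ Q) ∧ Tendsto Φ atTop (𝓝 p.1) ∧
    Tendsto (fun kl : ℕ × ℕ => q (Φ kl.1 - Φ kl.2) (Φ kl.1 - Φ kl.2)) atTop (𝓝 0) ∧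
    ∀ Ψ ∈ Q, Tendsto (fun k => q Ψ (Φ k)) atTop (𝓝 (inner ℂ Ψ p.2))}

/-- `z` is in the resolvent set of the operator `T` with graph `G`: `T - z` maps the domain of
`T` bijectively onto the Hilbert space, with bounded inverse. -/
def InResolventSet (G : Set (H × H)) (z : ℂ) : Prop :=
  (∀ η : H, ∃! Φ : H, (Φ, η + z • Φ) ∈ G) ∧
    ∃ C : ℝ, ∀ p ∈ G, ‖p.1‖ ≤ C * ‖p.2 - z • p.1‖

/-- The real points of the spectrum (all of it, for a self-adjoint operator). -/
def realSpectrum (G : Set (H × H)) : Set ℝ :=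
  {e | ¬ InResolventSet G (e : ℂ)}

end Friedrichs

/-! ### Configuration spaces and the Hilbert space -/

/-- Physical space, or photon momentum space, with the Euclidean norm. -/
abbrev Space := EuclideanSpace ℝ (Fin 3)

/-- Positions and spins of `N` electrons. -/
abbrev ElectronConf (N : ℕ) := (Fin N → Space) × (Fin N → Fin 2)

/-- Wave vector and polarization of one photon. -/
abbrev Mode := Space × Fin 2

/-- Finitely many photons; square-integrable functions on this space that are symmetric in the
photons form the Fock space. -/
abbrev PhotonConf := Σ n : ℕ, (Fin n → Mode)

abbrev Conf (N : ℕ) := ElectronConf N × PhotonConf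

def electronMeasure (N : ℕ) : Measure (ElectronConf N) :=
  (volume : Measure (Fin N → Space)).prod Measure.count

def modeMeasure : Measure Mode :=
  (volume : Measure Space).prod Measure.count

/-- On the `n`-photon sector, Lebesgue measure times counting measure on polarizations; the vacuum
sector `n = 0` is a point of mass one. -/
def photonMeasure : Measure PhotonConf :=
  Measure.sum fun n : ℕ =>
    (Measure.pi fun _ : Fin n => modeMeasure).map
      (fun K => (⟨n, K⟩ : PhotonConf))

def confMeasure (N : ℕ) : Measure (Conf N) :=
  (electronMeasure N).prod photonMeasure

/-- Antisymmetry in the electrons (position and spin) and symmetry in the photons. -/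
structure HasStatistics {N : ℕ} (f : Conf N → ℂ) : Prop where
  electrons : ∀ (σ : Equiv.Perm (Fin N)) (X : Fin N → Space) (s : Fin N → Fin 2)
    (κ : PhotonConf),
    f ((X ∘ σ, s ∘ σ), κ) = ((Equiv.Perm.sign σ : ℤ) : ℂ) * f ((X, s), κ)
  photons : ∀ (n : ℕ) (τ : Equiv.Perm (Fin n)) (Z : ElectronConf N) (K : Fin n → Mode),
    f (Z, ⟨n, K ∘ τ⟩) = f (Z, ⟨n, K⟩)

/-- The `N`-electron Hilbert space (antisymmetric part of `⊗^N L²(ℝ³; ℂ²)`) `⊗` (Fock space). -/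
def hilbert (N : ℕ) : Submodule ℂ (Lp ℂ 2 (confMeasure N)) where
  carrier := {Ψ | ∃ f : Conf N → ℂ, HasStatistics f ∧ Ψ =ᵐ[confMeasure N] f}
  zero_mem' := ⟨0, ⟨by simp, by simp⟩, Lp.coeFn_zero _ _ _⟩
  add_mem' := by
    rintro Φ Ψ ⟨f, hf, hΦ⟩ ⟨h, hh, hΨ⟩
    refine ⟨f + h, ⟨fun σ X s κ => ?_, fun n τ Z K => ?_⟩,
      (Lp.coeFn_add Φ Ψ).trans (hΦ.add hΨ)⟩
    · simp only [Pi.add_apply, hf.electrons σ X s κ, hh.electrons σ X s κ]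
      ring
    · simp only [Pi.add_apply, hf.photons n τ Z K, hh.photons n τ Z K]
  smul_mem' := by
    rintro c Ψ ⟨f, hf, hΨ⟩
    refine ⟨c • f, ⟨fun σ X s κ => ?_, fun n τ Z K => ?_⟩,
      (Lp.coeFn_smul c Ψ).trans (hΨ.const_smul c)⟩
    · simp only [Pi.smul_apply, hf.electrons σ X s κ, smul_eq_mul]
      ring
    · simp only [Pi.smul_apply, hf.photons n τ Z K]

/-! ### Derivatives with respect to the electron positions -/

/-- `G` is the weak partial derivative of `f` in the `i`-th coordinate of the `j`-th electron, for
all spins and almost all photon configurations. -/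
def IsWeakPartial {N : ℕ} (j : Fin N) (i : Fin 3) (f G : Conf N → ℂ) : Prop :=
  ∀ᵐ κ ∂photonMeasure, ∀ (s : Fin N → Fin 2) (φ : (Fin N → Space) → ℝ),
    ContDiff ℝ ∞ φ → HasCompactSupport φ →
      ∫ X, ((fderiv ℝ φ X (Pi.single j (EuclideanSpace.single i 1)) : ℝ) : ℂ) * f ((X, s), κ) =
        -∫ X, (φ X : ℂ) * G ((X, s), κ)

/-- `f` has a square-integrable weak partial derivative. -/
def HasL2Partial {N : ℕ} (j : Fin N) (i : Fin 3) (f : Conf N → ℂ) : Prop :=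
  ∃ G : Conf N → ℂ, MemLp G 2 (confMeasure N) ∧ IsWeakPartial j i f G

open Classical in
/-- The square-integrable weak partial derivative (unique almost everywhere), when it exists. -/
def weakPartial {N : ℕ} (j : Fin N) (i : Fin 3) (f : Conf N → ℂ) : Conf N → ℂ :=
  if h : HasL2Partial j i f then h.choose else 0

/-! ### The quantized field -/

/-- Polarization vectors `ε₁(k) = (k₂, -k₁, 0) / √(k₁² + k₂²)` and `ε₂(k) = (k / |k|) ∧ ε₁(k)`. -/
def polarization (lam : Fin 2) (k : Space) : Fin 3 → ℝ :=
  let e₁ : Fin 3 → ℝ := (Real.sqrt (k 0 ^ 2 + k 1 ^ 2))⁻¹ • ![k 1, -k 0, 0]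
  if lam = 0 then e₁ else crossProduct (‖k‖⁻¹ • k.ofLp) e₁

/-- Coefficient of the annihilation operator `a_λ(k)` in the `i`-th component of `A(x)`:
`1_{|k| < Λ} |k|^{-1/2} ε_λ(k)_i e^{ik·x}`. -/
def coeffA (Λ : ℝ) (x : Space) (i : Fin 3) (k : Mode) : ℂ :=
  if ‖k.1‖ < Λ then
    (((Real.sqrt ‖k.1‖)⁻¹ * polarization k.2 k.1 i : ℝ) : ℂ) *
      Complex.exp (Complex.I * ((inner ℝ k.1 x : ℝ) : ℂ))
  else 0

/-- Coefficient of `a_λ(k)` in the `i`-th component of `B(x) = curl A(x)`: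
`1_{|k| < Λ} |k|^{-1/2} i (k ∧ ε_λ(k))_i e^{ik·x}`. -/
def coeffB (Λ : ℝ) (x : Space) (i : Fin 3) (k : Mode) : ℂ :=
  if ‖k.1‖ < Λ then
    Complex.I *
      (((Real.sqrt ‖k.1‖)⁻¹ * crossProduct k.1.ofLp (polarization k.2 k.1) i : ℝ) : ℂ) *
      Complex.exp (Complex.I * ((inner ℝ k.1 x : ℝ) : ℂ))
  else 0

/-- `∑_λ ∫ h(Z, k, λ) a_λ(k) dk`, where the coefficient may depend on the electrons `Z`. -/
def annihilate {N : ℕ} (h : ElectronConf N → Mode → ℂ) (f : Conf N → ℂ) : Conf N → ℂ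
  | (Z, ⟨n, K⟩) =>
    (Real.sqrt (n + 1) : ℂ) *
      ∫ k, h Z k * f (Z, ⟨n + 1, Fin.cons k K⟩) ∂modeMeasure

/-- `∑_λ ∫ conj (h(Z, k, λ)) a*_λ(k) dk`, the adjoint of `annihilate h`. -/
def create {N : ℕ} (h : ElectronConf N → Mode → ℂ) (f : Conf N → ℂ) : Conf N → ℂ
  | (_, ⟨0, _⟩) => 0
  | (Z, ⟨n + 1, K⟩) =>
    ((Real.sqrt (n + 1))⁻¹ : ℂ) *
      ∑ l : Fin (n + 1), conj (h Z (K l)) * f (Z, ⟨n, fun r => K (l.succAbove r)⟩)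

/-- The `i`-th component of the vector potential at the position of electron `j`. -/
def fieldA {N : ℕ} (Λ : ℝ) (j : Fin N) (i : Fin 3) (f : Conf N → ℂ) : Conf N → ℂ :=
  annihilate (fun Z => coeffA Λ (Z.1 j) i) f + create (fun Z => coeffA Λ (Z.1 j) i) f

/-- The `i`-th component of the magnetic field at the position of electron `j`. -/
def fieldB {N : ℕ} (Λ : ℝ) (j : Fin N) (i : Fin 3) (f : Conf N → ℂ) : Conf N → ℂ :=
  annihilate (fun Z => coeffB Λ (Z.1 j) i) f + create (fun Z => coeffB Λ (Z.1 j) i) f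

def pauliMatrix : Fin 3 → Matrix (Fin 2) (Fin 2) ℂ :=
  ![!![0, 1; 1, 0], !![0, -Complex.I; Complex.I, 0], !![1, 0; 0, -1]]

/-- The `i`-th Pauli matrix acting on the spin of electron `j`. -/
def pauli {N : ℕ} (j : Fin N) (i : Fin 3) (f : Conf N → ℂ) : Conf N → ℂ :=
  fun z => ∑ t : Fin 2,
    pauliMatrix i (z.1.2 j) t * f ((z.1.1, Function.update z.1.2 j t), z.2)

/-- Photon energy `√(|k|² + m²)`. -/
def dispersion (m : ℝ) (k : Space) : ℝ := Real.sqrt (‖k‖ ^ 2 + m ^ 2)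

/-- The field energy `H_f(m)` multiplies the `n`-photon component by the sum of the photon
energies. -/
def fieldEnergy (m : ℝ) (κ : PhotonConf) : ℝ := ∑ l : Fin κ.1, dispersion m (κ.2 l).1

/-! ### The Hamiltonian -/

/-- `V(X) = ∑_j v(x_j)`. -/
def externalPotential {N : ℕ} (v : Space → ℝ) (X : Fin N → Space) : ℝ := ∑ j, v (X j)

/-- The `i`-th component of `p_j + √α A(x_j)`, with `p = -i∇`. -/
def kineticMomentum {N : ℕ} (α Λ : ℝ) (j : Fin N) (i : Fin 3) (f : Conf N → ℂ) :
    Conf N → ℂ :=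
  fun z => -Complex.I * weakPartial j i f z + (Real.sqrt α : ℂ) * fieldA Λ j i f z

/-- The form `(Φ, H Ψ)` of
`∑_j {(p_j + √α A(x_j))² + (g/2) √α σ_j · B(x_j)} + W(X) + H_f(m)`. -/
def energyForm {N : ℕ} (α g Λ : ℝ) (W : (Fin N → Space) → ℝ) (m : ℝ)
    (Φ Ψ : hilbert N) : ℂ :=
  (∑ j : Fin N, ∑ i : Fin 3,
    ∫ z, conj (kineticMomentum α Λ j i Φ.1 z) * kineticMomentum α Λ j i Ψ.1 z ∂confMeasure N) +
  ((g / 2 * Real.sqrt α : ℝ) : ℂ) * (∑ j : Fin N, ∑ i : Fin 3,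
    ∫ z, conj (Φ.1 z) * pauli j i (fieldB Λ j i Ψ.1) z ∂confMeasure N) +
  (∫ z, (W z.1.1 : ℂ) * (conj (Φ.1 z) * Ψ.1 z) ∂confMeasure N) +
  ∫ z, (fieldEnergy m z.2 : ℂ) * (conj (Φ.1 z) * Ψ.1 z) ∂confMeasure N

/-- The vectors of finite energy: finite `∑_j p_j²`, potential energy and field energy. -/
def finiteEnergy {N : ℕ} (W : (Fin N → Space) → ℝ) (m : ℝ) : Set (hilbert N) :=
  {Ψ | (∀ j i, HasL2Partial j i Ψ.1) ∧
    Integrable (fun z => W z.1.1 * ‖Ψ.1 z‖ ^ 2) (confMeasure N) ∧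
    Integrable (fun z => fieldEnergy m z.2 * ‖Ψ.1 z‖ ^ 2) (confMeasure N)}

/-- Graph of the self-adjoint Hamiltonian `H^V_m` with `V = ∑_j v(x_j)` and interaction `I`. -/
def hamiltonian {N : ℕ} (α g Λ : ℝ) (v : Space → ℝ) (I : (Fin N → Space) → ℝ) (m : ℝ) :
    Set (hilbert N × hilbert N) :=
  friedrichsGraph (finiteEnergy (fun X => externalPotential v X + I X) m)
    (energyForm α g Λ (fun X => externalPotential v X + I X) m)

/-- The ground state energy `E^V(m, N)`: bottom of the spectrum of `H^V_m`. -/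
def groundEnergy {N : ℕ} (α g Λ : ℝ) (v : Space → ℝ) (I : (Fin N → Space) → ℝ) (m : ℝ) : ℝ :=
  sInf (realSpectrum (hamiltonian α g Λ v I m))

/-- For every `ε > 0` there is `a` with `V_- + I_- ≤ ε ∑_j p_j² + a` as quadratic forms. -/
def KineticallyBounded {N : ℕ} (v : Space → ℝ) (I : (Fin N → Space) → ℝ) : Prop :=
  ∀ ε : ℝ, 0 < ε → ∃ a : ℝ, ∀ Ψ : hilbert N, (∀ j i, HasL2Partial j i Ψ.1) →
    Integrable (fun z => (max (-externalPotential v z.1.1) 0 + max (-I z.1.1) 0) *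
      ‖Ψ.1 z‖ ^ 2) (confMeasure N) ∧
    ∫ z, (max (-externalPotential v z.1.1) 0 + max (-I z.1.1) 0) * ‖Ψ.1 z‖ ^ 2
        ∂confMeasure N ≤
      ε * (∑ j : Fin N, ∑ i : Fin 3, ∫ z, ‖weakPartial j i Ψ.1 z‖ ^ 2 ∂confMeasure N) +
        a * ‖Ψ‖ ^ 2

end PauliFierz

end

/-!
# Continuity of the Pauli–Fierz ground state energy in the photon mass

Let `q_m` be the energy form of the Hamiltonian with potential `W` (either `V + I` or `I`) and photon
mass `m`, on the vectors of finite energy. The bottom of the spectrum is shown to be the infimum of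
`q_m` over unit vectors, and the massless limit is then a variational argument.

*Spectrum.* The form `q_m` is hermitian, bounded below and closed, and its domain is not trivial. For
such a form the Friedrichs extension needs no closure (`mem_friedrichsGraph_iff`), real numbers below
the infimum are in the resolvent set by the Riesz representation theorem (`inResolventSet_of_lt`),
and the infimum itself is not (`exists_isLeast_realSpectrum`).

*Bounds.* The form factors satisfy `|h|² ≤ |k| U(k)` with `U` a multiple of `|k|⁻²` below the
ultraviolet cutoff, and `U` and `|k| U` are integrable in three dimensions. So `A` and `B` are bounded
relative to `H_f(0)^{1/2}` (`lintegral_annihilate_le`, `lintegral_create_le`). The `A²` term is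
absorbed by using only a small fraction of the kinetic energy, the term `σ·B` by an arbitrarily small
fraction of the field energy, and the negative part of `W` by the hypothesis. Hence `q_m` is
comparable, up to multiples of the norm, with the form of `∑ p_j² + W_+ + H_f(m)`
(`exists_coercive`, `exists_energyForm_le`). That form is closed because weak differentiation and
multiplication operators are (`freeEnergy_closed`), so `q_m` is closed too. The domain contains an
antisymmetric smooth function tensored with the photon vacuum (`exists_ne_zero_mem_finiteEnergy`).

*Massless limit.* Since `H_f(m) ≥ H_f(0)`, the energy at mass `m` is at least the massless one.
Conversely, cutting off the photon number of an approximate massless ground state changes its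
massless energy arbitrarily little, and on vectors with at most `k` photons `H_f(m) ≤ H_f(0) + k m`
(`cutoff_massive`). Letting `m → 0` at fixed `k` gives the upper bound (`tendsto_infimum`).
-/

noncomputable section

namespace PauliFierz

/-! ### The bottom of the spectrum of a closed form -/

section ClosedForms

/-- Riesz representation theorem for a vector space with an unbundled inner product, its completeness
and the boundedness of `f` being expressed by that inner product. -/
theorem exists_riesz_representative {V : Type*} [AddCommGroup V] [Module ℂ V]
    (core : InnerProductSpace.Core ℂ V)
    (hcomplete : ∀ u : ℕ → V,
      Tendsto (fun kl : ℕ × ℕ => core.inner (u kl.1 - u kl.2) (u kl.1 - u kl.2)) atTop (𝓝 0) →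
      ∃ x, Tendsto (fun k => core.inner (u k - x) (u k - x)) atTop (𝓝 0))
    (f : V →ₗ[ℂ] ℂ) (C : ℝ) (hf : ∀ x, ‖f x‖ ^ 2 ≤ C ^ 2 * (core.inner x x).re) :
    ∃ x, ∀ y, core.inner x y = f y := by
  let : NormedAddCommGroup V := core.toNormedAddCommGroup
  let : InnerProductSpace ℂ V := InnerProductSpace.ofCore core.toCore
  have hin : ∀ x y : V, core.inner x y = inner ℂ x y := fun x y => rfl
  have hnorm : ∀ x : V, core.inner x x = ((‖x‖ ^ 2 : ℝ) : ℂ) := fun x => by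
    rw [hin, inner_self_eq_norm_sq_to_K]; push_cast; rfl
  have key : ∀ {ι : Type} (l : Filter ι) (g : ι → V),
      Tendsto (fun k => core.inner (g k) (g k)) l (𝓝 0) ↔ Tendsto (fun k => ‖g k‖) l (𝓝 0) := by
    intro ι l g
    rw [tendsto_zero_iff_norm_tendsto_zero]
    have : ∀ k, ‖core.inner (g k) (g k)‖ = ‖g k‖ ^ 2 := fun k => by
      rw [hnorm, Complex.norm_real, Real.norm_of_nonneg (by positivity)]
    simp only [this]
    constructor
    · intro h
      have := h.sqrt
      simpa [Real.sqrt_sq] using this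
    · intro h
      simpa using h.pow 2
  have : CompleteSpace V := by
    refine Metric.complete_of_cauchySeq_tendsto fun u hu => ?_
    obtain ⟨x, hx⟩ := hcomplete u (by
      rw [key]
      rw [cauchySeq_iff_tendsto_dist_atTop_0] at hu
      simpa [dist_eq_norm] using hu)
    refine ⟨x, ?_⟩
    rw [key] at hx
    exact tendsto_iff_norm_sub_tendsto_zero.2 hx
  let F : V →L[ℂ] ℂ := f.mkContinuous |C| fun x => by
    have h := hf x
    rw [hnorm, Complex.ofReal_re, ← mul_pow] at h
    have := Real.sqrt_le_sqrt h
    rwa [Real.sqrt_sq (norm_nonneg _), Real.sqrt_sq_eq_abs, abs_mul, abs_norm] at this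
  refine ⟨(InnerProductSpace.toDual ℂ V).symm F, fun y => ?_⟩
  rw [hin, InnerProductSpace.toDual_symm_apply]
  rfl

variable {H : Type*} [NormedAddCommGroup H] [InnerProductSpace ℂ H]

/-- A sesquilinear hermitian form on the subspace `Q`, conjugate linear in the first argument.
Values of `q` outside `Q` are irrelevant. -/
structure IsHermitianForm (Q : Submodule ℂ H) (q : H → H → ℂ) : Prop where
  add_right : ∀ Φ ∈ Q, ∀ Ψ ∈ Q, ∀ Ψ' ∈ Q, q Φ (Ψ + Ψ') = q Φ Ψ + q Φ Ψ'
  smul_right : ∀ Φ ∈ Q, ∀ Ψ ∈ Q, ∀ c : ℂ, q Φ (c • Ψ) = c * q Φ Ψ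
  conj_symm : ∀ Φ ∈ Q, ∀ Ψ ∈ Q, conj (q Ψ Φ) = q Φ Ψ

/-- The form `q` on `Q` is closed: form-Cauchy sequences that converge in the Hilbert space have
their limit in `Q` and converge to it in the form sense. -/
def IsClosedForm (Q : Submodule ℂ H) (q : H → H → ℂ) : Prop :=
  ∀ (Φ : ℕ → H) (x : H), (∀ k, Φ k ∈ Q) → Tendsto Φ atTop (𝓝 x) →
    Tendsto (fun kl : ℕ × ℕ => q (Φ kl.1 - Φ kl.2) (Φ kl.1 - Φ kl.2)) atTop (𝓝 0) →
    x ∈ Q ∧ Tendsto (fun k => q (Φ k - x) (Φ k - x)) atTop (𝓝 0)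

variable {Q : Submodule ℂ H} {q : H → H → ℂ}

/-- If `q ≥ e`, then `q - e` is a semi-inner product on `Q`. -/
@[reducible]
def IsHermitianForm.shiftCore (hq : IsHermitianForm Q q) {e : ℝ}
    (he : ∀ Φ ∈ Q, e * ‖Φ‖ ^ 2 ≤ (q Φ Φ).re) : PreInnerProductSpace.Core ℂ Q where
  inner Φ Ψ := q Φ Ψ - e * inner ℂ (Φ : H) Ψ
  conj_inner_symm Φ Ψ := by
    rw [map_sub, map_mul, hq.conj_symm _ Φ.2 _ Ψ.2, inner_conj_symm, Complex.conj_ofReal]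
  re_inner_nonneg Φ := by
    have h := he Φ Φ.2
    have h2 : inner ℂ (Φ : H) Φ = ((‖(Φ : H)‖ ^ 2 : ℝ) : ℂ) := by
      rw [inner_self_eq_norm_sq_to_K]; push_cast; rfl
    rw [h2, ← Complex.ofReal_mul]
    change 0 ≤ (_ - _ : ℂ).re
    rw [Complex.sub_re, Complex.ofReal_re]
    linarith
  add_left Φ Ψ Θ := by
    rw [← hq.conj_symm _ (Φ + Ψ).2 _ Θ.2, ← hq.conj_symm _ Φ.2 _ Θ.2, ← hq.conj_symm _ Ψ.2 _ Θ.2,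
      Submodule.coe_add, hq.add_right _ Θ.2 _ Φ.2 _ Ψ.2, map_add, inner_add_left]
    ring
  smul_left Φ Θ r := by
    rw [← hq.conj_symm _ (r • Φ).2 _ Θ.2, ← hq.conj_symm _ Φ.2 _ Θ.2,
      Submodule.coe_smul, hq.smul_right _ Θ.2 _ Φ.2, map_mul, inner_smul_left]
    ring

theorem re_inner_self (Φ : H) (e : ℝ) (c : ℂ) :
    (c - e * inner ℂ Φ Φ).re = c.re - e * ‖Φ‖ ^ 2 := by
  rw [inner_self_eq_norm_sq_to_K]
  have : ((‖Φ‖ : ℂ)) ^ 2 = ((‖Φ‖ ^ 2 : ℝ) : ℂ) := by push_cast; rfl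
  change (c - e * (‖Φ‖ : ℂ) ^ 2).re = _
  rw [this, ← Complex.ofReal_mul, Complex.sub_re, Complex.ofReal_re]

/-- Cauchy–Schwarz inequality for the nonnegative form `q - e`. -/
theorem IsHermitianForm.norm_sq_le (hq : IsHermitianForm Q q) {e : ℝ}
    (he : ∀ Φ ∈ Q, e * ‖Φ‖ ^ 2 ≤ (q Φ Φ).re) {Φ Ψ : H} (hΦ : Φ ∈ Q) (hΨ : Ψ ∈ Q) :
    ‖q Φ Ψ - e * inner ℂ Φ Ψ‖ ^ 2 ≤
      ((q Φ Φ).re - e * ‖Φ‖ ^ 2) * ((q Ψ Ψ).re - e * ‖Ψ‖ ^ 2) := by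
  let := hq.shiftCore he
  have h := InnerProductSpace.Core.inner_mul_inner_self_le (𝕜 := ℂ) (F := Q) ⟨Φ, hΦ⟩ ⟨Ψ, hΨ⟩
  have h2 := InnerProductSpace.Core.norm_inner_symm (𝕜 := ℂ) (F := Q) ⟨Φ, hΦ⟩ ⟨Ψ, hΨ⟩
  rw [← h2, ← sq] at h
  rw [← re_inner_self Φ e (q Φ Φ), ← re_inner_self Ψ e (q Ψ Ψ)]
  exact h

/-- The values of a form bounded below converge along form-convergent sequences, by Cauchy–Schwarz
for `q - e`. -/
theorem IsHermitianForm.tendsto_re_self (hq : IsHermitianForm Q q) {e : ℝ}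
    (he : ∀ Φ ∈ Q, e * ‖Φ‖ ^ 2 ≤ (q Φ Φ).re) {u : ℕ → H} {x : H} (hu : ∀ k, u k ∈ Q) (hx : x ∈ Q)
    (hlim : Tendsto u atTop (𝓝 x))
    (hform : Tendsto (fun k => (q (u k - x) (u k - x)).re) atTop (𝓝 0)) :
    Tendsto (fun k => (q (u k) (u k)).re) atTop (𝓝 (q x x).re) := by
  have hd : ∀ k, u k - x ∈ Q := fun k => Q.sub_mem (hu k) hx
  have hn := (tendsto_iff_norm_sub_tendsto_zero.1 hlim).pow 2
  rw [zero_pow two_ne_zero] at hn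
  have h0 : Tendsto (fun k => q x (u k - x)) atTop (𝓝 0) := by
    have h1 : Tendsto (fun k => ‖q x (u k - x) - e * inner ℂ x (u k - x)‖ ^ 2) atTop (𝓝 0) := by
      have h2 := (hform.sub (hn.const_mul e)).const_mul ((q x x).re - e * ‖x‖ ^ 2)
      rw [mul_zero, sub_zero, mul_zero] at h2
      exact squeeze_zero (fun k => sq_nonneg _) (fun k => hq.norm_sq_le he hx (hd k)) h2
    have h3 : Tendsto (fun k => q x (u k - x) - e * inner ℂ x (u k - x)) atTop (𝓝 0) := by
      rw [tendsto_zero_iff_norm_tendsto_zero]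
      simpa [Real.sqrt_sq (norm_nonneg _)] using h1.sqrt
    have h4 : Tendsto (fun k => (e : ℂ) * inner ℂ x (u k - x)) atTop (𝓝 0) := by
      have h5 : Tendsto (fun k => inner ℂ x (u k - x)) atTop (𝓝 (inner ℂ x (x - x))) :=
        tendsto_const_nhds.inner (hlim.sub_const x)
      rw [sub_self, inner_zero_right] at h5
      simpa using h5.const_mul (e : ℂ)
    simpa using h3.add h4
  have hexp : ∀ k, (q (u k) (u k)).re =
      (q x x).re + 2 * (q x (u k - x)).re + (q (u k - x) (u k - x)).re := by
    intro k
    have e1 := congrArg Complex.re (hq.add_right _ (hu k) _ hx _ (hd k))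
    have e2 := congrArg Complex.re (hq.add_right _ hx _ hx _ (hd k))
    have e3 := congrArg Complex.re (hq.add_right _ (hd k) _ hx _ (hd k))
    have c1 := congrArg Complex.re (hq.conj_symm _ (hu k) _ hx)
    have c2 := congrArg Complex.re (hq.conj_symm _ (hu k) _ (hd k))
    have c3 := congrArg Complex.re (hq.conj_symm _ (hd k) _ hx)
    rw [add_sub_cancel, Complex.add_re] at e1 e2 e3
    rw [Complex.conj_re] at c1 c2 c3
    linarith
  have hlim2 := ((((Complex.continuous_re.tendsto 0).comp h0).const_mul 2).const_add
    (q x x).re).add hform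
  simp only [Complex.zero_re, mul_zero, add_zero] at hlim2
  exact hlim2.congr fun k => (hexp k).symm

/-- The Friedrichs extension of a closed form is the operator of the form itself: no closure has to
be taken. -/
theorem mem_friedrichsGraph_iff (hq : IsHermitianForm Q q) (hcl : IsClosedForm Q q) {e : ℝ}
    (he : ∀ Φ ∈ Q, e * ‖Φ‖ ^ 2 ≤ (q Φ Φ).re) (p : H × H) :
    p ∈ friedrichsGraph (Q : Set H) q ↔
      p.1 ∈ Q ∧ ∀ Ψ ∈ Q, q Ψ p.1 = inner ℂ Ψ p.2 := by
  have hsub : ∀ Φ ∈ Q, ∀ Ψ ∈ Q, ∀ Ψ' ∈ Q, q Φ (Ψ - Ψ') = q Φ Ψ - q Φ Ψ' := by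
    intro Φ hΦ Ψ hΨ Ψ' hΨ'
    have h := hq.add_right Φ hΦ (Ψ - Ψ') (Q.sub_mem hΨ hΨ') Ψ' hΨ'
    rw [sub_add_cancel] at h
    rw [h]; ring
  constructor
  · rintro ⟨u, hu, hlim, hC, hw⟩
    obtain ⟨hx, hform⟩ := hcl u p.1 hu hlim hC
    refine ⟨hx, fun Ψ hΨ => tendsto_nhds_unique ?_ (hw Ψ hΨ)⟩
    have hdiff : Tendsto (fun k => q Ψ (u k - p.1) - e * inner ℂ Ψ (u k - p.1)) atTop (𝓝 0) := by
      rw [tendsto_zero_iff_norm_tendsto_zero]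
      have h1 : Tendsto (fun k => ((q Ψ Ψ).re - e * ‖Ψ‖ ^ 2) *
          ((q (u k - p.1) (u k - p.1)).re - e * ‖u k - p.1‖ ^ 2)) atTop (𝓝 0) := by
        have h2 : Tendsto (fun k => (q (u k - p.1) (u k - p.1)).re) atTop (𝓝 0) := by
          exact (Complex.continuous_re.tendsto 0).comp hform
        have h3 : Tendsto (fun k => ‖u k - p.1‖) atTop (𝓝 0) :=
          tendsto_iff_norm_sub_tendsto_zero.1 hlim
        simpa using (h2.sub ((h3.pow 2).const_mul e)).const_mul ((q Ψ Ψ).re - e * ‖Ψ‖ ^ 2)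
      have h4 := h1.sqrt
      rw [Real.sqrt_zero] at h4
      refine squeeze_zero (fun _ => norm_nonneg _) (fun k => ?_) h4
      exact Real.le_sqrt_of_sq_le (hq.norm_sq_le he hΨ (Q.sub_mem (hu k) hx))
    have hin : Tendsto (fun k => (e : ℂ) * inner ℂ Ψ (u k - p.1)) atTop (𝓝 0) := by
      have : Tendsto (fun k => u k - p.1) atTop (𝓝 0) := by
        simpa using hlim.sub_const p.1
      have h := (tendsto_const_nhds (x := (e : ℂ))).mul
        ((tendsto_const_nhds (x := Ψ)).inner (𝕜 := ℂ) this)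
      rwa [inner_zero_right, mul_zero] at h
    have hsum := (hdiff.add hin).add_const (q Ψ p.1)
    simp only [zero_add, sub_add_cancel] at hsum
    refine hsum.congr fun k => ?_
    rw [hsub Ψ hΨ _ (hu k) _ hx, sub_add_cancel]
  · rintro ⟨hx, hw⟩
    refine ⟨fun _ => p.1, fun _ => hx, tendsto_const_nhds, ?_, fun Ψ hΨ => ?_⟩
    · have : q (p.1 - p.1) (p.1 - p.1) = 0 := by
        rw [hsub _ (Q.sub_mem hx hx) _ hx _ hx, sub_self]
      exact this ▸ tendsto_const_nhds
    · exact hw Ψ hΨ ▸ tendsto_const_nhds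

variable [CompleteSpace H]

/-- Real numbers strictly below the form are in the resolvent set: on `Q` the form `q - z` is an
inner product for which `Q` is complete, so the Riesz representation theorem solves
`(T - z) Φ = η`. -/
theorem inResolventSet_of_lt (hq : IsHermitianForm Q q) (hcl : IsClosedForm Q q) {e z : ℝ}
    (he : ∀ Φ ∈ Q, e * ‖Φ‖ ^ 2 ≤ (q Φ Φ).re) (hz : z < e) :
    InResolventSet (friedrichsGraph (Q : Set H) q) (z : ℂ) := by
  have hze : ∀ Φ ∈ Q, z * ‖Φ‖ ^ 2 ≤ (q Φ Φ).re := fun Φ hΦ =>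
    le_trans (by gcongr) (he Φ hΦ)
  have hcoer : ∀ Φ ∈ Q, (e - z) * ‖Φ‖ ^ 2 ≤ (q Φ Φ - z * inner ℂ Φ Φ).re := fun Φ hΦ => by
    rw [re_inner_self]; linarith [he Φ hΦ]
  have hpos : 0 < e - z := sub_pos.2 hz
  -- A solution is bounded by the right-hand side.
  have hbound : ∀ p ∈ friedrichsGraph (Q : Set H) q,
      ‖p.1‖ ≤ (e - z)⁻¹ * ‖p.2 - (z : ℂ) • p.1‖ := by
    intro p hp
    obtain ⟨hx, hw⟩ := (mem_friedrichsGraph_iff hq hcl he p).1 hp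
    have h1 := hcoer p.1 hx
    rw [hw p.1 hx, ← inner_smul_right, ← inner_sub_right] at h1
    have h2 : (inner ℂ p.1 (p.2 - (z : ℂ) • p.1)).re ≤ ‖p.1‖ * ‖p.2 - (z : ℂ) • p.1‖ :=
      (Complex.re_le_norm _).trans (norm_inner_le_norm _ _)
    rw [inv_mul_eq_div, le_div_iff₀ hpos]
    by_cases h0 : ‖p.1‖ = 0
    · rw [h0]; simp
    · have h3 : 0 < ‖p.1‖ := lt_of_le_of_ne (norm_nonneg _) (Ne.symm h0)
      nlinarith
  refine ⟨fun η => ?_, (e - z)⁻¹, hbound⟩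
  let core : InnerProductSpace.Core ℂ Q :=
    { hq.shiftCore hze with
      definite := fun Φ hΦ => by
        have h1 := hcoer Φ Φ.2
        change q Φ Φ - z * inner ℂ (Φ : H) Φ = 0 at hΦ
        rw [hΦ, Complex.zero_re] at h1
        have h2 : ‖(Φ : H)‖ ^ 2 ≤ 0 := by nlinarith
        have h3 : ‖(Φ : H)‖ = 0 := by nlinarith [norm_nonneg (Φ : H)]
        exact Subtype.ext (norm_eq_zero.1 h3) }
  have hcoreinner : ∀ Φ Ψ : Q, core.inner Φ Ψ = q Φ Ψ - z * inner ℂ (Φ : H) Ψ := fun _ _ => rfl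
  have hcomplete : ∀ u : ℕ → Q,
      Tendsto (fun kl : ℕ × ℕ => core.inner (u kl.1 - u kl.2) (u kl.1 - u kl.2)) atTop (𝓝 0) →
      ∃ x, Tendsto (fun k => core.inner (u k - x) (u k - x)) atTop (𝓝 0) := by
    intro u hu
    have hnorm : Tendsto (fun kl : ℕ × ℕ => ‖(u kl.1 : H) - u kl.2‖ ^ 2) atTop (𝓝 0) := by
      have h1 : Tendsto (fun kl : ℕ × ℕ => (e - z)⁻¹ *
          (core.inner (u kl.1 - u kl.2) (u kl.1 - u kl.2)).re) atTop (𝓝 0) := by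
        simpa using ((Complex.continuous_re.tendsto 0).comp hu).const_mul (e - z)⁻¹
      refine squeeze_zero (fun _ => by positivity) (fun kl => ?_) h1
      rw [inv_mul_eq_div, le_div_iff₀ hpos, mul_comm]
      exact hcoer _ (u kl.1 - u kl.2).2
    have hcauchy : CauchySeq fun k => (u k : H) := by
      rw [cauchySeq_iff_tendsto_dist_atTop_0]
      have := hnorm.sqrt
      simpa [dist_eq_norm, Real.sqrt_sq] using this
    obtain ⟨x, hx⟩ := cauchySeq_tendsto_of_complete hcauchy
    have hself : ∀ Φ : H, inner ℂ Φ Φ = ((‖Φ‖ ^ 2 : ℝ) : ℂ) := fun Φ => by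
      rw [inner_self_eq_norm_sq_to_K]; push_cast; rfl
    have hform : Tendsto (fun kl : ℕ × ℕ => q ((u kl.1 : H) - u kl.2) (u kl.1 - u kl.2))
        atTop (𝓝 0) := by
      have h2 : Tendsto (fun kl : ℕ × ℕ => (z : ℂ) * ((‖(u kl.1 : H) - u kl.2‖ ^ 2 : ℝ) : ℂ))
          atTop (𝓝 0) := by
        simpa using ((Complex.continuous_ofReal.tendsto 0).comp hnorm).const_mul (z : ℂ)
      have h3 := hu.add h2
      rw [add_zero] at h3
      refine h3.congr fun kl => ?_
      rw [hcoreinner, ← hself]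
      simp
    obtain ⟨hxQ, hconv⟩ := hcl _ x (fun k => (u k).2) hx hform
    refine ⟨⟨x, hxQ⟩, ?_⟩
    have h4 : Tendsto (fun k => (z : ℂ) * ((‖(u k : H) - x‖ ^ 2 : ℝ) : ℂ)) atTop (𝓝 0) := by
      have := tendsto_iff_norm_sub_tendsto_zero.1 hx
      have h5 := (Complex.continuous_ofReal.tendsto _).comp (this.pow 2)
      simpa using h5.const_mul (z : ℂ)
    have h6 := hconv.sub h4
    rw [sub_zero] at h6
    refine h6.congr fun k => ?_
    rw [hcoreinner, ← hself]
    rfl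
  let f : Q →ₗ[ℂ] ℂ := (innerSL ℂ η).toLinearMap.comp Q.subtype
  have hf : ∀ y : Q, f y = inner ℂ η (y : H) := fun y => rfl
  obtain ⟨x, hx⟩ := exists_riesz_representative core hcomplete f
    (‖η‖ * Real.sqrt (e - z)⁻¹) (fun y => by
      have h1 := hcoer y y.2
      rw [hcoreinner, hf, mul_pow, Real.sq_sqrt (inv_nonneg.2 hpos.le)]
      have h2 : ‖inner ℂ η (y : H)‖ ^ 2 ≤ ‖η‖ ^ 2 * ‖(y : H)‖ ^ 2 := by
        rw [← mul_pow]
        gcongr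
        exact norm_inner_le_norm _ _
      refine h2.trans ?_
      rw [mul_assoc]
      gcongr
      rw [inv_mul_eq_div, le_div_iff₀ hpos, mul_comm]
      exact h1)
  have hmem : ((x : H), η + (z : ℂ) • (x : H)) ∈ friedrichsGraph (Q : Set H) q := by
    refine (mem_friedrichsGraph_iff hq hcl he _).2 ⟨x.2, fun Ψ hΨ => ?_⟩
    have h1 := hx ⟨Ψ, hΨ⟩
    rw [hcoreinner, hf] at h1
    have h2 := congrArg conj h1
    simp only [map_sub, map_mul, Complex.conj_ofReal, inner_conj_symm] at h2
    rw [hq.conj_symm _ hΨ _ x.2] at h2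
    change q Ψ x = inner ℂ Ψ (η + (z : ℂ) • (x : H))
    rw [inner_add_right, inner_smul_right, ← h2]
    ring
  refine ⟨x, hmem, fun y hy => ?_⟩
  obtain ⟨hyQ, hyw⟩ := (mem_friedrichsGraph_iff hq hcl he _).1 hy
  obtain ⟨_, hxw⟩ := (mem_friedrichsGraph_iff hq hcl he _).1 hmem
  have hdiff : (y - x, (z : ℂ) • (y - x)) ∈ friedrichsGraph (Q : Set H) q := by
    refine (mem_friedrichsGraph_iff hq hcl he _).2 ⟨Q.sub_mem hyQ x.2, fun Ψ hΨ => ?_⟩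
    have h := hq.add_right Ψ hΨ (y - x) (Q.sub_mem hyQ x.2) x x.2
    rw [sub_add_cancel] at h
    have h1 := hyw Ψ hΨ
    have h2 := hxw Ψ hΨ
    simp only at h1 h2
    change q Ψ (y - x) = _
    rw [eq_sub_of_add_eq h.symm, h1, h2, ← inner_sub_right, smul_sub]
    rw [add_sub_add_left_eq_sub]
  have := hbound _ hdiff
  simp only [sub_self, norm_zero, mul_zero] at this
  exact sub_eq_zero.1 (norm_le_zero_iff.1 this)

/-- The spectrum of the operator of a closed form starts at the infimum of the form over unit
vectors. If that infimum were in the resolvent set, Cauchy–Schwarz for `q - E` together with the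
bounded inverse would make `q - E` strictly positive. -/
theorem exists_isLeast_realSpectrum (hq : IsHermitianForm Q q) (hcl : IsClosedForm Q q) {e : ℝ}
    (he : ∀ Φ ∈ Q, e * ‖Φ‖ ^ 2 ≤ (q Φ Φ).re) (hne : ∃ Φ ∈ Q, Φ ≠ 0) :
    ∃ E : ℝ, IsLeast (realSpectrum (friedrichsGraph (Q : Set H) q)) E ∧
      (∀ Φ ∈ Q, E * ‖Φ‖ ^ 2 ≤ (q Φ Φ).re) ∧
      ∀ E' > E, ∃ Φ ∈ Q, Φ ≠ 0 ∧ (q Φ Φ).re < E' * ‖Φ‖ ^ 2 := by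
  set S : Set ℝ := {r | ∃ Φ ∈ Q, Φ ≠ 0 ∧ r = (q Φ Φ).re / ‖Φ‖ ^ 2} with hS
  have hSne : S.Nonempty := by
    obtain ⟨Φ, hΦ, h0⟩ := hne
    exact ⟨_, Φ, hΦ, h0, rfl⟩
  have hSbdd : BddBelow S := by
    refine ⟨e, ?_⟩
    rintro r ⟨Φ, hΦ, h0, rfl⟩
    rw [le_div_iff₀ (by positivity)]
    exact he Φ hΦ
  have hzero : q 0 0 = 0 := by simpa using hq.smul_right 0 Q.zero_mem 0 Q.zero_mem 0
  have hE : ∀ Φ ∈ Q, sInf S * ‖Φ‖ ^ 2 ≤ (q Φ Φ).re := by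
    intro Φ hΦ
    by_cases h0 : Φ = 0
    · simp [h0, hzero]
    · rw [← le_div_iff₀ (by positivity)]
      exact csInf_le hSbdd ⟨Φ, hΦ, h0, rfl⟩
  have hE' : ∀ E' > sInf S, ∃ Φ ∈ Q, Φ ≠ 0 ∧ (q Φ Φ).re < E' * ‖Φ‖ ^ 2 := by
    intro E' hlt
    obtain ⟨r, ⟨Φ, hΦ, h0, rfl⟩, hr⟩ := exists_lt_of_csInf_lt hSne hlt
    refine ⟨Φ, hΦ, h0, ?_⟩
    rwa [div_lt_iff₀ (by positivity)] at hr
  refine ⟨sInf S, ⟨fun hres => ?_, fun z hz => ?_⟩, hE, hE'⟩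
  · obtain ⟨hsol, C, hC⟩ := hres
    have hlow : ∀ Φ ∈ Q, ‖Φ‖ ^ 2 ≤ |C| * ((q Φ Φ).re - sInf S * ‖Φ‖ ^ 2) := by
      intro Φ hΦ
      obtain ⟨Θ, hΘ, -⟩ := hsol Φ
      obtain ⟨hΘQ, hw⟩ := (mem_friedrichsGraph_iff hq hcl hE _).1 hΘ
      have hnorm : ‖Θ‖ ≤ |C| * ‖Φ‖ := by
        have h := hC _ hΘ
        simp only [add_sub_cancel_right] at h
        exact h.trans (by gcongr; exact le_abs_self C)
      have hid : ∀ Ψ ∈ Q, q Ψ Θ - (sInf S : ℝ) * inner ℂ Ψ Θ = inner ℂ Ψ Φ := by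
        intro Ψ hΨ
        have h := hw Ψ hΨ
        simp only [inner_add_right, inner_smul_right] at h
        rw [h]; ring
      have hCS := hq.norm_sq_le hE hΦ hΘQ
      rw [hid Φ hΦ, ← re_inner_self Θ, hid Θ hΘQ] at hCS
      have h1 : ‖inner ℂ Φ Φ‖ = ‖Φ‖ ^ 2 := by
        rw [inner_self_eq_norm_sq_to_K]; simp
      have h2 : (inner ℂ Θ Φ).re ≤ |C| * ‖Φ‖ ^ 2 :=
        calc (inner ℂ Θ Φ).re ≤ ‖Θ‖ * ‖Φ‖ :=
              (Complex.re_le_norm _).trans (norm_inner_le_norm _ _)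
          _ ≤ (|C| * ‖Φ‖) * ‖Φ‖ := by gcongr
          _ = _ := by ring
      have h3 : 0 ≤ (q Φ Φ).re - sInf S * ‖Φ‖ ^ 2 := sub_nonneg.2 (hE Φ hΦ)
      rw [h1] at hCS
      by_cases h0 : ‖Φ‖ = 0
      · rw [h0] at h3 ⊢
        have := mul_nonneg (abs_nonneg C) h3
        simpa using this
      · have h4 : 0 < ‖Φ‖ ^ 2 := by positivity
        have h5 := mul_le_mul_of_nonneg_left h2 h3
        nlinarith
    obtain ⟨Φ, hΦ, h0⟩ := hne
    have hn : 0 < ‖Φ‖ ^ 2 := by positivity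
    have hCpos : 0 < |C| := by
      by_contra hcon
      have : |C| = 0 := le_antisymm (not_lt.1 hcon) (abs_nonneg C)
      have := hlow Φ hΦ
      simp_all
    obtain ⟨Ψ, hΨ, hΨ0, hlt⟩ := hE' (sInf S + |C|⁻¹) (by linarith [inv_pos.2 hCpos])
    have h1 := hlow Ψ hΨ
    have h2 : (q Ψ Ψ).re - sInf S * ‖Ψ‖ ^ 2 < |C|⁻¹ * ‖Ψ‖ ^ 2 := by linarith
    have h3 := mul_lt_mul_of_pos_left h2 hCpos
    rw [mul_inv_cancel_left₀ hCpos.ne'] at h3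
    linarith
  · by_contra hlt
    exact hz (inResolventSet_of_lt hq hcl hE (not_le.1 hlt))

end ClosedForms

/-! ### Photon sectors of the configuration space -/

section Sectors

open scoped ENNReal

instance (N : ℕ) : SigmaFinite (electronMeasure N) := by
  unfold electronMeasure; infer_instance

instance : SigmaFinite modeMeasure := by
  unfold modeMeasure; infer_instance

instance : SFinite photonMeasure := by
  unfold photonMeasure; infer_instance

theorem measurableEmbedding_sigmaMk (n : ℕ) :
    MeasurableEmbedding (fun K : Fin n → Mode => (⟨n, K⟩ : PhotonConf)) := by
  have hinj : ∀ m, Function.Injective (fun K : Fin m → Mode => (⟨m, K⟩ : PhotonConf)) :=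
    fun m _ _ h => eq_of_heq (Sigma.mk.inj h).2
  refine ⟨hinj n, measurable_iff_le_map.2 (iInf_le _ n), fun s hs => ?_⟩
  refine MeasurableSpace.measurableSet_iInf.2 fun m => ?_
  change MeasurableSet ((fun K : Fin m → Mode => (⟨m, K⟩ : PhotonConf)) ⁻¹'
    ((fun K : Fin n → Mode => (⟨n, K⟩ : PhotonConf)) '' s))
  by_cases h : m = n
  · subst h
    rwa [Set.preimage_image_eq _ (hinj m)]
  · convert MeasurableSet.empty
    ext K
    simp only [Set.mem_preimage, Set.mem_image, Sigma.mk.injEq, Set.mem_empty_iff_false,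
      iff_false, not_exists, not_and]
    rintro K' - hn
    exact absurd hn.symm h

variable {N : ℕ}

/-- The `n`-photon sector of the configuration space. -/
def sector (n : ℕ) (y : ElectronConf N × (Fin n → Mode)) : Conf N := (y.1, ⟨n, y.2⟩)

variable (N) in
/-- The measure on the `n`-photon sector. -/
def sectorMeasure (n : ℕ) : Measure (ElectronConf N × (Fin n → Mode)) :=
  (electronMeasure N).prod (Measure.pi fun _ : Fin n => modeMeasure)

instance (n : ℕ) : SigmaFinite (sectorMeasure N n) := by
  unfold sectorMeasure; infer_instance

theorem measurableEmbedding_sector (n : ℕ) : MeasurableEmbedding (sector (N := N) n) :=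
  MeasurableEmbedding.id.prodMap (measurableEmbedding_sigmaMk n)

variable (N) in
theorem confMeasure_eq_sum :
    confMeasure N = Measure.sum fun n => (sectorMeasure N n).map (sector n) := by
  rw [confMeasure, photonMeasure, Measure.prod_sum_right]
  congr 1
  funext n
  conv_lhs => rw [← Measure.map_id (μ := electronMeasure N)]
  exact Measure.map_prod_map _ _ measurable_id (measurableEmbedding_sigmaMk n).measurable

theorem lintegral_confMeasure (F : Conf N → ℝ≥0∞) :
    ∫⁻ z, F z ∂confMeasure N = ∑' n, ∫⁻ y, F (sector n y) ∂sectorMeasure N n := by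
  rw [confMeasure_eq_sum, lintegral_sum_measure]
  simp only [(measurableEmbedding_sector _).lintegral_map]

theorem ae_confMeasure_iff {P : Conf N → Prop} :
    (∀ᵐ z ∂confMeasure N, P z) ↔ ∀ n, ∀ᵐ y ∂sectorMeasure N n, P (sector n y) := by
  rw [confMeasure_eq_sum, Measure.ae_sum_iff]
  simp only [(measurableEmbedding_sector _).ae_map_iff]

theorem measurable_of_sectors {β : Type*} [MeasurableSpace β] {F : Conf N → β}
    (h : ∀ n, Measurable fun y => F (sector n y)) : Measurable F := by
  intro s hs
  have : F ⁻¹' s = ⋃ n, sector n '' ((fun y => F (sector n y)) ⁻¹' s) := by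
    ext ⟨Z, n, K⟩
    simp only [Set.mem_preimage, Set.mem_iUnion, Set.mem_image]
    constructor
    · intro hz
      exact ⟨n, (Z, K), hz, rfl⟩
    · rintro ⟨m, y, hy, hyz⟩
      rwa [← hyz]
  rw [this]
  exact MeasurableSet.iUnion fun n =>
    (measurableEmbedding_sector n).measurableSet_image.2 (h n hs)

theorem hasSum_integral_sector {F : Conf N → ℂ} (hF : Integrable F (confMeasure N)) :
    HasSum (fun n => ∫ y, F (sector n y) ∂sectorMeasure N n) (∫ z, F z ∂confMeasure N) := by
  rw [confMeasure_eq_sum] at hF ⊢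
  have := hasSum_integral_measure hF
  simpa only [(measurableEmbedding_sector _).integral_map] using this

end Sectors

/-! ### Completeness of the Hilbert space -/

section Statistics

theorem measurePreserving_comp_perm {ι E : Type*} [Fintype ι] [MeasurableSpace E] (ν : Measure E)
    [SigmaFinite ν] (τ : Equiv.Perm ι) :
    MeasurePreserving (fun K : ι → E => K ∘ τ) (Measure.pi fun _ => ν)
      (Measure.pi fun _ => ν) := by
  have h := measurePreserving_piCongrLeft (fun _ : ι => ν) τ.symm
  convert h using 1
  funext K i
  simp [MeasurableEquiv.piCongrLeft, Equiv.piCongrLeft]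

theorem measurePreserving_count {ι : Type*} [MeasurableSpace ι] [MeasurableSingletonClass ι]
    [Countable ι] (e : Equiv.Perm ι) :
    MeasurePreserving e (Measure.count : Measure ι) Measure.count := by
  refine ⟨measurable_of_countable _, Measure.ext fun s hs => ?_⟩
  rw [Measure.map_apply (measurable_of_countable _) hs, Measure.count_apply hs,
    Measure.count_apply (measurable_of_countable _ hs), ← e.image_symm_eq_preimage,
    (e.symm.injective.injOn).encard_image]

variable {N : ℕ}

/-- A permutation of the electrons together with permutations of the photons in each sector. -/
def permute (σ : Equiv.Perm (Fin N)) (τ : ∀ n, Equiv.Perm (Fin n)) (z : Conf N) : Conf N :=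
  ((z.1.1 ∘ σ, z.1.2 ∘ σ), ⟨z.2.1, z.2.2 ∘ τ z.2.1⟩)

theorem measurePreserving_electron_perm (σ : Equiv.Perm (Fin N)) :
    MeasurePreserving (fun Z : ElectronConf N => (Z.1 ∘ σ, Z.2 ∘ σ))
      (electronMeasure N) (electronMeasure N) :=
  (measurePreserving_comp_perm volume σ).prod
    (measurePreserving_count (Equiv.arrowCongr σ.symm (Equiv.refl (Fin 2))))

theorem measurePreserving_permute (σ : Equiv.Perm (Fin N)) (τ : ∀ n, Equiv.Perm (Fin n)) :
    MeasurePreserving (permute σ τ) (confMeasure N) (confMeasure N) := by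
  have hsec : ∀ n, MeasurePreserving
      (fun y : ElectronConf N × (Fin n → Mode) => ((y.1.1 ∘ σ, y.1.2 ∘ σ), y.2 ∘ τ n))
      (sectorMeasure N n) (sectorMeasure N n) := fun n =>
    (measurePreserving_electron_perm σ).prod (measurePreserving_comp_perm modeMeasure (τ n))
  have hmeas : Measurable (permute (N := N) σ τ) := measurable_of_sectors fun n =>
    (measurableEmbedding_sector n).measurable.comp (hsec n).measurable
  refine ⟨hmeas, ?_⟩
  rw [confMeasure_eq_sum, Measure.map_sum hmeas.aemeasurable]
  congr 1
  funext n
  rw [Measure.map_map hmeas (measurableEmbedding_sector n).measurable]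
  conv_rhs => rw [← (hsec n).map_eq]
  rw [Measure.map_map (measurableEmbedding_sector n).measurable (hsec n).measurable]
  rfl

theorem HasStatistics.permute {f : Conf N → ℂ} (hf : HasStatistics f) (σ : Equiv.Perm (Fin N))
    (τ : ∀ n, Equiv.Perm (Fin n)) (z : Conf N) :
    f (permute σ τ z) = ((Equiv.Perm.sign σ : ℤ) : ℂ) * f z := by
  obtain ⟨⟨X, s⟩, n, K⟩ := z
  exact (hf.electrons σ X s _).trans (by rw [hf.photons])

/-- Membership in the Hilbert space is symmetry almost everywhere; an exactly symmetric
representative is obtained by averaging over the permutation groups. -/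
theorem mem_hilbert_iff (Ψ : Lp ℂ 2 (confMeasure N)) :
    Ψ ∈ hilbert N ↔ ∀ (σ : Equiv.Perm (Fin N)) (τ : ∀ n, Equiv.Perm (Fin n)),
      (fun z => Ψ (permute σ τ z)) =ᵐ[confMeasure N]
        fun z => ((Equiv.Perm.sign σ : ℤ) : ℂ) * Ψ z := by
  constructor
  · rintro ⟨f, hf, hΨ⟩ σ τ
    filter_upwards [hΨ, (measurePreserving_permute σ τ).quasiMeasurePreserving.ae hΨ] with z h1 h2
    rw [h1, h2, hf.permute]
  · intro h
    let S : Conf N → ℂ := fun z =>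
      ((Nat.factorial N : ℂ)⁻¹ * (Nat.factorial z.2.1 : ℂ)⁻¹) *
        ∑ σ : Equiv.Perm (Fin N), ∑ τ : Equiv.Perm (Fin z.2.1),
          ((Equiv.Perm.sign σ : ℤ) : ℂ) * Ψ ((z.1.1 ∘ σ, z.1.2 ∘ σ), ⟨z.2.1, z.2.2 ∘ τ⟩)
    refine ⟨S, ⟨fun σ₀ X s κ => ?_, fun n τ₀ Z K => ?_⟩, ?_⟩
    · simp only [S]
      rw [mul_left_comm]
      congr 1
      rw [Finset.mul_sum]
      refine Fintype.sum_equiv (Equiv.mulLeft σ₀) _ _ fun σ => ?_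
      rw [Finset.mul_sum]
      refine Finset.sum_congr rfl fun τ _ => ?_
      have hs : ((Equiv.Perm.sign σ₀ : ℤ) : ℂ) * ((Equiv.Perm.sign σ₀ : ℤ) : ℂ) = 1 := by
        rw [← Int.cast_mul, ← Units.val_mul, Int.units_mul_self]; simp
      simp only [Equiv.coe_mulLeft, Equiv.Perm.sign_mul, Units.val_mul, Int.cast_mul,
        Equiv.Perm.coe_mul]
      rw [← mul_assoc, ← mul_assoc, hs, one_mul]
      rfl
    · simp only [S]
      congr 1
      refine Finset.sum_congr rfl fun σ _ => ?_
      refine Fintype.sum_equiv (Equiv.mulLeft τ₀) _ _ fun τ => ?_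
      simp only [Equiv.coe_mulLeft, Equiv.Perm.coe_mul]
      rfl
    · rw [Filter.EventuallyEq, ae_confMeasure_iff]
      intro n
      have h2 : ∀ᵐ y ∂sectorMeasure N n, ∀ (σ : Equiv.Perm (Fin N)) (τ : Equiv.Perm (Fin n)),
          Ψ ((y.1.1 ∘ σ, y.1.2 ∘ σ), ⟨n, y.2 ∘ τ⟩) =
            ((Equiv.Perm.sign σ : ℤ) : ℂ) * Ψ (sector n y) := by
        rw [ae_all_iff]; intro σ
        rw [ae_all_iff]; intro τ
        have h3 := ae_confMeasure_iff.1 (h σ (Function.update (fun m => Equiv.refl _) n τ)) n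
        filter_upwards [h3] with y hy
        simp only [permute, sector, Function.update_self] at hy
        exact hy
      filter_upwards [h2] with y hy
      have hs : ∀ σ : Equiv.Perm (Fin N),
          ((Equiv.Perm.sign σ : ℤ) : ℂ) * ((Equiv.Perm.sign σ : ℤ) : ℂ) = 1 := fun σ => by
        rw [← Int.cast_mul, ← Units.val_mul, Int.units_mul_self]; simp
      change Ψ (sector n y) = ((Nat.factorial N : ℂ)⁻¹ * (Nat.factorial n : ℂ)⁻¹) *
        ∑ σ : Equiv.Perm (Fin N), ∑ τ : Equiv.Perm (Fin n),
          ((Equiv.Perm.sign σ : ℤ) : ℂ) * Ψ ((y.1.1 ∘ σ, y.1.2 ∘ σ), ⟨n, y.2 ∘ τ⟩)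
      simp only [hy, ← mul_assoc, hs, one_mul, Finset.sum_const, Finset.card_univ,
        Fintype.card_perm, Fintype.card_fin, nsmul_eq_mul]
      have h4 : (Nat.factorial N : ℂ) ≠ 0 := Nat.cast_ne_zero.2 (Nat.factorial_ne_zero N)
      have h5 : (Nat.factorial n : ℂ) ≠ 0 := Nat.cast_ne_zero.2 (Nat.factorial_ne_zero n)
      field_simp

theorem isClosed_hilbert (N : ℕ) : IsClosed (hilbert N : Set (Lp ℂ 2 (confMeasure N))) := by
  have h : (hilbert N : Set (Lp ℂ 2 (confMeasure N))) =
      ⋂ (σ : Equiv.Perm (Fin N)) (τ : ∀ n, Equiv.Perm (Fin n)),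
        {Ψ | Lp.compMeasurePreserving (permute σ τ) (measurePreserving_permute σ τ) Ψ =
          ((Equiv.Perm.sign σ : ℤ) : ℂ) • Ψ} := by
    ext Ψ
    simp only [SetLike.mem_coe, mem_hilbert_iff, Set.mem_iInter, Set.mem_ofPred_eq]
    refine forall_congr' fun σ => forall_congr' fun τ => ?_
    rw [Lp.ext_iff]
    have h1 := Lp.coeFn_compMeasurePreserving Ψ (measurePreserving_permute σ τ)
    have h2 := Lp.coeFn_smul ((Equiv.Perm.sign σ : ℤ) : ℂ) Ψ
    exact ⟨fun h => h1.trans (h.trans h2.symm), fun h => h1.symm.trans (h.trans h2)⟩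
  rw [h]
  refine isClosed_iInter fun σ => isClosed_iInter fun τ => isClosed_eq ?_ (continuous_const_smul _)
  exact (Lp.isometry_compMeasurePreserving (measurePreserving_permute σ τ)).continuous

instance (N : ℕ) : CompleteSpace (hilbert N) := (isClosed_hilbert N).completeSpace_coe

end Statistics

/-! ### Bounds for creation and annihilation operators -/

section Fields

open scoped ENNReal

theorem eLpNorm_two_sq {X : Type*} [MeasurableSpace X] (μ : Measure X) (f : X → ℂ) :
    eLpNorm f 2 μ ^ 2 = ∫⁻ x, ‖f x‖ₑ ^ 2 ∂μ := by
  have h := eLpNorm_nnreal_pow_eq_lintegral (μ := μ) (f := f) (p := 2) (by norm_num)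
  simpa using h

theorem memLp_two_iff {X : Type*} [MeasurableSpace X] {μ : Measure X} {f : X → ℂ}
    (hf : AEStronglyMeasurable f μ) : MemLp f 2 μ ↔ ∫⁻ x, ‖f x‖ₑ ^ 2 ∂μ < ⊤ := by
  rw [← eLpNorm_two_sq, MemLp]
  simp [hf, ENNReal.pow_lt_top_iff]

/-- Cauchy–Schwarz inequality for the Lebesgue integral. -/
theorem sq_lintegral_mul_le {X : Type*} [MeasurableSpace X] (μ : Measure X) {F G : X → ℝ≥0∞}
    (hF : AEMeasurable F μ) (hG : AEMeasurable G μ) :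
    (∫⁻ x, F x * G x ∂μ) ^ 2 ≤ (∫⁻ x, F x ^ 2 ∂μ) * ∫⁻ x, G x ^ 2 ∂μ := by
  have h := ENNReal.lintegral_mul_le_Lp_mul_Lq μ (p := 2) (q := 2) ⟨by norm_num, by norm_num,
    by norm_num⟩ hF hG
  have h2 := pow_le_pow_left₀ (zero_le (a := ∫⁻ x, (F * G) x ∂μ)) h 2
  have h3 : ∀ a : ℝ≥0∞, (a ^ (1 / (2 : ℝ))) ^ 2 = a := fun a => by
    rw [← ENNReal.rpow_natCast, ← ENNReal.rpow_mul]; norm_num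
  rw [mul_pow, h3, h3] at h2
  simpa using h2

variable {N : ℕ}

/-- Symmetry under permutations of the photons, almost everywhere. -/
def PhotonSymmetric (f : Conf N → ℂ) : Prop :=
  ∀ τ : ∀ n, Equiv.Perm (Fin n), (fun z => f (permute 1 τ z)) =ᵐ[confMeasure N] f

theorem photonSymmetric_of_mem {Ψ : Lp ℂ 2 (confMeasure N)} (hΨ : Ψ ∈ hilbert N) :
    PhotonSymmetric Ψ := fun τ => by
  simpa using (mem_hilbert_iff Ψ).1 hΨ 1 τ

/-- The configurations with `n + 1` photons as configurations with `n` photons and one more photon,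
which becomes number `l`. -/
def insertPhoton (N n : ℕ) (l : Fin (n + 1)) :
    ((ElectronConf N × (Fin n → Mode)) × Mode) ≃ᵐ (ElectronConf N × (Fin (n + 1) → Mode)) :=
  MeasurableEquiv.prodAssoc.trans ((MeasurableEquiv.refl _).prodCongr
    (MeasurableEquiv.prodComm.trans (MeasurableEquiv.piFinSuccAbove (fun _ => Mode) l).symm))

@[simp] theorem insertPhoton_apply (n : ℕ) (l : Fin (n + 1))
    (p : (ElectronConf N × (Fin n → Mode)) × Mode) :
    insertPhoton N n l p = (p.1.1, l.insertNth p.2 p.1.2) := rfl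

theorem measurePreserving_insertPhoton (n : ℕ) (l : Fin (n + 1)) :
    MeasurePreserving (insertPhoton N n l) ((sectorMeasure N n).prod modeMeasure)
      (sectorMeasure N (n + 1)) := by
  have h1 : MeasurePreserving (MeasurableEquiv.prodAssoc)
      ((sectorMeasure N n).prod modeMeasure) ((electronMeasure N).prod
        ((Measure.pi fun _ : Fin n => modeMeasure).prod modeMeasure)) :=
    measurePreserving_prodAssoc _ _ _
  have h2 := ((measurePreserving_piFinSuccAbove (fun _ : Fin (n + 1) => modeMeasure) l).symm).comp
    (Measure.measurePreserving_swap (μ := (Measure.pi fun _ : Fin n => modeMeasure))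
      (ν := modeMeasure))
  exact ((MeasurePreserving.id (electronMeasure N)).prod h2).comp h1

theorem lintegral_sector_succ {n : ℕ} (l : Fin (n + 1))
    {F : ElectronConf N × (Fin (n + 1) → Mode) → ℝ≥0∞} (hF : Measurable F) :
    ∫⁻ y, F y ∂sectorMeasure N (n + 1) =
      ∫⁻ y, ∫⁻ k, F (y.1, l.insertNth k y.2) ∂modeMeasure ∂sectorMeasure N n := by
  rw [← (measurePreserving_insertPhoton n l).lintegral_comp_emb
    (insertPhoton N n l).measurableEmbedding, lintegral_prod]
  · rfl
  · exact (hF.comp (insertPhoton N n l).measurable).aemeasurable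

theorem measurable_dispersion (m : ℝ) : Measurable (dispersion m) := by
  unfold dispersion; fun_prop

theorem dispersion_nonneg (m : ℝ) (k : Space) : 0 ≤ dispersion m k := Real.sqrt_nonneg _

theorem fieldEnergy_nonneg (m : ℝ) (κ : PhotonConf) : 0 ≤ fieldEnergy m κ :=
  Finset.sum_nonneg fun _ _ => dispersion_nonneg m _

theorem measurable_fieldEnergy (m : ℝ) : Measurable fun z : Conf N => fieldEnergy m z.2 := by
  refine measurable_of_sectors fun n => ?_
  change Measurable fun y : ElectronConf N × (Fin n → Mode) => ∑ l, dispersion m (y.2 l).1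
  refine Finset.measurable_sum _ fun l _ => (measurable_dispersion m).comp ?_
  fun_prop

/-- The coefficient `h` of an annihilation operator is dominated by the photon energy `|k|` times an
integrable function `U`. Both `∫ |h|²` and `∫ |h|² / |k|` are then bounded uniformly in the
electrons. -/
structure FormFactorBound (h : ElectronConf N → Mode → ℂ) (U : Mode → ℝ) : Prop where
  measurable : Measurable fun p : ElectronConf N × Mode => h p.1 p.2
  measurable_bound : Measurable U
  nonneg : ∀ k, 0 ≤ U k
  norm_sq_le : ∀ Z k, ‖h Z k‖ ^ 2 ≤ dispersion 0 k.1 * U k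
  lintegral_lt_top : ∫⁻ k, ENNReal.ofReal (U k) ∂modeMeasure < ⊤
  lintegral_mul_lt_top :
    ∫⁻ k, ENNReal.ofReal (dispersion 0 k.1 * U k) ∂modeMeasure < ⊤

variable {h : ElectronConf N → Mode → ℂ} {U : Mode → ℝ}

theorem annihilate_sector (h : ElectronConf N → Mode → ℂ) (f : Conf N → ℂ) (n : ℕ)
    (y : ElectronConf N × (Fin n → Mode)) :
    annihilate h f (sector n y) = (Real.sqrt (n + 1) : ℂ) *
      ∫ k, h y.1 k * f (sector (n + 1) (y.1, (0 : Fin (n + 1)).insertNth k y.2)) ∂modeMeasure := by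
  simp only [Fin.insertNth_zero']
  rfl

theorem create_sector_succ (h : ElectronConf N → Mode → ℂ) (f : Conf N → ℂ) (n : ℕ)
    (y : ElectronConf N × (Fin (n + 1) → Mode)) :
    create h f (sector (n + 1) y) = ((Real.sqrt (n + 1))⁻¹ : ℂ) *
      ∑ l : Fin (n + 1), conj (h y.1 (y.2 l)) * f (sector n (y.1, fun r => y.2 (l.succAbove r))) :=
  rfl

theorem measurable_annihilate (hh : Measurable fun p : ElectronConf N × Mode => h p.1 p.2)
    {f : Conf N → ℂ} (hf : Measurable f) : Measurable (annihilate h f) := by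
  refine measurable_of_sectors fun n => ?_
  simp only [annihilate_sector]
  refine Measurable.const_mul ?_ _
  have hm : Measurable fun p : (ElectronConf N × (Fin n → Mode)) × Mode =>
      h p.1.1 p.2 * f (sector (n + 1) (insertPhoton N n 0 p)) :=
    (hh.comp (by fun_prop : Measurable fun p : (ElectronConf N × (Fin n → Mode)) × Mode =>
      (p.1.1, p.2))).mul
      (hf.comp ((measurableEmbedding_sector _).measurable.comp (insertPhoton N n 0).measurable))
  exact (hm.stronglyMeasurable.integral_prod_right (ν := modeMeasure)).measurable

theorem measurable_create (hh : Measurable fun p : ElectronConf N × Mode => h p.1 p.2)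
    {f : Conf N → ℂ} (hf : Measurable f) : Measurable (create h f) := by
  refine measurable_of_sectors fun n => ?_
  cases n with
  | zero => exact measurable_const
  | succ n =>
    simp only [create_sector_succ]
    refine Measurable.const_mul (Finset.measurable_sum _ fun l _ => Measurable.mul ?_ ?_) _
    · exact Complex.continuous_conj.measurable.comp (hh.comp (by fun_prop :
        Measurable fun y : ElectronConf N × (Fin (n + 1) → Mode) => (y.1, y.2 l)))
    · exact hf.comp ((measurableEmbedding_sector _).measurable.comp (by fun_prop))

/-- The expectation of the massless field energy, as an extended nonnegative number. -/
def photonEnergy (f : Conf N → ℂ) : ℝ≥0∞ :=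
  ∫⁻ z, ENNReal.ofReal (fieldEnergy 0 z.2) * ‖f z‖ₑ ^ 2 ∂confMeasure N

/-- The operator bound `‖a(h) f‖² ≤ (∫ |h|² / |k|) ⟨f, H_f f⟩`. -/
theorem lintegral_annihilate_le (hU : FormFactorBound h U) {f : Conf N → ℂ} (hf : Measurable f)
    (hsymm : PhotonSymmetric f) :
    ∫⁻ z, ‖annihilate h f z‖ₑ ^ 2 ∂confMeasure N ≤
      (∫⁻ k, ENNReal.ofReal (U k) ∂modeMeasure) * photonEnergy f := by
  have hω : Measurable fun k : Mode => dispersion 0 k.1 :=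
    (measurable_dispersion 0).comp measurable_fst
  have hfs : ∀ n, Measurable fun y : ElectronConf N × (Fin n → Mode) => f (sector n y) :=
    fun n => hf.comp (measurableEmbedding_sector n).measurable
  set C := ∫⁻ k, ENNReal.ofReal (U k) ∂modeMeasure with hC
  -- On the `n`-photon sector the bound involves the energy of the first of `n + 1` photons.
  have hpt : ∀ (n : ℕ) (y : ElectronConf N × (Fin n → Mode)),
      ‖annihilate h f (sector n y)‖ₑ ^ 2 ≤ ((n : ℝ≥0∞) + 1) * (C *
        ∫⁻ k, ENNReal.ofReal (dispersion 0 k.1) *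
          ‖f (sector (n + 1) (y.1, (0 : Fin (n + 1)).insertNth k y.2))‖ₑ ^ 2 ∂modeMeasure) := by
    intro n y
    rw [annihilate_sector, enorm_mul, mul_pow]
    have hsq : ‖((Real.sqrt (n + 1) : ℝ) : ℂ)‖ₑ ^ 2 = (n : ℝ≥0∞) + 1 := by
      rw [← ofReal_norm, ← ENNReal.ofReal_pow (norm_nonneg _), Complex.norm_real,
        Real.norm_of_nonneg (Real.sqrt_nonneg _), Real.sq_sqrt (by positivity),
        ENNReal.ofReal_add (by positivity) zero_le_one]
      simp
    rw [hsq]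
    gcongr
    have hfk : Measurable fun k : Mode =>
        f (sector (n + 1) (y.1, (0 : Fin (n + 1)).insertNth k y.2)) :=
      (hfs (n + 1)).comp ((insertPhoton N n 0).measurable.comp
        (by fun_prop : Measurable fun k : Mode => (y, k)))
    have h1 : ‖∫ k, h y.1 k * f (sector (n + 1) (y.1, (0 : Fin (n + 1)).insertNth k y.2))
        ∂modeMeasure‖ₑ ≤ ∫⁻ k, ENNReal.ofReal (Real.sqrt (U k)) *
          (ENNReal.ofReal (Real.sqrt (dispersion 0 k.1)) *
          ‖f (sector (n + 1) (y.1, (0 : Fin (n + 1)).insertNth k y.2))‖ₑ) ∂modeMeasure := by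
      refine (enorm_integral_le_lintegral_enorm _).trans (lintegral_mono fun k => ?_)
      rw [enorm_mul, ← mul_assoc, ← ENNReal.ofReal_mul (Real.sqrt_nonneg _),
        ← Real.sqrt_mul (hU.nonneg k), mul_comm (U k)]
      gcongr
      rw [← ofReal_norm]
      exact ENNReal.ofReal_le_ofReal (Real.le_sqrt_of_sq_le (hU.norm_sq_le _ _))
    refine (pow_le_pow_left₀ zero_le h1 2).trans
      ((sq_lintegral_mul_le _ (hU.measurable_bound.sqrt.ennreal_ofReal).aemeasurable
        (hω.sqrt.ennreal_ofReal.mul hfk.enorm).aemeasurable).trans (le_of_eq ?_))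
    congr 1
    · refine lintegral_congr fun k => ?_
      rw [← ENNReal.ofReal_pow (Real.sqrt_nonneg _), Real.sq_sqrt (hU.nonneg k)]
    · refine lintegral_congr fun k => ?_
      rw [Pi.mul_apply, mul_pow, ← ENNReal.ofReal_pow (Real.sqrt_nonneg _),
        Real.sq_sqrt (dispersion_nonneg _ _)]
  -- By symmetry each of the `n + 1` photons carries the same share of the energy.
  have hshare : ∀ (n : ℕ) (l : Fin (n + 1)),
      ∫⁻ y, ENNReal.ofReal (dispersion 0 (y.2 0).1) * ‖f (sector (n + 1) y)‖ₑ ^ 2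
        ∂sectorMeasure N (n + 1) =
      ∫⁻ y, ENNReal.ofReal (dispersion 0 (y.2 l).1) * ‖f (sector (n + 1) y)‖ₑ ^ 2
        ∂sectorMeasure N (n + 1) := by
    intro n l
    let τ : Equiv.Perm (Fin (n + 1)) := Equiv.swap 0 l
    have hτ : MeasurePreserving
        (fun y : ElectronConf N × (Fin (n + 1) → Mode) => (y.1, y.2 ∘ τ))
        (sectorMeasure N (n + 1)) (sectorMeasure N (n + 1)) :=
      (MeasurePreserving.id _).prod (measurePreserving_comp_perm modeMeasure τ)
    rw [← hτ.lintegral_comp]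
    · have hs := ae_confMeasure_iff.1
        (hsymm (Function.update (fun m => Equiv.refl _) (n + 1) τ)) (n + 1)
      refine lintegral_congr_ae ?_
      filter_upwards [hs] with y hy
      have hy' : f (sector (n + 1) (y.1, y.2 ∘ τ)) = f (sector (n + 1) y) := by
        simp only [permute, sector, Function.update_self] at hy
        exact hy
      rw [hy']
      simp [τ]
    · exact (hω.comp (by fun_prop)).ennreal_ofReal.mul ((hfs (n + 1)).enorm.pow_const 2)
  calc ∫⁻ z, ‖annihilate h f z‖ₑ ^ 2 ∂confMeasure N
      = ∑' n, ∫⁻ y, ‖annihilate h f (sector n y)‖ₑ ^ 2 ∂sectorMeasure N n :=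
        lintegral_confMeasure _
    _ ≤ ∑' n : ℕ, C * ∫⁻ y, ENNReal.ofReal (fieldEnergy 0 (sector (n + 1) y).2) *
          ‖f (sector (n + 1) y)‖ₑ ^ 2 ∂sectorMeasure N (n + 1) := by
        refine ENNReal.tsum_le_tsum fun n => ?_
        refine (lintegral_mono (hpt n)).trans (le_of_eq ?_)
        have hm0 : ∀ l : Fin (n + 1), Measurable fun y : ElectronConf N × (Fin (n + 1) → Mode) =>
            ENNReal.ofReal (dispersion 0 (y.2 l).1) * ‖f (sector (n + 1) y)‖ₑ ^ 2 := fun l =>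
          (hω.comp (by fun_prop)).ennreal_ofReal.mul ((hfs (n + 1)).enorm.pow_const 2)
        have hinner := lintegral_sector_succ 0 (hm0 0)
        simp only [Fin.insertNth_apply_same] at hinner
        rw [lintegral_const_mul' _ _ (by simp), lintegral_const_mul' _ _ hU.lintegral_lt_top.ne,
          ← hinner, mul_left_comm]
        congr 1
        have hsum : ∀ y : ElectronConf N × (Fin (n + 1) → Mode),
            ENNReal.ofReal (fieldEnergy 0 (sector (n + 1) y).2) * ‖f (sector (n + 1) y)‖ₑ ^ 2 =
            ∑ l, ENNReal.ofReal (dispersion 0 (y.2 l).1) * ‖f (sector (n + 1) y)‖ₑ ^ 2 := by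
          intro y
          rw [← Finset.sum_mul, ← ENNReal.ofReal_sum_of_nonneg
            fun l _ => dispersion_nonneg _ _]
          rfl
        simp only [hsum]
        rw [lintegral_finsetSum _ fun l _ => hm0 l]
        rw [Finset.sum_congr rfl fun l _ => (hshare n l).symm]
        simp
    _ ≤ C * photonEnergy f := by
        rw [ENNReal.tsum_mul_left, photonEnergy, lintegral_confMeasure]
        refine mul_le_mul_right ?_ C
        rw [tsum_eq_zero_add' (f := fun n => ∫⁻ y, ENNReal.ofReal
          (fieldEnergy 0 (sector n y).2) * ‖f (sector n y)‖ₑ ^ 2 ∂sectorMeasure N n)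
          ENNReal.summable]
        exact le_add_self

/-- The operator bound `‖a*(h) f‖² ≤ (∫ |h|² / |k|) ⟨f, H_f f⟩ + (∫ |h|²) ‖f‖²`. It is a weighted
Cauchy–Schwarz inequality for the sum over the created photon, with weights the photon energies;
no symmetry of `f` is needed. -/
theorem lintegral_create_le (hU : FormFactorBound h U) {f : Conf N → ℂ} (hf : Measurable f) :
    ∫⁻ z, ‖create h f z‖ₑ ^ 2 ∂confMeasure N ≤
      (∫⁻ k, ENNReal.ofReal (U k) ∂modeMeasure) * photonEnergy f +
      (∫⁻ k, ENNReal.ofReal (dispersion 0 k.1 * U k) ∂modeMeasure) *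
        ∫⁻ z, ‖f z‖ₑ ^ 2 ∂confMeasure N := by
  have hω : Measurable fun k : Mode => dispersion 0 k.1 :=
    (measurable_dispersion 0).comp measurable_fst
  have hfs : ∀ n, Measurable fun y : ElectronConf N × (Fin n → Mode) => f (sector n y) :=
    fun n => hf.comp (measurableEmbedding_sector n).measurable
  have hEs : ∀ n, Measurable fun y : ElectronConf N × (Fin n → Mode) =>
      fieldEnergy 0 (sector n y).2 := fun n =>
    (measurable_fieldEnergy 0).comp (measurableEmbedding_sector n).measurable
  -- The integrand for the creation of photon `k` on top of the configuration `y`.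
  let G : ∀ n, (ElectronConf N × (Fin n → Mode)) → Mode → ℝ≥0∞ := fun n y k =>
    ENNReal.ofReal (U k) * (ENNReal.ofReal (fieldEnergy 0 (sector n y).2) *
      ‖f (sector n y)‖ₑ ^ 2) +
      ENNReal.ofReal (dispersion 0 k.1 * U k) * ‖f (sector n y)‖ₑ ^ 2
  have hG : ∀ n, Measurable fun p : (ElectronConf N × (Fin n → Mode)) × Mode => G n p.1 p.2 := by
    intro n
    have h1 := hU.measurable_bound.ennreal_ofReal
    have h2 := (hω.mul hU.measurable_bound).ennreal_ofReal
    have h3 := (hfs n).enorm.pow_const 2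
    have h4 := (hEs n).ennreal_ofReal
    exact ((h1.comp measurable_snd).mul ((h4.comp measurable_fst).mul (h3.comp measurable_fst))).add
      ((h2.comp measurable_snd).mul (h3.comp measurable_fst))
  have hpt : ∀ (n : ℕ) (y : ElectronConf N × (Fin (n + 1) → Mode)),
      ‖create h f (sector (n + 1) y)‖ₑ ^ 2 ≤ ((n : ℝ≥0∞) + 1)⁻¹ *
        ∑ l : Fin (n + 1), G n (y.1, fun r => y.2 (l.succAbove r)) (y.2 l) := by
    intro n y
    rw [create_sector_succ, enorm_mul, mul_pow]
    have hsq : ‖((Real.sqrt (n + 1) : ℝ) : ℂ)⁻¹‖ₑ ^ 2 = ((n : ℝ≥0∞) + 1)⁻¹ := by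
      rw [enorm_inv (by norm_cast; positivity), ← ENNReal.inv_pow, ← ofReal_norm,
        ← ENNReal.ofReal_pow (norm_nonneg _), Complex.norm_real,
        Real.norm_of_nonneg (Real.sqrt_nonneg _), Real.sq_sqrt (by positivity),
        ENNReal.ofReal_add (by positivity) zero_le_one]
      simp
    rw [hsq]
    gcongr
    have hreal : ‖∑ l : Fin (n + 1), conj (h y.1 (y.2 l)) *
        f (sector n (y.1, fun r => y.2 (l.succAbove r)))‖ ^ 2 ≤
        ∑ l : Fin (n + 1), (U (y.2 l) * (fieldEnergy 0 (sector n
            (y.1, fun r => y.2 (l.succAbove r))).2 *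
            ‖f (sector n (y.1, fun r => y.2 (l.succAbove r)))‖ ^ 2) +
          dispersion 0 (y.2 l).1 * U (y.2 l) *
            ‖f (sector n (y.1, fun r => y.2 (l.succAbove r)))‖ ^ 2) := by
      calc _ ≤ (∑ l : Fin (n + 1), ‖h y.1 (y.2 l)‖ *
              ‖f (sector n (y.1, fun r => y.2 (l.succAbove r)))‖) ^ 2 := by
            gcongr
            refine (norm_sum_le _ _).trans (Finset.sum_le_sum fun l _ => ?_)
            rw [norm_mul, RCLike.norm_conj]
        _ ≤ (∑ l : Fin (n + 1), dispersion 0 (y.2 l).1) * ∑ l : Fin (n + 1), U (y.2 l) *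
              ‖f (sector n (y.1, fun r => y.2 (l.succAbove r)))‖ ^ 2 := by
            refine Finset.sum_sq_le_sum_mul_sum_of_sq_le_mul _ (fun l _ => dispersion_nonneg _ _)
              (fun l _ => mul_nonneg (hU.nonneg _) (sq_nonneg _)) fun l _ => ?_
            rw [mul_pow, ← mul_assoc]
            gcongr
            exact hU.norm_sq_le _ _
        _ = _ := by
            rw [Finset.mul_sum]
            refine Finset.sum_congr rfl fun l _ => ?_
            have hsplit : ∑ r : Fin (n + 1), dispersion 0 (y.2 r).1 = dispersion 0 (y.2 l).1 +
                fieldEnergy 0 (sector n (y.1, fun r => y.2 (l.succAbove r))).2 := by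
              rw [Fin.sum_univ_succAbove _ l]; rfl
            rw [hsplit]; ring
    rw [← ofReal_norm, ← ENNReal.ofReal_pow (norm_nonneg _)]
    refine (ENNReal.ofReal_le_ofReal hreal).trans (le_of_eq ?_)
    rw [ENNReal.ofReal_sum_of_nonneg fun l _ => add_nonneg
      (mul_nonneg (hU.nonneg _) (mul_nonneg (fieldEnergy_nonneg _ _) (sq_nonneg _)))
      (mul_nonneg (mul_nonneg (dispersion_nonneg _ _) (hU.nonneg _)) (sq_nonneg _))]
    refine Finset.sum_congr rfl fun l _ => ?_
    have hd := dispersion_nonneg 0 (y.2 l).1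
    have hu := hU.nonneg (y.2 l)
    have he := fieldEnergy_nonneg 0 (sector n (y.1, fun r => y.2 (l.succAbove r))).2
    simp only [G]
    rw [ENNReal.ofReal_add (by positivity) (by positivity), ENNReal.ofReal_mul hu,
      ENNReal.ofReal_mul he, ENNReal.ofReal_mul (mul_nonneg hd hu),
      ENNReal.ofReal_pow (norm_nonneg _), ofReal_norm]
  have hGint : ∀ n, ∫⁻ y, ∫⁻ k, G n y k ∂modeMeasure ∂sectorMeasure N n =
      (∫⁻ k, ENNReal.ofReal (U k) ∂modeMeasure) *
        (∫⁻ y, ENNReal.ofReal (fieldEnergy 0 (sector n y).2) * ‖f (sector n y)‖ₑ ^ 2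
          ∂sectorMeasure N n) +
      (∫⁻ k, ENNReal.ofReal (dispersion 0 k.1 * U k) ∂modeMeasure) *
        ∫⁻ y, ‖f (sector n y)‖ₑ ^ 2 ∂sectorMeasure N n := by
    intro n
    have h1 := hU.measurable_bound.ennreal_ofReal
    have h2 : Measurable fun k : Mode => ENNReal.ofReal (dispersion 0 k.1 * U k) :=
      (hω.mul hU.measurable_bound).ennreal_ofReal
    have h3 := (hfs n).enorm.pow_const 2
    have h4 : Measurable fun y => ENNReal.ofReal (fieldEnergy 0 (sector n y).2) *
        ‖f (sector n y)‖ₑ ^ 2 := (hEs n).ennreal_ofReal.mul h3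
    have hin : ∀ y, ∫⁻ k, G n y k ∂modeMeasure =
        (∫⁻ k, ENNReal.ofReal (U k) ∂modeMeasure) *
          (ENNReal.ofReal (fieldEnergy 0 (sector n y).2) * ‖f (sector n y)‖ₑ ^ 2) +
        (∫⁻ k, ENNReal.ofReal (dispersion 0 k.1 * U k) ∂modeMeasure) *
          ‖f (sector n y)‖ₑ ^ 2 := by
      intro y
      simp only [G]
      rw [lintegral_add_left (h1.mul_const _), lintegral_mul_const _ h1,
        lintegral_mul_const _ h2]
    simp only [hin]
    rw [lintegral_add_left (h4.const_mul _), lintegral_const_mul _ h4,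
      lintegral_const_mul _ h3]
  calc ∫⁻ z, ‖create h f z‖ₑ ^ 2 ∂confMeasure N
      = ∑' n, ∫⁻ y, ‖create h f (sector n y)‖ₑ ^ 2 ∂sectorMeasure N n := lintegral_confMeasure _
    _ = ∑' n : ℕ, ∫⁻ y, ‖create h f (sector (n + 1) y)‖ₑ ^ 2 ∂sectorMeasure N (n + 1) := by
        rw [tsum_eq_zero_add' ENNReal.summable]
        have : ∀ y : ElectronConf N × (Fin 0 → Mode), create h f (sector 0 y) = 0 := fun _ => rfl
        simp [this]
    _ ≤ ∑' n : ℕ, ∫⁻ y, ∫⁻ k, G n y k ∂modeMeasure ∂sectorMeasure N n := by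
        refine ENNReal.tsum_le_tsum fun n => ?_
        refine (lintegral_mono (hpt n)).trans (le_of_eq ?_)
        have hGl : ∀ l : Fin (n + 1), Measurable fun y : ElectronConf N × (Fin (n + 1) → Mode) =>
            G n (y.1, fun r => y.2 (l.succAbove r)) (y.2 l) := fun l =>
          (hG n).comp (by fun_prop : Measurable fun y : ElectronConf N × (Fin (n + 1) → Mode) =>
            (((y.1, fun r => y.2 (l.succAbove r)), y.2 l) :
              (ElectronConf N × (Fin n → Mode)) × Mode))
        rw [lintegral_const_mul' _ _ (by simp), lintegral_finsetSum _ fun l _ => hGl l]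
        have heq : ∀ l : Fin (n + 1), ∫⁻ y, G n (y.1, fun r => y.2 (l.succAbove r)) (y.2 l)
            ∂sectorMeasure N (n + 1) = ∫⁻ y, ∫⁻ k, G n y k ∂modeMeasure ∂sectorMeasure N n := by
          intro l
          rw [lintegral_sector_succ l (hGl l)]
          simp only [Fin.insertNth_apply_same, Fin.insertNth_apply_succAbove]
        simp only [heq, Finset.sum_const, Finset.card_univ, Fintype.card_fin, nsmul_eq_mul]
        rw [← mul_assoc]
        have : ((n : ℝ≥0∞) + 1)⁻¹ * ((n + 1 : ℕ) : ℝ≥0∞) = 1 := by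
          push_cast
          exact ENNReal.inv_mul_cancel (by simp) (by simp)
        rw [this, one_mul]
    _ = _ := by
        simp only [hGint]
        rw [ENNReal.tsum_add, ENNReal.tsum_mul_left, ENNReal.tsum_mul_left, photonEnergy,
          lintegral_confMeasure, lintegral_confMeasure]

end Fields

/-! ### Adjointness of creation and annihilation, and the Pauli matrices -/

section Adjoint

open scoped ENNReal

variable {N : ℕ} {h : ElectronConf N → Mode → ℂ} {U : Mode → ℝ}

/-- `a*(h)` is the adjoint of `a(h)`. Only the function to which `a(h)` is applied has to be
symmetric in the photons. -/
theorem integral_conj_create_mul (hU : FormFactorBound h U) {f g : Conf N → ℂ}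
    (hf : Measurable f) (hg : Measurable g) (hf2 : MemLp f 2 (confMeasure N))
    (hg2 : MemLp g 2 (confMeasure N)) (hfE : photonEnergy f < ⊤) (hgE : photonEnergy g < ⊤)
    (hsymm : PhotonSymmetric g) :
    ∫ z, conj (create h f z) * g z ∂confMeasure N =
      ∫ z, conj (f z) * annihilate h g z ∂confMeasure N := by
  have hf2' := (memLp_two_iff hf.aestronglyMeasurable).1 hf2
  have hc2 : MemLp (create h f) 2 (confMeasure N) := by
    rw [memLp_two_iff (measurable_create hU.measurable hf).aestronglyMeasurable]
    exact (lintegral_create_le hU hf).trans_lt (ENNReal.add_lt_top.2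
      ⟨ENNReal.mul_lt_top hU.lintegral_lt_top hfE, ENNReal.mul_lt_top hU.lintegral_mul_lt_top hf2'⟩)
  have ha2 : MemLp (annihilate h g) 2 (confMeasure N) := by
    rw [memLp_two_iff (measurable_annihilate hU.measurable hg).aestronglyMeasurable]
    exact (lintegral_annihilate_le hU hg hsymm).trans_lt
      (ENNReal.mul_lt_top hU.lintegral_lt_top hgE)
  have hL : Integrable (fun z => conj (create h f z) * g z) (confMeasure N) :=
    (hc2.star).integrable_mul hg2
  have hR : Integrable (fun z => conj (f z) * annihilate h g z) (confMeasure N) :=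
    (hf2.star).integrable_mul ha2
  have hfs : ∀ n, Measurable fun y : ElectronConf N × (Fin n → Mode) => f (sector n y) :=
    fun n => hf.comp (measurableEmbedding_sector n).measurable
  have hgs : ∀ n, Measurable fun y : ElectronConf N × (Fin n → Mode) => g (sector n y) :=
    fun n => hg.comp (measurableEmbedding_sector n).measurable
  have hsec2 : ∀ {F : Conf N → ℂ}, Measurable F → MemLp F 2 (confMeasure N) → ∀ n,
      MemLp (fun y => F (sector n y)) 2 (sectorMeasure N n) := by
    intro F hF hF2 n
    have h1 := (memLp_two_iff hF.aestronglyMeasurable).1 hF2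
    have hm : Measurable fun y : ElectronConf N × (Fin n → Mode) => F (sector n y) :=
      hF.comp (measurableEmbedding_sector n).measurable
    rw [memLp_two_iff hm.aestronglyMeasurable]
    rw [lintegral_confMeasure] at h1
    exact (ENNReal.le_tsum n).trans_lt h1
  -- The contribution of the creation of photon number `l`.
  let T : ∀ n, Fin (n + 1) → ElectronConf N × (Fin (n + 1) → Mode) → ℂ := fun n l y =>
    h y.1 (y.2 l) * conj (f (sector n (y.1, fun r => y.2 (l.succAbove r)))) * g (sector (n + 1) y)
  have hT : ∀ n l, Integrable (T n l) (sectorMeasure N (n + 1)) := by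
    intro n l
    have hm : Measurable fun y : ElectronConf N × (Fin (n + 1) → Mode) => h y.1 (y.2 l) *
        conj (f (sector n (y.1, fun r => y.2 (l.succAbove r)))) :=
      (hU.measurable.comp (by fun_prop :
        Measurable fun y : ElectronConf N × (Fin (n + 1) → Mode) => (y.1, y.2 l))).mul
        (Complex.continuous_conj.measurable.comp ((hfs n).comp (by fun_prop)))
    refine MemLp.integrable_mul (p := 2) (q := 2) ?_ (hsec2 hg hg2 (n + 1))
    rw [memLp_two_iff hm.aestronglyMeasurable,
      lintegral_sector_succ l (hm.enorm.pow_const 2)]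
    simp only [Fin.insertNth_apply_same, Fin.insertNth_apply_succAbove]
    have hle : ∀ y : ElectronConf N × (Fin n → Mode),
        ∫⁻ k, ‖h y.1 k * conj (f (sector n (y.1, fun r => y.2 r)))‖ₑ ^ 2 ∂modeMeasure ≤
          (∫⁻ k, ENNReal.ofReal (dispersion 0 k.1 * U k) ∂modeMeasure) *
            ‖f (sector n y)‖ₑ ^ 2 := by
      intro y
      rw [← lintegral_mul_const' _ _ (by simp)]
      refine lintegral_mono fun k => ?_
      rw [enorm_mul, mul_pow, RCLike.enorm_conj]
      change _ * ‖f (sector n y)‖ₑ ^ 2 ≤ _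
      gcongr
      rw [← ofReal_norm, ← ENNReal.ofReal_pow (norm_nonneg _)]
      exact ENNReal.ofReal_le_ofReal (hU.norm_sq_le _ _)
    refine (lintegral_mono hle).trans_lt ?_
    rw [lintegral_const_mul' _ _ hU.lintegral_mul_lt_top.ne]
    exact ENNReal.mul_lt_top hU.lintegral_mul_lt_top
      ((memLp_two_iff (hfs n).aestronglyMeasurable).1 (hsec2 hf hf2 n))
  -- By symmetry of `g`, all these contributions are equal.
  have hTl : ∀ n l, ∫ y, T n l y ∂sectorMeasure N (n + 1) =
      ∫ y, T n 0 y ∂sectorMeasure N (n + 1) := by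
    intro n l
    rw [← (measurePreserving_insertPhoton n l).integral_comp',
      ← (measurePreserving_insertPhoton n 0).integral_comp']
    have hs := (measurePreserving_insertPhoton (N := N) n l).quasiMeasurePreserving.ae
      (ae_confMeasure_iff.1 (hsymm (Function.update (fun m => Equiv.refl _) (n + 1)
        (Fin.cycleRange l).symm)) (n + 1))
    refine integral_congr_ae ?_
    filter_upwards [hs] with p hp
    simp only [permute, sector, Function.update_self, insertPhoton_apply] at hp
    have hc : (l.insertNth p.2 p.1.2 ∘ l.cycleRange.symm : Fin (n + 1) → Mode) =
        Fin.cons p.2 p.1.2 := Fin.insertNth_comp_cycleRange_symm l p.2 p.1.2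
    simp only [T, insertPhoton_apply, Fin.insertNth_apply_same, Fin.insertNth_apply_succAbove,
      sector, Fin.insertNth_zero']
    congr 1
    exact hp.symm.trans (congrArg (fun K => g (p.1.1, ⟨n + 1, K⟩)) hc)
  have hT0 : ∀ n, ∫ y, conj (f (sector n y)) * annihilate h g (sector n y) ∂sectorMeasure N n =
      (Real.sqrt (n + 1) : ℂ) * ∫ y, T n 0 y ∂sectorMeasure N (n + 1) := by
    intro n
    have hmp := measurePreserving_insertPhoton (N := N) n 0
    rw [← hmp.integral_comp', integral_prod, ← integral_const_mul]
    · refine integral_congr_ae (ae_of_all _ fun y => ?_)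
      simp only [annihilate_sector]
      rw [mul_left_comm, ← integral_const_mul]
      congr 1
      refine integral_congr_ae (ae_of_all _ fun k => ?_)
      simp only [T, insertPhoton_apply, Fin.insertNth_apply_same, Fin.insertNth_apply_succAbove]
      ring
    · exact (hmp.integrable_comp_emb (insertPhoton N n 0).measurableEmbedding).2 (hT n 0)
  rw [← (hasSum_integral_sector hL).tsum_eq, ← (hasSum_integral_sector hR).tsum_eq]
  rw [(hasSum_integral_sector hL).summable.tsum_eq_zero_add]
  have h0 : ∀ y : ElectronConf N × (Fin 0 → Mode), create h f (sector 0 y) = 0 := fun _ => rfl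
  simp only [h0, map_zero, zero_mul, integral_zero, zero_add]
  refine tsum_congr fun n => ?_
  rw [hT0]
  have hsum : ∀ y : ElectronConf N × (Fin (n + 1) → Mode),
      conj (create h f (sector (n + 1) y)) * g (sector (n + 1) y) =
        ((Real.sqrt (n + 1))⁻¹ : ℂ) * ∑ l, T n l y := by
    intro y
    rw [create_sector_succ, map_mul, map_inv₀, Complex.conj_ofReal, map_sum, mul_assoc,
      Finset.sum_mul]
    congr 1
    refine Finset.sum_congr rfl fun l _ => ?_
    rw [map_mul, Complex.conj_conj]
  simp only [hsum]
  rw [integral_const_mul, integral_finsetSum _ fun l _ => hT n l]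
  simp only [hTl, Finset.sum_const, Finset.card_univ, Fintype.card_fin, nsmul_eq_mul]
  rw [← mul_assoc]
  congr 1
  have hs : ((Real.sqrt (n + 1) : ℝ) : ℂ) * (Real.sqrt (n + 1) : ℝ) = ((n + 1 : ℕ) : ℂ) := by
    rw [← Complex.ofReal_mul, Real.mul_self_sqrt (by positivity)]
    push_cast; rfl
  have hne : ((Real.sqrt (n + 1) : ℝ) : ℂ) ≠ 0 := by
    norm_cast; positivity
  rw [← hs, inv_mul_cancel_left₀ hne]

/-- Reversal of the spin of electron `j`. -/
def flipSpin (j : Fin N) (z : Conf N) : Conf N :=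
  ((z.1.1, Function.update z.1.2 j (1 - z.1.2 j)), z.2)

theorem flipSpin_involutive (j : Fin N) : Function.Involutive (flipSpin j) := by
  rintro ⟨⟨X, s⟩, κ⟩
  simp [flipSpin]

theorem measurePreserving_flipSpin (j : Fin N) :
    MeasurePreserving (flipSpin j) (confMeasure N) (confMeasure N) := by
  have hinv : Function.Involutive
      fun s : Fin N → Fin 2 => Function.update s j (1 - s j) := by
    intro s; simp
  exact ((MeasurePreserving.id _).prod (measurePreserving_count hinv.toPerm)).prod
    (MeasurePreserving.id _)

/-- Reversal of the spin of electron `j`, as a measurable equivalence. -/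
def flipSpinEquiv (j : Fin N) : Conf N ≃ᵐ Conf N :=
  MeasurableEquiv.ofInvolutive (flipSpin j) (flipSpin_involutive j)
    (measurePreserving_flipSpin j).measurable

theorem pauli_apply (j : Fin N) (i : Fin 3) (f : Conf N → ℂ) (z : Conf N) :
    pauli j i f z = pauliMatrix i (z.1.2 j) (z.1.2 j) * f z +
      pauliMatrix i (z.1.2 j) (1 - z.1.2 j) * f (flipSpin j z) := by
  obtain ⟨⟨X, s⟩, κ⟩ := z
  have h2 : ∀ a : Fin 2, a = 0 ∨ a = 1 := by decide
  rw [pauli, Fin.sum_univ_two]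
  simp only [flipSpin]
  rcases h2 (s j) with h | h
  · have hs : Function.update s j 0 = s := by rw [← h]; simp
    simp [h, hs]
  · have hs : Function.update s j 1 = s := by rw [← h]; simp
    simp [h, hs, add_comm]

theorem norm_pauliMatrix_le (i : Fin 3) (a b : Fin 2) : ‖pauliMatrix i a b‖ ≤ 1 := by
  fin_cases i <;> fin_cases a <;> fin_cases b <;> simp [pauliMatrix]

theorem conj_pauliMatrix (i : Fin 3) (a b : Fin 2) :
    conj (pauliMatrix i a b) = pauliMatrix i b a := by
  fin_cases i <;> fin_cases a <;> fin_cases b <;> simp [pauliMatrix]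

theorem measurable_pauli (j : Fin N) (i : Fin 3) {f : Conf N → ℂ} (hf : Measurable f) :
    Measurable (pauli j i f) := by
  have hp : ∀ F : Fin 2 → ℂ, Measurable F := fun F => measurable_of_finite F
  have : pauli j i f = fun z => pauliMatrix i (z.1.2 j) (z.1.2 j) * f z +
      pauliMatrix i (z.1.2 j) (1 - z.1.2 j) * f (flipSpin j z) := funext (pauli_apply j i f)
  rw [this]
  have hs : Measurable fun z : Conf N => z.1.2 j := by fun_prop
  exact (((hp fun a => pauliMatrix i a a).comp hs).mul hf).add
    (((hp fun a => pauliMatrix i a (1 - a)).comp hs).mul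
      (hf.comp (measurePreserving_flipSpin j).measurable))

/-- The Pauli matrices are bounded, also with a weight that depends on the photons only. -/
theorem lintegral_pauli_le (j : Fin N) (i : Fin 3) {f : Conf N → ℂ} (hf : Measurable f)
    {w : PhotonConf → ℝ≥0∞} (hw : Measurable fun z : Conf N => w z.2) :
    ∫⁻ z, w z.2 * ‖pauli j i f z‖ₑ ^ 2 ∂confMeasure N ≤
      4 * ∫⁻ z, w z.2 * ‖f z‖ₑ ^ 2 ∂confMeasure N := by
  have hpt : ∀ z : Conf N, w z.2 * ‖pauli j i f z‖ₑ ^ 2 ≤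
      2 * (w z.2 * ‖f z‖ₑ ^ 2) + 2 * (w (flipSpin j z).2 * ‖f (flipSpin j z)‖ₑ ^ 2) := by
    intro z
    have h1 : ‖pauli j i f z‖ ≤ ‖f z‖ + ‖f (flipSpin j z)‖ := by
      rw [pauli_apply]
      refine (norm_add_le _ _).trans (add_le_add ?_ ?_) <;> rw [norm_mul]
      · exact mul_le_of_le_one_left (norm_nonneg _) (norm_pauliMatrix_le _ _ _)
      · exact mul_le_of_le_one_left (norm_nonneg _) (norm_pauliMatrix_le _ _ _)
    have h2 : ‖pauli j i f z‖ ^ 2 ≤ 2 * ‖f z‖ ^ 2 + 2 * ‖f (flipSpin j z)‖ ^ 2 := by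
      nlinarith [norm_nonneg (pauli j i f z), sq_nonneg (‖f z‖ - ‖f (flipSpin j z)‖)]
    have h3 : ‖pauli j i f z‖ₑ ^ 2 ≤ 2 * ‖f z‖ₑ ^ 2 + 2 * ‖f (flipSpin j z)‖ₑ ^ 2 := by
      have h4 := ENNReal.ofReal_le_ofReal h2
      rw [ENNReal.ofReal_add (by positivity) (by positivity), ENNReal.ofReal_mul zero_le_two,
        ENNReal.ofReal_mul zero_le_two] at h4
      simpa only [ENNReal.ofReal_pow (norm_nonneg _), ofReal_norm, ENNReal.ofReal_ofNat] using h4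
    refine (mul_le_mul_right h3 (w z.2)).trans (le_of_eq ?_)
    change _ = 2 * (w z.2 * ‖f z‖ₑ ^ 2) + 2 * (w z.2 * ‖f (flipSpin j z)‖ₑ ^ 2)
    ring
  have hm : Measurable fun z : Conf N => w z.2 * ‖f z‖ₑ ^ 2 := hw.mul (hf.enorm.pow_const 2)
  have hm' : Measurable fun z : Conf N => w (flipSpin j z).2 * ‖f (flipSpin j z)‖ₑ ^ 2 :=
    hm.comp (measurePreserving_flipSpin j).measurable
  refine (lintegral_mono hpt).trans (le_of_eq ?_)
  rw [lintegral_add_left (hm.const_mul _), lintegral_const_mul _ hm, lintegral_const_mul _ hm',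
    (measurePreserving_flipSpin j).lintegral_comp hm, ← add_mul]
  norm_num

theorem memLp_pauli (j : Fin N) (i : Fin 3) {f : Conf N → ℂ} (hf : Measurable f)
    (hf2 : MemLp f 2 (confMeasure N)) : MemLp (pauli j i f) 2 (confMeasure N) := by
  rw [memLp_two_iff (measurable_pauli j i hf).aestronglyMeasurable]
  have h1 := (memLp_two_iff hf.aestronglyMeasurable).1 hf2
  have h2 := lintegral_pauli_le j i hf (w := 1) measurable_const
  simp only [Pi.one_apply, one_mul] at h2
  exact h2.trans_lt (ENNReal.mul_lt_top (by simp) h1)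

theorem photonEnergy_pauli_lt_top (j : Fin N) (i : Fin 3) {f : Conf N → ℂ} (hf : Measurable f)
    (hfE : photonEnergy f < ⊤) : photonEnergy (pauli j i f) < ⊤ :=
  (lintegral_pauli_le j i hf (w := fun κ => ENNReal.ofReal (fieldEnergy 0 κ))
    (measurable_fieldEnergy 0).ennreal_ofReal).trans_lt (ENNReal.mul_lt_top (by simp) hfE)

/-- The Pauli matrices are symmetric operators. -/
theorem integral_conj_mul_pauli (j : Fin N) (i : Fin 3) {f g : Conf N → ℂ}
    (hf2 : MemLp f 2 (confMeasure N)) (hg2 : MemLp g 2 (confMeasure N)) :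
    ∫ z, conj (f z) * pauli j i g z ∂confMeasure N =
      ∫ z, conj (pauli j i f z) * g z ∂confMeasure N := by
  have hmp : MeasurePreserving (flipSpinEquiv j) (confMeasure N) (confMeasure N) :=
    measurePreserving_flipSpin j
  have hs : Measurable fun z : Conf N => z.1.2 j := by fun_prop
  -- Multiplication by a matrix entry preserves integrability.
  have hbd : ∀ (F : Conf N → ℂ) (a b : Fin 2 → Fin 2), Integrable F (confMeasure N) →
      Integrable (fun z => pauliMatrix i (a (z.1.2 j)) (b (z.1.2 j)) * F z) (confMeasure N) := by
    intro F a b hF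
    have hm : Measurable fun c : Fin 2 => pauliMatrix i (a c) (b c) := measurable_of_finite _
    exact hF.bdd_mul (c := 1) (hm.comp hs).aestronglyMeasurable
      (ae_of_all _ fun z => norm_pauliMatrix_le _ _ _)
  have hf2' : MemLp (fun z => f (flipSpin j z)) 2 (confMeasure N) :=
    hf2.comp_measurePreserving (measurePreserving_flipSpin j)
  have hg2' : MemLp (fun z => g (flipSpin j z)) 2 (confMeasure N) :=
    hg2.comp_measurePreserving (measurePreserving_flipSpin j)
  have h1 : Integrable (fun z => conj (f z) * g z) (confMeasure N) := hf2.star.integrable_mul hg2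
  have h2 : Integrable (fun z => conj (f z) * g (flipSpin j z)) (confMeasure N) :=
    hf2.star.integrable_mul hg2'
  have h3 : Integrable (fun z => conj (f (flipSpin j z)) * g z) (confMeasure N) :=
    hf2'.star.integrable_mul hg2
  have hl : ∀ z, conj (f z) * pauli j i g z =
      pauliMatrix i (z.1.2 j) (z.1.2 j) * (conj (f z) * g z) +
      pauliMatrix i (z.1.2 j) (1 - z.1.2 j) * (conj (f z) * g (flipSpin j z)) := fun z => by
    rw [pauli_apply]; ring
  have hr : ∀ z, conj (pauli j i f z) * g z =
      pauliMatrix i (z.1.2 j) (z.1.2 j) * (conj (f z) * g z) +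
      pauliMatrix i (1 - z.1.2 j) (z.1.2 j) * (conj (f (flipSpin j z)) * g z) := fun z => by
    rw [pauli_apply, map_add, map_mul, map_mul, conj_pauliMatrix, conj_pauliMatrix]; ring
  simp only [hl, hr]
  have i1 : Integrable (fun z => pauliMatrix i (z.1.2 j) (z.1.2 j) * (conj (f z) * g z))
      (confMeasure N) := hbd _ id id h1
  have i2 : Integrable (fun z => pauliMatrix i (z.1.2 j) (1 - z.1.2 j) *
      (conj (f z) * g (flipSpin j z))) (confMeasure N) := hbd _ id (1 - ·) h2
  have i3 : Integrable (fun z => pauliMatrix i (1 - z.1.2 j) (z.1.2 j) *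
      (conj (f (flipSpin j z)) * g z)) (confMeasure N) := hbd _ (1 - ·) id h3
  rw [integral_add i1 i2, integral_add i1 i3]
  congr 1
  rw [← hmp.integral_comp' (fun z => pauliMatrix i (z.1.2 j) (1 - z.1.2 j) *
    (conj (f z) * g (flipSpin j z)))]
  refine integral_congr_ae (ae_of_all _ fun z => ?_)
  have hz : flipSpinEquiv j z = flipSpin j z := rfl
  simp only [hz, flipSpin_involutive j z]
  simp [flipSpin]

/-- If the coefficient does not depend on the spins, then `σ a(h)` and `σ a*(h)` are adjoint to
each other. -/
theorem integral_conj_mul_pauli_annihilate (hU : FormFactorBound h U)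
    (hspin : ∀ (X : Fin N → Space) (s s' : Fin N → Fin 2), h (X, s) = h (X, s'))
    (j : Fin N) (i : Fin 3) {f g : Conf N → ℂ}
    (hf : Measurable f) (hg : Measurable g) (hf2 : MemLp f 2 (confMeasure N))
    (hg2 : MemLp g 2 (confMeasure N)) (hfE : photonEnergy f < ⊤) (hgE : photonEnergy g < ⊤)
    (hsymm : PhotonSymmetric g) :
    ∫ z, conj (f z) * pauli j i (annihilate h g) z ∂confMeasure N =
      ∫ z, conj (pauli j i (create h f) z) * g z ∂confMeasure N := by
  have ha2 : MemLp (annihilate h g) 2 (confMeasure N) := by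
    rw [memLp_two_iff (measurable_annihilate hU.measurable hg).aestronglyMeasurable]
    exact (lintegral_annihilate_le hU hg hsymm).trans_lt
      (ENNReal.mul_lt_top hU.lintegral_lt_top hgE)
  rw [integral_conj_mul_pauli j i hf2 ha2,
    ← integral_conj_create_mul hU (measurable_pauli j i hf) hg (memLp_pauli j i hf hf2) hg2
      (photonEnergy_pauli_lt_top j i hf hfE) hgE hsymm]
  congr 1
  funext z
  congr 2
  obtain ⟨⟨X, s⟩, n, K⟩ := z
  cases n with
  | zero => simp [pauli, create]
  | succ n =>
    simp only [pauli, create, Finset.mul_sum]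
    rw [Finset.sum_comm]
    refine Finset.sum_congr rfl fun t _ => ?_
    refine Finset.sum_congr rfl fun l _ => ?_
    rw [hspin X (Function.update s j t) s]
    ring

end Adjoint

/-! ### The form factors of the quantized field -/

section FormFactors

open scoped ENNReal

theorem measurable_polarization (i : Fin 3) :
    Measurable fun k : Mode => polarization k.2 k.1 i := by
  have h0 : Measurable fun k : Mode => k.1 0 := by fun_prop
  have h1 : Measurable fun k : Mode => k.1 1 := by fun_prop
  have h2 : Measurable fun k : Mode => k.1 2 := by fun_prop
  have hs : MeasurableSet {k : Mode | k.2 = 0} := measurable_snd (measurableSet_singleton 0)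
  have hif : (fun k : Mode => polarization k.2 k.1 i) = fun k => if k.2 = 0 then
      ((Real.sqrt (k.1 0 ^ 2 + k.1 1 ^ 2))⁻¹ • ![k.1 1, -k.1 0, 0] : Fin 3 → ℝ) i else
      crossProduct (‖k.1‖⁻¹ • k.1.ofLp)
        ((Real.sqrt (k.1 0 ^ 2 + k.1 1 ^ 2))⁻¹ • ![k.1 1, -k.1 0, 0] : Fin 3 → ℝ) i := by
    funext k
    simp only [polarization]
    split_ifs <;> rfl
  rw [hif]
  refine Measurable.ite hs ?_ ?_
  · fin_cases i <;> simp <;> fun_prop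
  · fin_cases i <;> simp [crossProduct] <;> fun_prop

theorem abs_coord_le_norm (k : Space) (i : Fin 3) : |k i| ≤ ‖k‖ :=
  PiLp.norm_apply_le k i

theorem abs_crossProduct_le {a b : Fin 3 → ℝ} {A B : ℝ} (ha : ∀ i, |a i| ≤ A)
    (hb : ∀ i, |b i| ≤ B) (i : Fin 3) : |crossProduct a b i| ≤ 2 * (A * B) := by
  have hA : 0 ≤ A := (abs_nonneg _).trans (ha 0)
  have key : ∀ p q r s : Fin 3, |a p * b q - a r * b s| ≤ 2 * (A * B) := by
    intro p q r s
    refine (abs_sub _ _).trans ?_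
    rw [abs_mul, abs_mul]
    have h1 := mul_le_mul (ha p) (hb q) (abs_nonneg _) hA
    have h2 := mul_le_mul (ha r) (hb s) (abs_nonneg _) hA
    linarith
  fin_cases i
  · simpa [crossProduct] using key 1 2 2 1
  · simpa [crossProduct] using key 2 0 0 2
  · simpa [crossProduct] using key 0 1 1 0

/-- A crude bound, valid also on the third axis, where the polarization vectors are zero because
`0⁻¹ = 0`. -/
theorem abs_polarization_le (lam : Fin 2) (k : Space) (i : Fin 3) :
    |polarization lam k i| ≤ 2 := by
  have he : ∀ i : Fin 3,
      |((Real.sqrt (k 0 ^ 2 + k 1 ^ 2))⁻¹ • ![k 1, -k 0, 0] : Fin 3 → ℝ) i| ≤ 1 := by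
    intro i
    rw [Pi.smul_apply, smul_eq_mul, abs_mul, abs_of_nonneg (by positivity), inv_mul_eq_div]
    refine div_le_one_of_le₀ (Real.le_sqrt_of_sq_le ?_) (Real.sqrt_nonneg _)
    rw [sq_abs]
    fin_cases i <;> simp <;> positivity
  have hu : ∀ i : Fin 3, |(‖k‖⁻¹ • k.ofLp : Fin 3 → ℝ) i| ≤ 1 := by
    intro i
    rw [Pi.smul_apply, smul_eq_mul, abs_mul, abs_of_nonneg (by positivity), inv_mul_eq_div]
    exact div_le_one_of_le₀ (abs_coord_le_norm k i) (norm_nonneg _)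
  simp only [polarization]
  split_ifs
  · exact (he i).trans one_le_two
  · simpa using abs_crossProduct_le hu he i

/-- The function `C |k|⁻² 1_{|k| < Λ}`. -/
def coulombCutoff (C Λ : ℝ) (k : Mode) : ℝ := if ‖k.1‖ < Λ then C * (‖k.1‖ ^ 2)⁻¹ else 0

theorem lintegral_modeMeasure_norm_lt_top (Λ : ℝ) {F : ℝ → ℝ} (hF : Measurable F)
    (hint : IntegrableOn (fun r : ℝ => r ^ 2 * F r) (Set.Ioo 0 Λ)) :
    ∫⁻ k : Mode, ENNReal.ofReal (if ‖k.1‖ < Λ then F ‖k.1‖ else 0) ∂modeMeasure < ⊤ := by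
  have h1 : Integrable (fun k : Space => if ‖k‖ < Λ then F ‖k‖ else 0) := by
    have := (integrable_fun_norm_addHaar (volume : Measure Space)
      (f := fun r => if r < Λ then F r else 0)).2 ?_
    · exact this
    · have hd : Module.finrank ℝ Space - 1 = 2 := by simp
      rw [hd, ← integrable_indicator_iff measurableSet_Ioi]
      rw [← integrable_indicator_iff measurableSet_Ioo] at hint
      refine hint.congr (ae_of_all _ fun r => ?_)
      by_cases h0 : 0 < r <;> by_cases hL : r < Λ <;> simp [Set.indicator, h0, hL]
  have hm : Measurable fun k : Space => ENNReal.ofReal (if ‖k‖ < Λ then F ‖k‖ else 0) :=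
    (Measurable.ite (measurableSet_lt measurable_norm measurable_const) (hF.comp measurable_norm)
      measurable_const).ennreal_ofReal
  have hm' : Measurable fun k : Mode => ENNReal.ofReal (if ‖k.1‖ < Λ then F ‖k.1‖ else 0) :=
    hm.comp measurable_fst
  rw [modeMeasure, lintegral_prod _ hm'.aemeasurable]
  simp only [lintegral_const]
  rw [lintegral_mul_const _ hm]
  refine ENNReal.mul_lt_top ?_ ?_
  · exact lt_of_le_of_lt (lintegral_mono fun k => Real.ofReal_le_enorm _) h1.2
  · simp [Measure.count_apply]

/-- In three dimensions both `|k|⁻²` and `|k|⁻¹` are integrable over a ball. -/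
theorem formFactorBound_of_le {N : ℕ} {h : ElectronConf N → Mode → ℂ} {C Λ : ℝ} (hC : 0 ≤ C)
    (hmeas : Measurable fun p : ElectronConf N × Mode => h p.1 p.2)
    (hle : ∀ Z k, ‖h Z k‖ ^ 2 ≤ if ‖k.1‖ < Λ then C * ‖k.1‖⁻¹ else 0) :
    FormFactorBound h (coulombCutoff C Λ) := by
  have hdisp : ∀ k : Space, dispersion 0 k = ‖k‖ := fun k => by
    simp [dispersion, Real.sqrt_sq]
  have hmul : ∀ k : Mode, dispersion 0 k.1 * coulombCutoff C Λ k =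
      if ‖k.1‖ < Λ then C * ‖k.1‖⁻¹ else 0 := by
    intro k
    rw [hdisp, coulombCutoff]
    split_ifs
    · by_cases h0 : ‖k.1‖ = 0
      · simp [h0]
      · field_simp
    · simp
  refine ⟨hmeas, ?_, ?_, ?_, ?_, ?_⟩
  · unfold coulombCutoff
    exact Measurable.ite (measurableSet_lt measurable_fst.norm measurable_const)
      (by fun_prop) measurable_const
  · intro k
    unfold coulombCutoff
    split_ifs <;> positivity
  · intro Z k
    rw [hmul]
    exact hle Z k
  · refine lintegral_modeMeasure_norm_lt_top Λ (F := fun r => C * (r ^ 2)⁻¹) (by fun_prop) ?_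
    have hc : IntegrableOn (fun _ : ℝ => C) (Set.Ioo 0 Λ) := integrableOn_const (by simp)
    refine hc.congr_fun (fun r hr => ?_) measurableSet_Ioo
    have : r ≠ 0 := hr.1.ne'
    field_simp
  · simp only [hmul]
    refine lintegral_modeMeasure_norm_lt_top Λ (F := fun r => C * r⁻¹) (by fun_prop) ?_
    have hc : IntegrableOn (fun r : ℝ => C * r) (Set.Ioo 0 Λ) :=
      ((continuous_const.mul continuous_id).integrableOn_Icc).mono_set Set.Ioo_subset_Icc_self
    refine hc.congr_fun (fun r hr => ?_) measurableSet_Ioo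
    have : r ≠ 0 := hr.1.ne'
    field_simp

theorem norm_exp_I_mul (t : ℝ) : ‖Complex.exp (Complex.I * (t : ℂ))‖ = 1 := by
  rw [mul_comm]; exact Complex.norm_exp_ofReal_mul_I t

theorem measurable_phase {N : ℕ} (j : Fin N) :
    Measurable fun p : ElectronConf N × Mode =>
      Complex.exp (Complex.I * ((inner ℝ p.2.1 (p.1.1 j) : ℝ) : ℂ)) := by
  have h1 : Measurable fun p : ElectronConf N × Mode => p.2.1 :=
    measurable_fst.comp measurable_snd
  have h2 : Measurable fun p : ElectronConf N × Mode => p.1.1 j :=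
    (measurable_pi_apply j).comp (measurable_fst.comp measurable_fst)
  have h3 : Measurable fun p : ElectronConf N × Mode => (inner ℝ p.2.1 (p.1.1 j) : ℝ) :=
    h1.inner h2
  exact Complex.measurable_exp.comp ((Complex.measurable_ofReal.comp h3).const_mul Complex.I)

theorem measurableSet_momentum_lt {N : ℕ} (Λ : ℝ) :
    MeasurableSet {p : ElectronConf N × Mode | ‖p.2.1‖ < Λ} :=
  measurableSet_lt (by fun_prop) measurable_const

theorem formFactorBound_coeffA {N : ℕ} (Λ : ℝ) (j : Fin N) (i : Fin 3) :
    FormFactorBound (fun Z : ElectronConf N => coeffA Λ (Z.1 j) i) (coulombCutoff 4 Λ) := by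
  refine formFactorBound_of_le (by norm_num) ?_ fun Z k => ?_
  · unfold coeffA
    refine Measurable.ite (measurableSet_momentum_lt Λ) (Measurable.mul ?_ (measurable_phase j))
      measurable_const
    have := (measurable_polarization i).comp
      (measurable_snd : Measurable fun p : ElectronConf N × Mode => p.2)
    refine Complex.measurable_ofReal.comp (Measurable.mul ?_ this)
    fun_prop
  · simp only [coeffA]
    split_ifs
    · rw [norm_mul, norm_exp_I_mul, mul_one, Complex.norm_real, Real.norm_eq_abs, sq_abs, mul_pow,
        inv_pow, Real.sq_sqrt (norm_nonneg _), mul_comm]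
      gcongr
      nlinarith [abs_polarization_le k.2 k.1 i, abs_nonneg (polarization k.2 k.1 i),
        sq_abs (polarization k.2 k.1 i)]
    · simp

theorem formFactorBound_coeffB {N : ℕ} (Λ : ℝ) (j : Fin N) (i : Fin 3) :
    FormFactorBound (fun Z : ElectronConf N => coeffB Λ (Z.1 j) i)
      (coulombCutoff (16 * Λ ^ 2) Λ) := by
  refine formFactorBound_of_le (by positivity) ?_ fun Z k => ?_
  · unfold coeffB
    refine Measurable.ite (measurableSet_momentum_lt Λ) (Measurable.mul ?_ (measurable_phase j))
      measurable_const
    refine Measurable.const_mul (Complex.measurable_ofReal.comp (Measurable.mul (by fun_prop) ?_)) _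
    have hp : ∀ i, Measurable fun p : ElectronConf N × Mode => polarization p.2.2 p.2.1 i :=
      fun i => (measurable_polarization i).comp measurable_snd
    have hk : ∀ i, Measurable fun p : ElectronConf N × Mode => p.2.1 i := fun i => by fun_prop
    fin_cases i
    · simpa [crossProduct] using! ((hk 1).mul (hp 2)).sub ((hk 2).mul (hp 1))
    · simpa [crossProduct] using! ((hk 2).mul (hp 0)).sub ((hk 0).mul (hp 2))
    · simpa [crossProduct] using! ((hk 0).mul (hp 1)).sub ((hk 1).mul (hp 0))
  · simp only [coeffB]
    split_ifs with hk
    · rw [norm_mul, norm_exp_I_mul, mul_one, norm_mul, Complex.norm_I, one_mul, Complex.norm_real,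
        Real.norm_eq_abs, sq_abs, mul_pow, inv_pow, Real.sq_sqrt (norm_nonneg _), mul_comm]
      gcongr
      have h1 := abs_crossProduct_le (abs_coord_le_norm k.1) (abs_polarization_le k.2 k.1) i
      rw [← sq_abs]
      have h2 : |crossProduct k.1.ofLp (polarization k.2 k.1) i| ≤ 4 * Λ := by
        refine h1.trans ?_
        linarith
      calc _ ≤ (4 * Λ) ^ 2 := by gcongr
        _ = _ := by ring
    · simp

end FormFactors

/-! ### Weak derivatives in the electron positions -/

section WeakDerivatives

open scoped ENNReal

/-- Functions with integrals tending to zero have a subsequence tending to zero almost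
everywhere. -/
theorem exists_subseq_ae_tendsto_zero {X : Type*} [MeasurableSpace X] {μ : Measure X}
    {F : ℕ → X → ℝ≥0∞} (hF : ∀ k, AEMeasurable (F k) μ)
    (hlim : Tendsto (fun k => ∫⁻ x, F k x ∂μ) atTop (𝓝 0)) :
    ∃ ns : ℕ → ℕ, StrictMono ns ∧ ∀ᵐ x ∂μ, Tendsto (fun i => F (ns i) x) atTop (𝓝 0) := by
  have hev : ∀ i : ℕ, ∀ᶠ k in atTop, ∫⁻ x, F k x ∂μ ≤ (2⁻¹ : ℝ≥0∞) ^ i := fun i =>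
    (hlim.eventually_lt_const (ENNReal.pow_pos (by simp) i)).mono fun _ h => h.le
  obtain ⟨ns, hns, hle⟩ := extraction_forall_of_eventually hev
  refine ⟨ns, hns, ?_⟩
  have hsum : ∫⁻ x, ∑' i, F (ns i) x ∂μ ≠ ⊤ := by
    rw [lintegral_tsum fun i => hF _]
    refine ne_top_of_le_ne_top ?_ (ENNReal.tsum_le_tsum hle)
    rw [ENNReal.tsum_geometric]
    simp
  filter_upwards [ae_lt_top' (AEMeasurable.tsum fun i => hF (ns i)) hsum] with x hx
  exact ENNReal.tendsto_atTop_zero_of_tsum_ne_top hx.ne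

variable {N : ℕ}

/-- A property of almost all configurations holds, for almost all photon configurations and all
spins, at almost all electron positions. -/
theorem ae_slice {P : Conf N → Prop} (h : ∀ᵐ z ∂confMeasure N, P z) :
    ∀ᵐ κ ∂photonMeasure, ∀ s : Fin N → Fin 2, ∀ᵐ X : Fin N → Space, P ((X, s), κ) := by
  have h1 : ∀ᵐ p ∂photonMeasure.prod (electronMeasure N), P p.swap :=
    (Measure.measurePreserving_swap (μ := photonMeasure)
      (ν := electronMeasure N)).quasiMeasurePreserving.ae h
  filter_upwards [Measure.ae_ae_of_ae_prod h1] with κ hκ s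
  have h2 : ∀ᵐ q ∂(Measure.count : Measure (Fin N → Fin 2)).prod
      (volume : Measure (Fin N → Space)), P (q.swap, κ) :=
    (Measure.measurePreserving_swap (μ := (Measure.count : Measure (Fin N → Fin 2)))
      (ν := (volume : Measure (Fin N → Space)))).quasiMeasurePreserving.ae hκ
  have h3 := Measure.ae_ae_of_ae_prod h2
  rw [ae_iff, Measure.count_eq_zero_iff] at h3
  by_contra hcon
  have : s ∈ (∅ : Set (Fin N → Fin 2)) := h3 ▸ hcon
  exact this

theorem lintegral_slice {F : Conf N → ℝ≥0∞} (hF : Measurable F) :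
    ∫⁻ z, F z ∂confMeasure N =
      ∫⁻ κ, (∑ s : Fin N → Fin 2, ∫⁻ X : Fin N → Space, F ((X, s), κ)) ∂photonMeasure := by
  rw [confMeasure, lintegral_prod_symm' _ hF]
  refine lintegral_congr fun κ => ?_
  have hm : Measurable fun Z : ElectronConf N => F (Z, κ) := hF.comp (by fun_prop)
  rw [electronMeasure, lintegral_prod_symm' _ hm, lintegral_count, tsum_fintype]

theorem measurable_slice_lintegral {F : Conf N → ℝ≥0∞} (hF : Measurable F) :
    Measurable fun κ : PhotonConf =>
      ∑ s : Fin N → Fin 2, ∫⁻ X : Fin N → Space, F ((X, s), κ) := by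
  refine Finset.measurable_sum _ fun s _ => ?_
  have : Measurable fun p : PhotonConf × (Fin N → Space) => F ((p.2, s), p.1) :=
    hF.comp (by fun_prop)
  exact this.lintegral_prod_right

theorem memLp_slice {f : Conf N → ℂ} (hf : MemLp f 2 (confMeasure N)) :
    ∀ᵐ κ ∂photonMeasure, ∀ s : Fin N → Fin 2,
      MemLp (fun X : Fin N → Space => f ((X, s), κ)) 2 volume := by
  obtain ⟨f', hf'm, hff'⟩ := hf.1
  have h1 := (memLp_two_iff hf'm.aestronglyMeasurable).1 (hf.ae_eq hff')
  have hm := hf'm.measurable.enorm.pow_const 2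
  rw [lintegral_slice hm] at h1
  filter_upwards [ae_slice hff', ae_lt_top (measurable_slice_lintegral hm) h1.ne] with κ h2 h3 s
  have hms : Measurable fun X : Fin N → Space => f' ((X, s), κ) :=
    hf'm.measurable.comp (by fun_prop)
  refine MemLp.ae_eq (Filter.EventuallyEq.symm (h2 s)) ?_
  rw [memLp_two_iff hms.aestronglyMeasurable]
  exact (ENNReal.sum_lt_top.1 h3) s (Finset.mem_univ s)

theorem ae_eq_zero_of_slices {f : Conf N → ℂ} (hf : AEStronglyMeasurable f (confMeasure N))
    (h : ∀ᵐ κ ∂photonMeasure, ∀ s : Fin N → Fin 2, ∀ᵐ X : Fin N → Space, f ((X, s), κ) = 0) :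
    f =ᵐ[confMeasure N] 0 := by
  obtain ⟨f', hf'm, hff'⟩ := hf
  refine hff'.trans ?_
  have hm := hf'm.measurable.enorm
  have h0 : ∫⁻ z, ‖f' z‖ₑ ∂confMeasure N = 0 := by
    rw [lintegral_slice hm]
    refine (lintegral_congr_ae ?_).trans lintegral_zero
    filter_upwards [h, ae_slice hff'] with κ h1 h2
    refine Finset.sum_eq_zero fun s _ => ?_
    refine (lintegral_congr_ae ?_).trans lintegral_zero
    filter_upwards [h1 s, h2 s] with X hX hX'
    rw [← hX', hX, enorm_zero]
  rw [lintegral_eq_zero_iff hm] at h0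
  filter_upwards [h0] with z hz
  simpa using hz

theorem integrable_test_mul {E : Type*} [NormedAddCommGroup E] [MeasurableSpace E] [BorelSpace E]
    {μ : Measure E} [IsLocallyFiniteMeasure μ] {ψ : E → ℝ} (hψ : Continuous ψ)
    (hc : HasCompactSupport ψ) {f : E → ℂ} (hf : MemLp f 2 μ) :
    Integrable (fun X => (ψ X : ℂ) * f X) μ := by
  have h : LocallyIntegrable f μ := hf.locallyIntegrable one_le_two
  simpa only [Complex.real_smul] using h.integrable_smul_left_of_hasCompactSupport hψ hc

theorem continuous_fderiv_test {φ : (Fin N → Space) → ℝ} (hφ : ContDiff ℝ ∞ φ)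
    (e : Fin N → Space) : Continuous fun X => fderiv ℝ φ X e :=
  (hφ.continuous_fderiv (by simp)).clm_apply continuous_const

theorem hasCompactSupport_fderiv_test {φ : (Fin N → Space) → ℝ} (hc : HasCompactSupport φ)
    (e : Fin N → Space) : HasCompactSupport fun X => fderiv ℝ φ X e :=
  hc.fderiv_apply (𝕜 := ℝ) e

variable {j : Fin N} {i : Fin 3} {f f' G G' : Conf N → ℂ}

theorem IsWeakPartial.congr (h : IsWeakPartial j i f G) (hf : f =ᵐ[confMeasure N] f')
    (hG : G =ᵐ[confMeasure N] G') : IsWeakPartial j i f' G' := by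
  filter_upwards [h, ae_slice hf, ae_slice hG] with κ h1 h2 h3 s φ hφ hc
  refine Eq.trans (integral_congr_ae ((h2 s).mono fun X hX => ?_))
    ((h1 s φ hφ hc).trans (congrArg Neg.neg (integral_congr_ae ((h3 s).mono fun X hX => ?_))))
  · simp only [hX]
  · simp only [hX]

theorem IsWeakPartial.add (h : IsWeakPartial j i f G) (h' : IsWeakPartial j i f' G')
    (hf : MemLp f 2 (confMeasure N)) (hf' : MemLp f' 2 (confMeasure N))
    (hG : MemLp G 2 (confMeasure N)) (hG' : MemLp G' 2 (confMeasure N)) :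
    IsWeakPartial j i (f + f') (G + G') := by
  filter_upwards [h, h', memLp_slice hf, memLp_slice hf', memLp_slice hG, memLp_slice hG']
    with κ h1 h1' h2 h2' h3 h3' s φ hφ hc
  have hd := continuous_fderiv_test hφ (Pi.single j (EuclideanSpace.single i 1))
  have hdc := hasCompactSupport_fderiv_test hc (Pi.single j (EuclideanSpace.single i 1))
  simp only [Pi.add_apply, mul_add]
  rw [integral_add (integrable_test_mul hd hdc (h2 s)) (integrable_test_mul hd hdc (h2' s)),
    integral_add (integrable_test_mul hφ.continuous hc (h3 s))
      (integrable_test_mul hφ.continuous hc (h3' s)), h1 s φ hφ hc, h1' s φ hφ hc]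
  ring

theorem IsWeakPartial.mul_left (h : IsWeakPartial j i f G) (c : PhotonConf → ℂ) :
    IsWeakPartial j i (fun z => c z.2 * f z) (fun z => c z.2 * G z) := by
  filter_upwards [h] with κ h1 s φ hφ hc
  simp only [mul_left_comm _ (c κ)]
  rw [integral_const_mul, integral_const_mul, h1 s φ hφ hc, mul_neg]

theorem IsWeakPartial.ae_eq (h : IsWeakPartial j i f G) (h' : IsWeakPartial j i f G')
    (hG : MemLp G 2 (confMeasure N)) (hG' : MemLp G' 2 (confMeasure N)) :
    G =ᵐ[confMeasure N] G' := by
  have h0 : (G - G') =ᵐ[confMeasure N] 0 := by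
    refine ae_eq_zero_of_slices (hG.1.sub hG'.1) ?_
    filter_upwards [h, h', memLp_slice hG, memLp_slice hG'] with κ h1 h1' h2 h2' s
    have h3 := ae_eq_of_integral_contDiff_smul_eq (μ := (volume : Measure (Fin N → Space)))
      ((h2 s).locallyIntegrable one_le_two) ((h2' s).locallyIntegrable one_le_two)
      (fun φ hφ hc => by
        have h4 := (h1 s φ hφ hc).symm.trans (h1' s φ hφ hc)
        simpa only [Complex.real_smul] using neg_injective h4)
    filter_upwards [h3] with X hX
    simp [hX]
  filter_upwards [h0] with z hz
  exact sub_eq_zero.1 hz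

theorem HasL2Partial.isWeakPartial (h : HasL2Partial j i f) :
    IsWeakPartial j i f (weakPartial j i f) := by
  rw [weakPartial, dif_pos h]
  exact h.choose_spec.2

theorem memLp_weakPartial (j : Fin N) (i : Fin 3) (f : Conf N → ℂ) :
    MemLp (weakPartial j i f) 2 (confMeasure N) := by
  rw [weakPartial]
  split_ifs with h
  · exact h.choose_spec.1
  · exact MemLp.zero

/-- Weak derivatives are unique, so the chosen one agrees with any other. -/
theorem weakPartial_ae_eq (h : IsWeakPartial j i f G) (hG : MemLp G 2 (confMeasure N)) :
    weakPartial j i f =ᵐ[confMeasure N] G :=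
  (HasL2Partial.isWeakPartial ⟨G, hG, h⟩).ae_eq h (memLp_weakPartial j i f) hG

theorem tendsto_integral_test_mul {E : Type*} [NormedAddCommGroup E] [MeasurableSpace E]
    [BorelSpace E] {μ : Measure E} [IsFiniteMeasureOnCompacts μ] [IsLocallyFiniteMeasure μ]
    {ψ : E → ℝ} (hψ : Continuous ψ)
    (hc : HasCompactSupport ψ) {f : ℕ → E → ℂ} {g : E → ℂ} (hf : ∀ k, MemLp (f k) 2 μ)
    (hg : MemLp g 2 μ) (hlim : Tendsto (fun k => ∫⁻ X, ‖f k X - g X‖ₑ ^ 2 ∂μ) atTop (𝓝 0)) :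
    Tendsto (fun k => ∫ X, (ψ X : ℂ) * f k X ∂μ) atTop (𝓝 (∫ X, (ψ X : ℂ) * g X ∂μ)) := by
  have hψ2 : ∫⁻ X, ‖ψ X‖ₑ ^ 2 ∂μ < ⊤ := by
    have h1 : Integrable (fun X => ψ X ^ 2) μ := by
      refine (hψ.pow 2).integrable_of_hasCompactSupport ?_
      simpa only [sq] using hc.mul_left (f := ψ)
    have h2 := h1.2
    simpa [HasFiniteIntegral, enorm_pow] using h2
  rw [tendsto_iff_norm_sub_tendsto_zero]
  have hbound : ∀ k, ENNReal.ofReal (‖(∫ X, (ψ X : ℂ) * f k X ∂μ) - ∫ X, (ψ X : ℂ) * g X ∂μ‖ ^ 2) ≤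
      (∫⁻ X, ‖ψ X‖ₑ ^ 2 ∂μ) * ∫⁻ X, ‖f k X - g X‖ₑ ^ 2 ∂μ := by
    intro k
    rw [← integral_sub (integrable_test_mul hψ hc (hf k)) (integrable_test_mul hψ hc hg),
      ENNReal.ofReal_pow (norm_nonneg _), ofReal_norm]
    refine (pow_le_pow_left₀ zero_le (enorm_integral_le_lintegral_enorm _) 2).trans ?_
    refine le_trans (le_of_eq ?_) (sq_lintegral_mul_le μ hψ.enorm.measurable.aemeasurable
      ((hf k).1.sub hg.1).enorm)
    congr 1
    refine lintegral_congr fun X => ?_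
    rw [← mul_sub, enorm_mul]
    congr 1
    rw [← ofReal_norm, Complex.norm_real, ofReal_norm]
  have hz : Tendsto (fun k => (∫⁻ X, ‖ψ X‖ₑ ^ 2 ∂μ) * ∫⁻ X, ‖f k X - g X‖ₑ ^ 2 ∂μ) atTop
      (𝓝 0) := by
    simpa using ENNReal.Tendsto.const_mul hlim (Or.inr hψ2.ne)
  have h3 := tendsto_of_tendsto_of_tendsto_of_le_of_le tendsto_const_nhds hz
    (fun _ => zero_le) hbound
  have h4 := ((ENNReal.tendsto_toReal ENNReal.zero_ne_top).comp h3).sqrt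
  simpa [Function.comp_def, ENNReal.toReal_ofReal, Real.sqrt_sq] using h4

/-- Weak differentiation is a closed operation in `L²`. -/
theorem isWeakPartial_of_tendsto {F D : ℕ → Conf N → ℂ}
    (hF : ∀ k, MemLp (F k) 2 (confMeasure N)) (hD : ∀ k, MemLp (D k) 2 (confMeasure N))
    (hf : MemLp f 2 (confMeasure N)) (hG : MemLp G 2 (confMeasure N))
    (hw : ∀ k, IsWeakPartial j i (F k) (D k))
    (hFlim : Tendsto (fun k => ∫⁻ z, ‖F k z - f z‖ₑ ^ 2 ∂confMeasure N) atTop (𝓝 0))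
    (hDlim : Tendsto (fun k => ∫⁻ z, ‖D k z - G z‖ₑ ^ 2 ∂confMeasure N) atTop (𝓝 0)) :
    IsWeakPartial j i f G := by
  -- Measurable representatives of the differences.
  have hex : ∀ k, ∃ R : Conf N → ℝ≥0∞, Measurable R ∧
      (fun z => ‖F k z - f z‖ₑ ^ 2 + ‖D k z - G z‖ₑ ^ 2) =ᵐ[confMeasure N] R := fun k =>
    (((hF k).1.sub hf.1).enorm.pow_const 2).add (((hD k).1.sub hG.1).enorm.pow_const 2)
  choose R hRm hR using hex
  have hRlim : Tendsto (fun k => ∫⁻ κ, (∑ s : Fin N → Fin 2,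
      ∫⁻ X : Fin N → Space, R k ((X, s), κ)) ∂photonMeasure) atTop (𝓝 0) := by
    have h1 := hFlim.add hDlim
    rw [add_zero] at h1
    refine h1.congr fun k => ?_
    have hm : AEMeasurable (fun z => ‖F k z - f z‖ₑ ^ 2) (confMeasure N) :=
      ((hF k).1.sub hf.1).enorm.pow_const 2
    rw [← lintegral_add_left' hm, ← lintegral_slice (hRm k)]
    exact lintegral_congr_ae (hR k)
  obtain ⟨ns, -, hns⟩ := exists_subseq_ae_tendsto_zero
    (fun k => (measurable_slice_lintegral (hRm k)).aemeasurable) hRlim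
  filter_upwards [ae_all_iff.2 hw, ae_all_iff.2 fun k => memLp_slice (hF k),
    ae_all_iff.2 fun k => memLp_slice (hD k), memLp_slice hf, memLp_slice hG, hns,
    ae_all_iff.2 fun k => ae_slice (hR k)] with κ h1 h2 h3 h4 h5 h6 h7 s φ hφ hc
  have hs : Tendsto (fun l => ∫⁻ X : Fin N → Space, R (ns l) ((X, s), κ)) atTop (𝓝 0) :=
    tendsto_of_tendsto_of_tendsto_of_le_of_le tendsto_const_nhds h6 (fun _ => zero_le)
      fun l => Finset.single_le_sum
        (f := fun s => ∫⁻ X : Fin N → Space, R (ns l) ((X, s), κ)) (fun _ _ => zero_le)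
        (Finset.mem_univ s)
  have hlimF : Tendsto (fun l => ∫⁻ X : Fin N → Space,
      ‖F (ns l) ((X, s), κ) - f ((X, s), κ)‖ₑ ^ 2) atTop (𝓝 0) :=
    tendsto_of_tendsto_of_tendsto_of_le_of_le tendsto_const_nhds hs (fun _ => zero_le)
      fun l => lintegral_mono_ae ((h7 (ns l) s).mono fun X hX => hX ▸ le_self_add)
  have hlimD : Tendsto (fun l => ∫⁻ X : Fin N → Space,
      ‖D (ns l) ((X, s), κ) - G ((X, s), κ)‖ₑ ^ 2) atTop (𝓝 0) :=
    tendsto_of_tendsto_of_tendsto_of_le_of_le tendsto_const_nhds hs (fun _ => zero_le)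
      fun l => lintegral_mono_ae ((h7 (ns l) s).mono fun X hX => hX ▸ le_add_self)
  have hd := continuous_fderiv_test hφ (Pi.single j (EuclideanSpace.single i 1))
  have hdc := hasCompactSupport_fderiv_test hc (Pi.single j (EuclideanSpace.single i 1))
  have t1 := tendsto_integral_test_mul hd hdc (fun l => h2 (ns l) s) (h4 s) hlimF
  have t2 := (tendsto_integral_test_mul hφ.continuous hc (fun l => h3 (ns l) s) (h5 s) hlimD).neg
  exact tendsto_nhds_unique t1 (t2.congr fun l => (h1 (ns l) s φ hφ hc).symm)

end WeakDerivatives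

/-! ### Weighted square-integrability -/

section Weights

open scoped ENNReal

variable {N : ℕ}

/-- `f` is measurable and `∫ w |f|²` exists, where the weight `w` may change sign. -/
structure HasWeight (w : Conf N → ℝ) (f : Conf N → ℂ) : Prop where
  aestronglyMeasurable : AEStronglyMeasurable f (confMeasure N)
  integrable : Integrable (fun z => w z * ‖f z‖ ^ 2) (confMeasure N)

/-- The sesquilinear form `∫ w conj(f) g`. -/
def pairing (w : Conf N → ℝ) (f g : Conf N → ℂ) : ℂ :=
  ∫ z, (w z : ℂ) * (conj (f z) * g z) ∂confMeasure N

variable {w : Conf N → ℝ} {f g f' g' : Conf N → ℂ}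

theorem norm_add_sq_le {E : Type*} [SeminormedAddCommGroup E] (a b : E) :
    ‖a + b‖ ^ 2 ≤ 2 * ‖a‖ ^ 2 + 2 * ‖b‖ ^ 2 := by
  have := norm_add_le a b
  nlinarith [norm_nonneg (a + b), sq_nonneg (‖a‖ - ‖b‖)]

theorem hasWeight_one_iff : HasWeight (fun _ : Conf N => (1 : ℝ)) f ↔ MemLp f 2 (confMeasure N) := by
  constructor
  · rintro ⟨h1, h2⟩
    simpa using (memLp_two_iff_integrable_sq_norm h1).2 (by simpa using h2)
  · intro h
    exact ⟨h.1, by simpa using (memLp_two_iff_integrable_sq_norm h.1).1 h⟩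

theorem HasWeight.abs (hf : HasWeight w f) :
    Integrable (fun z => |w z| * ‖f z‖ ^ 2) (confMeasure N) := by
  simpa [abs_mul] using hf.integrable.abs

theorem HasWeight.of_le (hf : HasWeight w f) {w' : Conf N → ℝ} (hw' : Measurable w')
    (hle : ∀ z, |w' z| ≤ |w z|) : HasWeight w' f := by
  refine ⟨hf.1, hf.2.mono (hw'.aestronglyMeasurable.mul (hf.1.norm.pow 2)) (ae_of_all _ fun z => ?_)⟩
  simp only [norm_mul, Real.norm_eq_abs]
  exact mul_le_mul_of_nonneg_right (hle z) (abs_nonneg _)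

theorem HasWeight.congr (hf : HasWeight w f) (h : f =ᵐ[confMeasure N] f') : HasWeight w f' :=
  ⟨hf.1.congr h, hf.2.congr (h.mono fun z hz => by simp only [hz])⟩

theorem HasWeight.add (hw : Measurable w) (hf : HasWeight w f) (hg : HasWeight w g) :
    HasWeight w (f + g) := by
  refine ⟨hf.1.add hg.1, (((hf.abs).const_mul 2).add ((hg.abs).const_mul 2)).mono
    (hw.aestronglyMeasurable.mul ((hf.1.add hg.1).norm.pow 2)) (ae_of_all _ fun z => ?_)⟩
  have h2 := mul_le_mul_of_nonneg_left (norm_add_sq_le (f z) (g z)) (abs_nonneg (w z))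
  refine le_trans ?_ (Real.le_norm_self _)
  rw [norm_mul, Real.norm_eq_abs, Real.norm_of_nonneg (by positivity)]
  simp only [Pi.add_apply]
  linarith

theorem HasWeight.const_mul (hf : HasWeight w f) (c : ℂ) : HasWeight w (fun z => c * f z) := by
  refine ⟨hf.1.const_mul c, (hf.2.const_mul (‖c‖ ^ 2)).congr (ae_of_all _ fun z => ?_)⟩
  simp only [norm_mul]
  ring

theorem integrable_pairing (hw : Measurable w) (hf : HasWeight w f) (hg : HasWeight w g) :
    Integrable (fun z => (w z : ℂ) * (conj (f z) * g z)) (confMeasure N) := by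
  refine ((hf.abs).add (hg.abs)).mono
    ((Complex.measurable_ofReal.comp hw).aestronglyMeasurable.mul
      ((Complex.continuous_conj.comp_aestronglyMeasurable hf.1).mul hg.1)) (ae_of_all _ fun z => ?_)
  have h1 : ‖f z‖ * ‖g z‖ ≤ ‖f z‖ ^ 2 + ‖g z‖ ^ 2 := by
    nlinarith [sq_nonneg (‖f z‖ - ‖g z‖), sq_nonneg (‖f z‖), sq_nonneg (‖g z‖)]
  have h2 := mul_le_mul_of_nonneg_left h1 (abs_nonneg (w z))
  refine le_trans ?_ (Real.le_norm_self _)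
  rw [norm_mul, norm_mul, Complex.norm_real, RCLike.norm_conj, Real.norm_eq_abs]
  simp only [Pi.add_apply]
  linarith

theorem pairing_congr (hf : f =ᵐ[confMeasure N] f') (hg : g =ᵐ[confMeasure N] g') :
    pairing w f g = pairing w f' g' := by
  refine integral_congr_ae ?_
  filter_upwards [hf, hg] with z h1 h2
  rw [h1, h2]

theorem pairing_add_right (hw : Measurable w) (hf : HasWeight w f) (hg : HasWeight w g)
    (hg' : HasWeight w g') : pairing w f (g + g') = pairing w f g + pairing w f g' := by
  simp only [pairing]
  rw [← integral_add (integrable_pairing hw hf hg) (integrable_pairing hw hf hg')]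
  congr 1
  funext z
  simp only [Pi.add_apply]
  ring

theorem pairing_const_mul_right (c : ℂ) :
    pairing w f (fun z => c * g z) = c * pairing w f g := by
  simp only [pairing]
  rw [← integral_const_mul]
  congr 1
  funext z
  ring

theorem conj_pairing (w : Conf N → ℝ) (f g : Conf N → ℂ) :
    conj (pairing w g f) = pairing w f g := by
  simp only [pairing]
  rw [← integral_conj]
  congr 1
  funext z
  simp only [map_mul, Complex.conj_conj, Complex.conj_ofReal]
  ring

theorem pairing_self (w : Conf N → ℝ) (f : Conf N → ℂ) :
    pairing w f f = ((∫ z, w z * ‖f z‖ ^ 2 ∂confMeasure N : ℝ) : ℂ) := by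
  simp only [pairing]
  rw [← integral_complex_ofReal]
  congr 1
  funext z
  rw [← Complex.normSq_eq_conj_mul_self, Complex.normSq_eq_norm_sq]
  push_cast
  rfl

theorem pairing_one (f g : Conf N → ℂ) :
    pairing (fun _ => 1) f g = ∫ z, conj (f z) * g z ∂confMeasure N := by
  simp [pairing]

theorem lintegral_weight_eq (hw0 : ∀ z, 0 ≤ w z) (f : Conf N → ℂ) :
    ∫⁻ z, ENNReal.ofReal (w z) * ‖f z‖ₑ ^ 2 ∂confMeasure N =
      ∫⁻ z, ENNReal.ofReal (w z * ‖f z‖ ^ 2) ∂confMeasure N := by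
  refine lintegral_congr fun z => ?_
  rw [ENNReal.ofReal_mul (hw0 z), ENNReal.ofReal_pow (norm_nonneg _), ofReal_norm]

theorem hasWeight_iff_lintegral (hw : Measurable w) (hw0 : ∀ z, 0 ≤ w z)
    (hf : AEStronglyMeasurable f (confMeasure N)) :
    HasWeight w f ↔ ∫⁻ z, ENNReal.ofReal (w z) * ‖f z‖ₑ ^ 2 ∂confMeasure N < ⊤ := by
  rw [lintegral_weight_eq hw0]
  have hm : AEStronglyMeasurable (fun z => w z * ‖f z‖ ^ 2) (confMeasure N) :=
    hw.aestronglyMeasurable.mul (hf.norm.pow 2)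
  have hnn : 0 ≤ᵐ[confMeasure N] fun z => w z * ‖f z‖ ^ 2 :=
    ae_of_all _ fun z => mul_nonneg (hw0 z) (sq_nonneg _)
  rw [← hasFiniteIntegral_iff_ofReal hnn]
  exact ⟨fun h => h.2.2, fun h => ⟨hf, hm, h⟩⟩

theorem integral_weight_eq (hw : Measurable w) (hw0 : ∀ z, 0 ≤ w z)
    (hf : AEStronglyMeasurable f (confMeasure N)) :
    ∫ z, w z * ‖f z‖ ^ 2 ∂confMeasure N =
      (∫⁻ z, ENNReal.ofReal (w z) * ‖f z‖ₑ ^ 2 ∂confMeasure N).toReal := by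
  rw [lintegral_weight_eq hw0, integral_eq_lintegral_of_nonneg_ae
    (ae_of_all _ fun z => mul_nonneg (hw0 z) (sq_nonneg _))
    (hw.aestronglyMeasurable.mul (hf.norm.pow 2))]

theorem integral_sq_norm_eq (hf : AEStronglyMeasurable f (confMeasure N)) :
    ∫ z, ‖f z‖ ^ 2 ∂confMeasure N = (∫⁻ z, ‖f z‖ₑ ^ 2 ∂confMeasure N).toReal := by
  have := integral_weight_eq (w := fun _ => 1) measurable_const (fun _ => zero_le_one) hf
  simpa using this

theorem lintegral_sq_eq_ofReal (hf : MemLp f 2 (confMeasure N)) :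
    ∫⁻ z, ‖f z‖ₑ ^ 2 ∂confMeasure N = ENNReal.ofReal (∫ z, ‖f z‖ ^ 2 ∂confMeasure N) := by
  rw [integral_sq_norm_eq hf.1, ENNReal.ofReal_toReal ((memLp_two_iff hf.1).1 hf).ne]

theorem lintegral_weight_eq_ofReal (hw : Measurable w) (hw0 : ∀ z, 0 ≤ w z) (hf : HasWeight w f) :
    ∫⁻ z, ENNReal.ofReal (w z) * ‖f z‖ₑ ^ 2 ∂confMeasure N =
      ENNReal.ofReal (∫ z, w z * ‖f z‖ ^ 2 ∂confMeasure N) := by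
  rw [integral_weight_eq hw hw0 hf.1,
    ENNReal.ofReal_toReal ((hasWeight_iff_lintegral hw hw0 hf.1).1 hf).ne]

/-- The squared norm in `L²`. -/
theorem norm_sq_Lp (Ψ : Lp ℂ 2 (confMeasure N)) :
    ‖Ψ‖ ^ 2 = ∫ z, ‖Ψ z‖ ^ 2 ∂confMeasure N := by
  have h := Lp.memLp Ψ
  rw [integral_sq_norm_eq h.1, ← eLpNorm_two_sq, ENNReal.toReal_pow, Lp.norm_def]

/-- Multiplication operators are closed: if `u k → x` in `L²` and `√w u k` is a Cauchy sequence in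
`L²`, then `√w (u k - x) → 0`, by Fatou's lemma along an almost everywhere convergent
subsequence. -/
theorem tendsto_weight_of_cauchy (hw : Measurable w) {u : ℕ → Lp ℂ 2 (confMeasure N)}
    {x : Lp ℂ 2 (confMeasure N)} (hu : Tendsto u atTop (𝓝 x))
    (hC : Tendsto (fun kl : ℕ × ℕ => ∫⁻ z, ENNReal.ofReal (w z) * ‖u kl.1 z - u kl.2 z‖ₑ ^ 2
      ∂confMeasure N) atTop (𝓝 0)) :
    Tendsto (fun k => ∫⁻ z, ENNReal.ofReal (w z) * ‖u k z - x z‖ₑ ^ 2 ∂confMeasure N)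
      atTop (𝓝 0) := by
  obtain ⟨ns, hns, hae⟩ := (tendstoInMeasure_of_tendsto_Lp hu).exists_seq_tendsto_ae
  rw [ENNReal.tendsto_nhds_zero] at hC ⊢
  intro ε hε
  obtain ⟨⟨a, b⟩, hab⟩ := eventually_atTop.1 (hC ε hε)
  refine eventually_atTop.2 ⟨a, fun k hk => ?_⟩
  calc ∫⁻ z, ENNReal.ofReal (w z) * ‖u k z - x z‖ₑ ^ 2 ∂confMeasure N
      ≤ ∫⁻ z, liminf (fun l => ENNReal.ofReal (w z) * ‖u k z - u (ns l) z‖ₑ ^ 2) atTop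
          ∂confMeasure N := by
        refine lintegral_mono_ae ?_
        filter_upwards [hae] with z hz
        have h1 : Tendsto (fun l => ENNReal.ofReal (w z) * ‖u k z - u (ns l) z‖ₑ ^ 2) atTop
            (𝓝 (ENNReal.ofReal (w z) * ‖u k z - x z‖ₑ ^ 2)) := by
          refine ENNReal.Tendsto.const_mul ?_ (Or.inr ENNReal.ofReal_ne_top)
          exact ((ENNReal.continuous_pow 2).tendsto _).comp
            ((continuous_enorm.tendsto _).comp (tendsto_const_nhds.sub hz))
        exact h1.liminf_eq.ge
    _ ≤ liminf (fun l => ∫⁻ z, ENNReal.ofReal (w z) * ‖u k z - u (ns l) z‖ₑ ^ 2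
          ∂confMeasure N) atTop := by
        refine lintegral_liminf_le' fun l => ?_
        exact hw.ennreal_ofReal.aemeasurable.mul
          ((((Lp.memLp (u k)).1.sub (Lp.memLp (u (ns l))).1).enorm).pow_const 2)
    _ ≤ ε := by
        refine liminf_le_of_frequently_le' (Eventually.frequently ?_)
        filter_upwards [eventually_ge_atTop b] with l hl
        exact hab (k, ns l) ⟨hk, hl.trans (hns.id_le l)⟩

end Weights

/-! ### Field operators and kinetic momenta on vectors of finite field energy -/

section FieldOperators

open scoped ENNReal

variable {N : ℕ}

/-- The field `a(h) + a*(h)`. -/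
def fieldOp (h : ElectronConf N → Mode → ℂ) (f : Conf N → ℂ) : Conf N → ℂ :=
  annihilate h f + create h f

/-- Square-integrable functions, symmetric in the photons, with finite massless field energy. -/
structure FieldDomain (f : Conf N → ℂ) : Prop where
  measurable : Measurable f
  memLp : MemLp f 2 (confMeasure N)
  energy : photonEnergy f < ⊤
  symm : PhotonSymmetric f

variable {h : ElectronConf N → Mode → ℂ} {U : Mode → ℝ} {f g f' : Conf N → ℂ}

theorem hasWeight_fieldEnergy_zero_iff (hf : AEStronglyMeasurable f (confMeasure N)) :
    HasWeight (fun z => fieldEnergy 0 z.2) f ↔ photonEnergy f < ⊤ :=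
  hasWeight_iff_lintegral (measurable_fieldEnergy 0) (fun _ => fieldEnergy_nonneg _ _) hf

theorem FieldDomain.hasWeight (hf : FieldDomain f) : HasWeight (fun z => fieldEnergy 0 z.2) f :=
  (hasWeight_fieldEnergy_zero_iff hf.memLp.1).2 hf.energy

theorem memLp_annihilate (hU : FormFactorBound h U) (hf : FieldDomain f) :
    MemLp (annihilate h f) 2 (confMeasure N) := by
  rw [memLp_two_iff (measurable_annihilate hU.measurable hf.measurable).aestronglyMeasurable]
  exact (lintegral_annihilate_le hU hf.measurable hf.symm).trans_lt
    (ENNReal.mul_lt_top hU.lintegral_lt_top hf.energy)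

theorem memLp_create (hU : FormFactorBound h U) (hf : FieldDomain f) :
    MemLp (create h f) 2 (confMeasure N) := by
  rw [memLp_two_iff (measurable_create hU.measurable hf.measurable).aestronglyMeasurable]
  exact (lintegral_create_le hU hf.measurable).trans_lt (ENNReal.add_lt_top.2
    ⟨ENNReal.mul_lt_top hU.lintegral_lt_top hf.energy, ENNReal.mul_lt_top hU.lintegral_mul_lt_top
      ((memLp_two_iff hf.memLp.1).1 hf.memLp)⟩)

theorem memLp_fieldOp (hU : FormFactorBound h U) (hf : FieldDomain f) :
    MemLp (fieldOp h f) 2 (confMeasure N) :=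
  (memLp_annihilate hU hf).add (memLp_create hU hf)

theorem measurable_fieldOp (hU : FormFactorBound h U) (hf : Measurable f) :
    Measurable (fieldOp h f) :=
  (measurable_annihilate hU.measurable hf).add (measurable_create hU.measurable hf)

/-- The constant in the relative bound of the field by the field energy. -/
def fieldConst (U : Mode → ℝ) : ℝ :=
  4 * (∫⁻ k, ENNReal.ofReal (U k) ∂modeMeasure).toReal +
    2 * (∫⁻ k, ENNReal.ofReal (dispersion 0 k.1 * U k) ∂modeMeasure).toReal

theorem fieldConst_nonneg (U : Mode → ℝ) : 0 ≤ fieldConst U := by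
  unfold fieldConst; positivity

theorem integral_norm_add_sq_le (hf : MemLp f 2 (confMeasure N))
    (hg : MemLp g 2 (confMeasure N)) :
    ∫ z, ‖f z + g z‖ ^ 2 ∂confMeasure N ≤
      2 * ∫ z, ‖f z‖ ^ 2 ∂confMeasure N + 2 * ∫ z, ‖g z‖ ^ 2 ∂confMeasure N := by
  have h1 := (memLp_two_iff_integrable_sq_norm hf.1).1 hf
  have h2 := (memLp_two_iff_integrable_sq_norm hg.1).1 hg
  have h3 := (memLp_two_iff_integrable_sq_norm (hf.add hg).1).1 (hf.add hg)
  rw [← integral_const_mul, ← integral_const_mul,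
    ← integral_add (h1.const_mul 2) (h2.const_mul 2)]
  exact integral_mono h3 ((h1.const_mul 2).add (h2.const_mul 2)) fun z => norm_add_sq_le _ _

/-- The field is bounded relative to the square root of the field energy. -/
theorem integral_fieldOp_le (hU : FormFactorBound h U) (hf : FieldDomain f) :
    ∫ z, ‖fieldOp h f z‖ ^ 2 ∂confMeasure N ≤ fieldConst U *
      ((∫ z, fieldEnergy 0 z.2 * ‖f z‖ ^ 2 ∂confMeasure N) +
        ∫ z, ‖f z‖ ^ 2 ∂confMeasure N) := by
  set c1 := ∫⁻ k, ENNReal.ofReal (U k) ∂modeMeasure with hc1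
  set c0 := ∫⁻ k, ENNReal.ofReal (dispersion 0 k.1 * U k) ∂modeMeasure with hc0
  have hE : photonEnergy f =
      ENNReal.ofReal (∫ z, fieldEnergy 0 z.2 * ‖f z‖ ^ 2 ∂confMeasure N) :=
    lintegral_weight_eq_ofReal (measurable_fieldEnergy 0) (fun _ => fieldEnergy_nonneg _ _)
      hf.hasWeight
  have hE0 : 0 ≤ ∫ z, fieldEnergy 0 z.2 * ‖f z‖ ^ 2 ∂confMeasure N :=
    integral_nonneg fun z => mul_nonneg (fieldEnergy_nonneg _ _) (sq_nonneg _)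
  have hn0 : 0 ≤ ∫ z, ‖f z‖ ^ 2 ∂confMeasure N := integral_nonneg fun z => sq_nonneg _
  set e := ∫ z, fieldEnergy 0 z.2 * ‖f z‖ ^ 2 ∂confMeasure N
  set n := ∫ z, ‖f z‖ ^ 2 ∂confMeasure N
  have ha : ∫ z, ‖annihilate h f z‖ ^ 2 ∂confMeasure N ≤ c1.toReal * e := by
    have h1 := lintegral_annihilate_le hU hf.measurable hf.symm
    rw [hE] at h1
    rw [integral_sq_norm_eq (memLp_annihilate hU hf).1]
    have h2 := ENNReal.toReal_mono
      (ENNReal.mul_lt_top hU.lintegral_lt_top ENNReal.ofReal_lt_top).ne h1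
    rwa [ENNReal.toReal_mul, ENNReal.toReal_ofReal hE0] at h2
  have hc : ∫ z, ‖create h f z‖ ^ 2 ∂confMeasure N ≤ c1.toReal * e + c0.toReal * n := by
    have h1 := lintegral_create_le hU hf.measurable
    rw [hE, lintegral_sq_eq_ofReal hf.memLp] at h1
    rw [integral_sq_norm_eq (memLp_create hU hf).1]
    have t1 := (ENNReal.mul_lt_top hU.lintegral_lt_top (ENNReal.ofReal_lt_top (r := e))).ne
    have t2 := (ENNReal.mul_lt_top hU.lintegral_mul_lt_top (ENNReal.ofReal_lt_top (r := n))).ne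
    have h2 := ENNReal.toReal_mono (ENNReal.add_ne_top.2 ⟨t1, t2⟩) h1
    rwa [ENNReal.toReal_add t1 t2, ENNReal.toReal_mul, ENNReal.toReal_mul,
      ENNReal.toReal_ofReal hE0, ENNReal.toReal_ofReal hn0] at h2
  have hsum := integral_norm_add_sq_le (memLp_annihilate hU hf) (memLp_create hU hf)
  have hc1' : 0 ≤ c1.toReal := ENNReal.toReal_nonneg
  have hc0' : 0 ≤ c0.toReal := ENNReal.toReal_nonneg
  have hdef : fieldConst U = 4 * c1.toReal + 2 * c0.toReal := rfl
  change ∫ z, ‖annihilate h f z + create h f z‖ ^ 2 ∂confMeasure N ≤ _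
  rw [hdef]
  nlinarith [mul_nonneg hc1' hn0, mul_nonneg hc0' hE0]

theorem ae_lintegral_dispersion_lt_top (hf : FieldDomain f) (n : ℕ) :
    ∀ᵐ y ∂sectorMeasure N n, ∫⁻ k, ENNReal.ofReal (dispersion 0 k.1) *
      ‖f (sector (n + 1) (y.1, (0 : Fin (n + 1)).insertNth k y.2))‖ₑ ^ 2 ∂modeMeasure < ⊤ := by
  have hω : Measurable fun k : Mode => dispersion 0 k.1 :=
    (measurable_dispersion 0).comp measurable_fst
  have hfs : Measurable fun y : ElectronConf N × (Fin (n + 1) → Mode) => f (sector (n + 1) y) :=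
    hf.measurable.comp (measurableEmbedding_sector _).measurable
  have h0 : Measurable fun y : ElectronConf N × (Fin (n + 1) → Mode) => y.2 0 :=
    (measurable_pi_apply 0).comp measurable_snd
  have hm : Measurable fun y : ElectronConf N × (Fin (n + 1) → Mode) =>
      ENNReal.ofReal (dispersion 0 (y.2 0).1) * ‖f (sector (n + 1) y)‖ₑ ^ 2 :=
    (hω.comp h0).ennreal_ofReal.mul (hfs.enorm.pow_const 2)
  have hfin : ∫⁻ y, ENNReal.ofReal (dispersion 0 (y.2 0).1) * ‖f (sector (n + 1) y)‖ₑ ^ 2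
      ∂sectorMeasure N (n + 1) < ⊤ := by
    have h1 := hf.energy
    rw [photonEnergy, lintegral_confMeasure] at h1
    refine lt_of_le_of_lt ?_ ((ENNReal.le_tsum (n + 1)).trans_lt h1)
    refine lintegral_mono fun y => ?_
    have hle : dispersion 0 (y.2 0).1 ≤ ∑ l, dispersion 0 (y.2 l).1 :=
      Finset.single_le_sum (f := fun l => dispersion 0 (y.2 l).1)
        (fun l _ => dispersion_nonneg _ _) (Finset.mem_univ 0)
    exact mul_le_mul_left (ENNReal.ofReal_le_ofReal hle) _
  rw [lintegral_sector_succ 0 hm] at hfin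
  have hm2 := (hm.comp (insertPhoton N n 0).measurable).lintegral_prod_right'
    (ν := modeMeasure)
  filter_upwards [ae_lt_top hm2 hfin.ne] with y hy
  exact hy

theorem FormFactorBound.integrable_mul (hU : FormFactorBound h U) (Z : ElectronConf N)
    {F : Mode → ℂ} (hF : Measurable F)
    (hF2 : ∫⁻ k, ENNReal.ofReal (dispersion 0 k.1) * ‖F k‖ₑ ^ 2 ∂modeMeasure < ⊤) :
    Integrable (fun k => h Z k * F k) modeMeasure := by
  have hhk : Measurable fun k : Mode => h Z k := hU.measurable.comp measurable_prodMk_left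
  refine ⟨(hhk.mul hF).aestronglyMeasurable, ?_⟩
  have hle : ∀ k : Mode, ‖h Z k * F k‖ₑ ≤
      ENNReal.ofReal (U k) + ENNReal.ofReal (dispersion 0 k.1) * ‖F k‖ₑ ^ 2 := by
    intro k
    rw [← ofReal_norm, ← ofReal_norm, ← ENNReal.ofReal_pow (norm_nonneg _),
      ← ENNReal.ofReal_mul (dispersion_nonneg _ _), ← ENNReal.ofReal_add (hU.nonneg k)
        (mul_nonneg (dispersion_nonneg _ _) (sq_nonneg _)), norm_mul]
    refine ENNReal.ofReal_le_ofReal ?_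
    have h1 := hU.norm_sq_le Z k
    have h2 := dispersion_nonneg 0 k.1
    have h3 := hU.nonneg k
    have h4 : (‖h Z k‖ * ‖F k‖) ^ 2 ≤ (U k + dispersion 0 k.1 * ‖F k‖ ^ 2) ^ 2 := by
      rw [mul_pow]
      have h5 : ‖h Z k‖ ^ 2 * ‖F k‖ ^ 2 ≤ dispersion 0 k.1 * U k * ‖F k‖ ^ 2 :=
        mul_le_mul_of_nonneg_right h1 (sq_nonneg _)
      nlinarith [sq_nonneg (U k), sq_nonneg (dispersion 0 k.1 * ‖F k‖ ^ 2),
        mul_nonneg (mul_nonneg h2 h3) (sq_nonneg ‖F k‖)]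
    exact (sq_le_sq₀ (by positivity) (by positivity)).1 h4
  refine lt_of_le_of_lt (lintegral_mono hle) ?_
  rw [lintegral_add_left hU.measurable_bound.ennreal_ofReal]
  exact ENNReal.add_lt_top.2 ⟨hU.lintegral_lt_top, hF2⟩

/-- For almost every configuration the integral defining `a(h) f` converges absolutely. -/
theorem ae_integrable_annihilate (hU : FormFactorBound h U) (hf : FieldDomain f) (n : ℕ) :
    ∀ᵐ y ∂sectorMeasure N n, Integrable (fun k => h y.1 k *
      f (sector (n + 1) (y.1, (0 : Fin (n + 1)).insertNth k y.2))) modeMeasure := by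
  have hfs : Measurable fun y : ElectronConf N × (Fin (n + 1) → Mode) => f (sector (n + 1) y) :=
    hf.measurable.comp (measurableEmbedding_sector _).measurable
  filter_upwards [ae_lintegral_dispersion_lt_top hf n] with y hy
  have hmk : Measurable fun k : Mode =>
      f (sector (n + 1) (y.1, (0 : Fin (n + 1)).insertNth k y.2)) :=
    hfs.comp ((insertPhoton N n 0).measurable.comp measurable_prodMk_left)
  exact hU.integrable_mul y.1 hmk hy

theorem fieldOp_add (hU : FormFactorBound h U) (hf : FieldDomain f) (hg : FieldDomain g) :
    fieldOp h (f + g) =ᵐ[confMeasure N] fieldOp h f + fieldOp h g := by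
  rw [Filter.EventuallyEq, ae_confMeasure_iff]
  intro n
  filter_upwards [ae_integrable_annihilate hU hf n, ae_integrable_annihilate hU hg n] with y h1 h2
  have ha : annihilate h (f + g) (sector n y) =
      annihilate h f (sector n y) + annihilate h g (sector n y) := by
    simp only [annihilate_sector, Pi.add_apply, mul_add]
    rw [integral_add h1 h2, mul_add]
  have hc : create h (f + g) (sector n y) =
      create h f (sector n y) + create h g (sector n y) := by
    cases n with
    | zero => simp [create, sector]
    | succ n =>
      simp only [create_sector_succ, Pi.add_apply, mul_add, Finset.sum_add_distrib]
  simp only [fieldOp, Pi.add_apply, ha, hc]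
  ring

theorem fieldOp_const_mul (h : ElectronConf N → Mode → ℂ) (f : Conf N → ℂ) (c : ℂ) :
    fieldOp h (fun z => c * f z) = fun z => c * fieldOp h f z := by
  funext z
  obtain ⟨Z, n, K⟩ := z
  have ha : annihilate h (fun z => c * f z) (Z, ⟨n, K⟩) = c * annihilate h f (Z, ⟨n, K⟩) := by
    simp only [annihilate, mul_left_comm _ c]
    rw [integral_const_mul]
    ring
  have hc : create h (fun z => c * f z) (Z, ⟨n, K⟩) = c * create h f (Z, ⟨n, K⟩) := by
    cases n with
    | zero => simp [create]
    | succ n =>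
      simp only [create, mul_left_comm _ c]
      rw [← Finset.mul_sum]
      ring
  simp only [fieldOp, Pi.add_apply, ha, hc, mul_add]

theorem fieldOp_congr (hff' : f =ᵐ[confMeasure N] f') :
    fieldOp h f =ᵐ[confMeasure N] fieldOp h f' := by
  rw [Filter.EventuallyEq, ae_confMeasure_iff]
  have hsec := ae_confMeasure_iff.1 hff'
  intro n
  have ha : ∀ᵐ y ∂sectorMeasure N n, annihilate h f (sector n y) =
      annihilate h f' (sector n y) := by
    have h1 := (measurePreserving_insertPhoton (N := N) n 0).quasiMeasurePreserving.ae
      (hsec (n + 1))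
    filter_upwards [Measure.ae_ae_of_ae_prod h1] with y hy
    rw [annihilate_sector, annihilate_sector]
    congr 1
    refine integral_congr_ae ?_
    filter_upwards [hy] with k hk
    have hk' : f (sector (n + 1) (y.1, (0 : Fin (n + 1)).insertNth k y.2)) =
      f' (sector (n + 1) (y.1, (0 : Fin (n + 1)).insertNth k y.2)) := hk
    rw [hk']
  have hc : ∀ᵐ y ∂sectorMeasure N n, create h f (sector n y) = create h f' (sector n y) := by
    cases n with
    | zero => exact ae_of_all _ fun y => rfl
    | succ n =>
      have h1 : ∀ᵐ y ∂sectorMeasure N (n + 1), ∀ l : Fin (n + 1),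
          f (sector n (y.1, fun r => y.2 (l.succAbove r))) =
            f' (sector n (y.1, fun r => y.2 (l.succAbove r))) := by
        rw [ae_all_iff]
        intro l
        have h2 : ∀ᵐ p ∂(sectorMeasure N n).prod modeMeasure,
            f (sector n p.1) = f' (sector n p.1) :=
          Measure.quasiMeasurePreserving_fst.ae (hsec n)
        have h3 := ((measurePreserving_insertPhoton (N := N) n l).symm).quasiMeasurePreserving.ae h2
        exact h3
      filter_upwards [h1] with y hy
      rw [create_sector_succ, create_sector_succ]
      simp only [hy]
  filter_upwards [ha, hc] with y h1 h2
  simp only [fieldOp, Pi.add_apply, h1, h2]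

theorem pauli_add (j : Fin N) (i : Fin 3) (f g : Conf N → ℂ) :
    pauli j i (f + g) = pauli j i f + pauli j i g := by
  funext z
  simp only [pauli_apply, Pi.add_apply]
  ring

theorem pauli_const_mul (j : Fin N) (i : Fin 3) (f : Conf N → ℂ) (c : ℂ) :
    pauli j i (fun z => c * f z) = fun z => c * pauli j i f z := by
  funext z
  simp only [pauli_apply]
  ring

theorem pauli_congr (j : Fin N) (i : Fin 3) (hff' : f =ᵐ[confMeasure N] f') :
    pauli j i f =ᵐ[confMeasure N] pauli j i f' := by
  filter_upwards [hff', (measurePreserving_flipSpin j).quasiMeasurePreserving.ae hff'] with z h1 h2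
  rw [pauli_apply, pauli_apply, h1, h2]

theorem integral_pauli_le (j : Fin N) (i : Fin 3) (hf : Measurable f)
    (hf2 : MemLp f 2 (confMeasure N)) :
    ∫ z, ‖pauli j i f z‖ ^ 2 ∂confMeasure N ≤ 4 * ∫ z, ‖f z‖ ^ 2 ∂confMeasure N := by
  have h2 := lintegral_pauli_le j i hf (w := 1) measurable_const
  simp only [Pi.one_apply, one_mul] at h2
  rw [integral_sq_norm_eq (memLp_pauli j i hf hf2).1, integral_sq_norm_eq hf2.1]
  have h3 := ENNReal.toReal_mono (ENNReal.mul_lt_top (by simp)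
    ((memLp_two_iff hf2.1).1 hf2)).ne h2
  simpa using h3

/-- The operator `σ · (a(h) + a*(h))` is symmetric if `h` does not depend on the spins. -/
theorem integral_conj_mul_pauli_fieldOp (hU : FormFactorBound h U)
    (hspin : ∀ (X : Fin N → Space) (s s' : Fin N → Fin 2), h (X, s) = h (X, s'))
    (j : Fin N) (i : Fin 3) (hf : FieldDomain f) (hg : FieldDomain g) :
    ∫ z, conj (f z) * pauli j i (fieldOp h g) z ∂confMeasure N =
      ∫ z, conj (pauli j i (fieldOp h f) z) * g z ∂confMeasure N := by
  have haf := memLp_pauli j i (measurable_annihilate hU.measurable hf.measurable)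
    (memLp_annihilate hU hf)
  have hag := memLp_pauli j i (measurable_annihilate hU.measurable hg.measurable)
    (memLp_annihilate hU hg)
  have hcf := memLp_pauli j i (measurable_create hU.measurable hf.measurable) (memLp_create hU hf)
  have hcg := memLp_pauli j i (measurable_create hU.measurable hg.measurable) (memLp_create hU hg)
  have h1 := integral_conj_mul_pauli_annihilate hU hspin j i hf.measurable hg.measurable hf.memLp
    hg.memLp hf.energy hg.energy hg.symm
  have h2 := integral_conj_mul_pauli_annihilate hU hspin j i hg.measurable hf.measurable hg.memLp
    hf.memLp hg.energy hf.energy hf.symm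
  have h3 := congrArg conj h2
  rw [← integral_conj, ← integral_conj] at h3
  simp only [map_mul, Complex.conj_conj] at h3
  have i1 : Integrable (fun z => conj (f z) * pauli j i (annihilate h g) z) (confMeasure N) :=
    hf.memLp.star.integrable_mul hag
  have i2 : Integrable (fun z => conj (f z) * pauli j i (create h g) z) (confMeasure N) :=
    hf.memLp.star.integrable_mul hcg
  have i3 : Integrable (fun z => conj (pauli j i (annihilate h f) z) * g z) (confMeasure N) :=
    haf.star.integrable_mul hg.memLp
  have i4 : Integrable (fun z => conj (pauli j i (create h f) z) * g z) (confMeasure N) :=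
    hcf.star.integrable_mul hg.memLp
  simp only [fieldOp, pauli_add, Pi.add_apply, map_add, mul_add, add_mul]
  rw [integral_add i1 i2, integral_add i3 i4, h1, add_comm]
  congr 1
  simp only [mul_comm (conj (f _))]
  rw [← h3]
  simp only [mul_comm]

variable {α Λ : ℝ} {j : Fin N} {i : Fin 3}

theorem fieldA_eq (Λ : ℝ) (j : Fin N) (i : Fin 3) (f : Conf N → ℂ) :
    fieldA Λ j i f = fieldOp (fun Z => coeffA Λ (Z.1 j) i) f := rfl

theorem memLp_fieldA (hf : FieldDomain f) : MemLp (fieldA Λ j i f) 2 (confMeasure N) :=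
  memLp_fieldOp (formFactorBound_coeffA Λ j i) hf

theorem memLp_kineticMomentum (hf : FieldDomain f) :
    MemLp (kineticMomentum α Λ j i f) 2 (confMeasure N) :=
  ((memLp_weakPartial j i f).const_mul (-Complex.I)).add
    ((memLp_fieldA hf).const_mul (Real.sqrt α : ℂ))

theorem HasL2Partial.congr (hf : HasL2Partial j i f) (hff' : f =ᵐ[confMeasure N] f') :
    HasL2Partial j i f' :=
  let ⟨G, hG, h⟩ := hf
  ⟨G, hG, h.congr hff' (ae_eq_refl G)⟩

theorem HasL2Partial.add (hf : HasL2Partial j i f) (hg : HasL2Partial j i g)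
    (hf2 : MemLp f 2 (confMeasure N)) (hg2 : MemLp g 2 (confMeasure N)) :
    HasL2Partial j i (f + g) :=
  let ⟨F, hF, h⟩ := hf
  let ⟨G, hG, h'⟩ := hg
  ⟨F + G, hF.add hG, h.add h' hf2 hg2 hF hG⟩

theorem HasL2Partial.const_mul (hf : HasL2Partial j i f) (c : ℂ) :
    HasL2Partial j i (fun z => c * f z) :=
  let ⟨F, hF, h⟩ := hf
  ⟨fun z => c * F z, hF.const_mul c, h.mul_left fun _ => c⟩

theorem weakPartial_congr (hf : HasL2Partial j i f) (hff' : f =ᵐ[confMeasure N] f') :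
    weakPartial j i f' =ᵐ[confMeasure N] weakPartial j i f :=
  weakPartial_ae_eq (hf.isWeakPartial.congr hff' (ae_eq_refl _)) (memLp_weakPartial j i f)

theorem weakPartial_add (hf : HasL2Partial j i f) (hg : HasL2Partial j i g)
    (hf2 : MemLp f 2 (confMeasure N)) (hg2 : MemLp g 2 (confMeasure N)) :
    weakPartial j i (f + g) =ᵐ[confMeasure N] weakPartial j i f + weakPartial j i g :=
  weakPartial_ae_eq (hf.isWeakPartial.add hg.isWeakPartial hf2 hg2 (memLp_weakPartial j i f)
    (memLp_weakPartial j i g)) ((memLp_weakPartial j i f).add (memLp_weakPartial j i g))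

theorem weakPartial_const_mul (hf : HasL2Partial j i f) (c : ℂ) :
    weakPartial j i (fun z => c * f z) =ᵐ[confMeasure N] fun z => c * weakPartial j i f z :=
  weakPartial_ae_eq (hf.isWeakPartial.mul_left fun _ => c) ((memLp_weakPartial j i f).const_mul c)

theorem kineticMomentum_congr (hf : HasL2Partial j i f) (hff' : f =ᵐ[confMeasure N] f') :
    kineticMomentum α Λ j i f' =ᵐ[confMeasure N] kineticMomentum α Λ j i f := by
  filter_upwards [weakPartial_congr hf hff',
    fieldOp_congr (h := fun Z => coeffA Λ (Z.1 j) i) hff'] with z h1 h2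
  rw [← fieldA_eq, ← fieldA_eq] at h2
  simp only [kineticMomentum, h1, h2]

theorem kineticMomentum_add (hf : HasL2Partial j i f) (hg : HasL2Partial j i g)
    (hf' : FieldDomain f) (hg' : FieldDomain g) :
    kineticMomentum α Λ j i (f + g) =ᵐ[confMeasure N]
      kineticMomentum α Λ j i f + kineticMomentum α Λ j i g := by
  filter_upwards [weakPartial_add hf hg hf'.memLp hg'.memLp,
    fieldOp_add (formFactorBound_coeffA Λ j i) hf' hg'] with z h1 h2
  rw [← fieldA_eq, ← fieldA_eq, ← fieldA_eq] at h2
  simp only [kineticMomentum, h1, h2, Pi.add_apply]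
  ring

theorem kineticMomentum_const_mul (hf : HasL2Partial j i f) (c : ℂ) :
    kineticMomentum α Λ j i (fun z => c * f z) =ᵐ[confMeasure N]
      fun z => c * kineticMomentum α Λ j i f z := by
  filter_upwards [weakPartial_const_mul hf c] with z h1
  simp only [kineticMomentum, h1, fieldA_eq, fieldOp_const_mul]
  ring

theorem integral_norm_const_mul_sq (c : ℂ) (f : Conf N → ℂ) :
    ∫ z, ‖c * f z‖ ^ 2 ∂confMeasure N = ‖c‖ ^ 2 * ∫ z, ‖f z‖ ^ 2 ∂confMeasure N := by
  rw [← integral_const_mul]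
  simp only [norm_mul, mul_pow]

theorem integral_kineticMomentum_le (hα : 0 ≤ α) (hf : FieldDomain f) :
    ∫ z, ‖kineticMomentum α Λ j i f z‖ ^ 2 ∂confMeasure N ≤
      2 * ∫ z, ‖weakPartial j i f z‖ ^ 2 ∂confMeasure N +
      2 * (α * ∫ z, ‖fieldA Λ j i f z‖ ^ 2 ∂confMeasure N) := by
  have h := integral_norm_add_sq_le ((memLp_weakPartial j i f).const_mul (-Complex.I))
    ((memLp_fieldA (Λ := Λ) (j := j) (i := i) hf).const_mul (Real.sqrt α : ℂ))
  simp only [integral_norm_const_mul_sq, norm_neg, Complex.norm_I, one_pow, one_mul,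
    Complex.norm_real, Real.norm_eq_abs, sq_abs, Real.sq_sqrt hα] at h
  exact h

theorem integral_weakPartial_le (hα : 0 ≤ α) (hf : FieldDomain f) :
    ∫ z, ‖weakPartial j i f z‖ ^ 2 ∂confMeasure N ≤
      2 * ∫ z, ‖kineticMomentum α Λ j i f z‖ ^ 2 ∂confMeasure N +
      2 * (α * ∫ z, ‖fieldA Λ j i f z‖ ^ 2 ∂confMeasure N) := by
  have h := integral_norm_add_sq_le (memLp_kineticMomentum (α := α) (Λ := Λ) (j := j) (i := i) hf)
    ((memLp_fieldA (Λ := Λ) (j := j) (i := i) hf).const_mul (-(Real.sqrt α : ℂ)))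
  have h2 : ∀ z, ‖kineticMomentum α Λ j i f z + -(Real.sqrt α : ℂ) * fieldA Λ j i f z‖ =
      ‖weakPartial j i f z‖ := by
    intro z
    have h3 : kineticMomentum α Λ j i f z + -(Real.sqrt α : ℂ) * fieldA Λ j i f z =
        -Complex.I * weakPartial j i f z := by
      simp only [kineticMomentum]; ring
    rw [h3, norm_mul, norm_neg, Complex.norm_I, one_mul]
  simpa only [h2, integral_norm_const_mul_sq, norm_neg, Complex.norm_I, one_pow, one_mul,
    Complex.norm_real, Real.norm_eq_abs, sq_abs, Real.sq_sqrt hα] using h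

end FieldOperators

/-! ### The energy form on its domain -/

section EnergyForm

open scoped ENNReal

variable {N : ℕ} {W : (Fin N → Space) → ℝ} {m : ℝ} {α g Λ : ℝ} {j : Fin N} {i : Fin 3}
  {Φ Ψ : hilbert N}

theorem coe_add_ae (Φ Ψ : hilbert N) :
    ((Φ.1 : Conf N → ℂ) + (Ψ.1 : Conf N → ℂ)) =ᵐ[confMeasure N] (Φ + Ψ).1 := (Lp.coeFn_add Φ.1 Ψ.1).symm

theorem coe_smul_ae (c : ℂ) (Ψ : hilbert N) :
    (fun z => c * Ψ.1 z) =ᵐ[confMeasure N] (c • Ψ).1 := (Lp.coeFn_smul c Ψ.1).symm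

theorem coe_sub_ae (Φ Ψ : hilbert N) :
    (fun z => Φ.1 z - Ψ.1 z) =ᵐ[confMeasure N] (Φ - Ψ).1 := (Lp.coeFn_sub Φ.1 Ψ.1).symm

theorem dispersion_mono {m m' : ℝ} (hm : 0 ≤ m) (hmm' : m ≤ m') (k : Space) :
    dispersion m k ≤ dispersion m' k := by
  unfold dispersion
  gcongr

theorem fieldEnergy_mono {m m' : ℝ} (hm : 0 ≤ m) (hmm' : m ≤ m') (κ : PhotonConf) :
    fieldEnergy m κ ≤ fieldEnergy m' κ :=
  Finset.sum_le_sum fun _ _ => dispersion_mono hm hmm' _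

theorem hasWeight_potential (hΨ : Ψ ∈ finiteEnergy W m) : HasWeight (fun z => W z.1.1) Ψ.1 :=
  ⟨(Lp.memLp Ψ.1).1, hΨ.2.1⟩

theorem hasWeight_fieldEnergy (hΨ : Ψ ∈ finiteEnergy W m) :
    HasWeight (fun z => fieldEnergy m z.2) Ψ.1 :=
  ⟨(Lp.memLp Ψ.1).1, hΨ.2.2⟩

theorem hasWeight_fieldEnergy_zero (hm : 0 ≤ m) (hΨ : Ψ ∈ finiteEnergy W m) :
    HasWeight (fun z => fieldEnergy 0 z.2) Ψ.1 :=
  (hasWeight_fieldEnergy hΨ).of_le (measurable_fieldEnergy 0) fun z => by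
    rw [abs_of_nonneg (fieldEnergy_nonneg _ _), abs_of_nonneg (fieldEnergy_nonneg _ _)]
    exact fieldEnergy_mono le_rfl hm z.2

theorem fieldDomain_of_mem (hm : 0 ≤ m) (hΨ : Ψ ∈ finiteEnergy W m) : FieldDomain Ψ.1 where
  measurable := (Lp.stronglyMeasurable Ψ.1).measurable
  memLp := Lp.memLp Ψ.1
  energy := (hasWeight_fieldEnergy_zero_iff (Lp.memLp Ψ.1).1).1 (hasWeight_fieldEnergy_zero hm hΨ)
  symm := photonSymmetric_of_mem Ψ.2

theorem measurable_potential (hW : Measurable W) : Measurable fun z : Conf N => W z.1.1 :=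
  hW.comp (measurable_fst.comp measurable_fst)

/-- The form domain as a subspace. -/
def formDomain (W : (Fin N → Space) → ℝ) (hW : Measurable W) (m : ℝ) :
    Submodule ℂ (hilbert N) where
  carrier := finiteEnergy W m
  zero_mem' := by
    have h0 : ((0 : hilbert N).1 : Conf N → ℂ) =ᵐ[confMeasure N] fun _ => 0 :=
      Lp.coeFn_zero _ _ _
    have hp : ∀ (j : Fin N) (i : Fin 3), HasL2Partial j i (fun _ : Conf N => (0 : ℂ)) :=
      fun j i => ⟨fun _ => 0, MemLp.zero, ae_of_all _ fun κ s φ _ _ => by simp⟩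
    have hw : ∀ w : Conf N → ℝ, HasWeight w (fun _ : Conf N => (0 : ℂ)) := fun w =>
      ⟨aestronglyMeasurable_const, by simp⟩
    exact ⟨fun j i => (hp j i).congr h0.symm, ((hw _).congr h0.symm).2, ((hw _).congr h0.symm).2⟩
  add_mem' := by
    intro Φ Ψ hΦ hΨ
    have h := coe_add_ae Φ Ψ
    exact ⟨fun j i => ((hΦ.1 j i).add (hΨ.1 j i) (Lp.memLp _) (Lp.memLp _)).congr h,
      (((hasWeight_potential hΦ).add (measurable_potential hW)
        (hasWeight_potential hΨ)).congr h).2,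
      (((hasWeight_fieldEnergy hΦ).add (measurable_fieldEnergy m)
        (hasWeight_fieldEnergy hΨ)).congr h).2⟩
  smul_mem' := by
    intro c Ψ hΨ
    have h := coe_smul_ae c Ψ
    exact ⟨fun j i => ((hΨ.1 j i).const_mul c).congr h,
      (((hasWeight_potential hΨ).const_mul c).congr h).2,
      (((hasWeight_fieldEnergy hΨ).const_mul c).congr h).2⟩

theorem kineticMomentum_coe_add (hm : 0 ≤ m) (hΦ : Φ ∈ finiteEnergy W m)
    (hΨ : Ψ ∈ finiteEnergy W m) :
    kineticMomentum α Λ j i (Φ + Ψ).1 =ᵐ[confMeasure N]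
      kineticMomentum α Λ j i Φ.1 + kineticMomentum α Λ j i Ψ.1 :=
  (kineticMomentum_congr ((hΦ.1 j i).add (hΨ.1 j i) (Lp.memLp _) (Lp.memLp _))
    (coe_add_ae Φ Ψ)).trans (kineticMomentum_add (hΦ.1 j i) (hΨ.1 j i)
      (fieldDomain_of_mem hm hΦ) (fieldDomain_of_mem hm hΨ))

theorem kineticMomentum_coe_smul (c : ℂ) (hΨ : Ψ ∈ finiteEnergy W m) :
    kineticMomentum α Λ j i (c • Ψ).1 =ᵐ[confMeasure N]
      fun z => c * kineticMomentum α Λ j i Ψ.1 z :=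
  (kineticMomentum_congr ((hΨ.1 j i).const_mul c) (coe_smul_ae c Ψ)).trans
    (kineticMomentum_const_mul (hΨ.1 j i) c)

theorem pauli_fieldB_coe_add (hm : 0 ≤ m) (hΦ : Φ ∈ finiteEnergy W m)
    (hΨ : Ψ ∈ finiteEnergy W m) :
    pauli j i (fieldB Λ j i (Φ + Ψ).1) =ᵐ[confMeasure N]
      pauli j i (fieldB Λ j i Φ.1) + pauli j i (fieldB Λ j i Ψ.1) := by
  rw [← pauli_add]
  exact pauli_congr j i ((fieldOp_congr (coe_add_ae Φ Ψ).symm).trans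
    (fieldOp_add (formFactorBound_coeffB Λ j i) (fieldDomain_of_mem hm hΦ)
      (fieldDomain_of_mem hm hΨ)))

theorem pauli_fieldB_coe_smul (c : ℂ) (Ψ : hilbert N) :
    pauli j i (fieldB Λ j i (c • Ψ).1) =ᵐ[confMeasure N]
      fun z => c * pauli j i (fieldB Λ j i Ψ.1) z := by
  have h1 : fieldB Λ j i (c • Ψ).1 =ᵐ[confMeasure N] fieldB Λ j i (fun z => c * Ψ.1 z) :=
    fieldOp_congr (coe_smul_ae c Ψ).symm
  have h2 : fieldB Λ j i (fun z => c * Ψ.1 z) = fun z => c * fieldB Λ j i Ψ.1 z :=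
    fieldOp_const_mul _ _ c
  rw [h2] at h1
  rw [← pauli_const_mul]
  exact pauli_congr j i h1

theorem memLp_pauli_fieldB {f : Conf N → ℂ} (hf : FieldDomain f) :
    MemLp (pauli j i (fieldB Λ j i f)) 2 (confMeasure N) :=
  memLp_pauli j i (measurable_fieldOp (formFactorBound_coeffB Λ j i) hf.measurable)
    (memLp_fieldOp (formFactorBound_coeffB Λ j i) hf)

/-- The energy form in terms of weighted pairings. -/
theorem energyForm_eq (Φ Ψ : hilbert N) :
    energyForm α g Λ W m Φ Ψ =
      (∑ j : Fin N, ∑ i : Fin 3, pairing (fun _ => 1) (kineticMomentum α Λ j i Φ.1)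
        (kineticMomentum α Λ j i Ψ.1)) +
      ((g / 2 * Real.sqrt α : ℝ) : ℂ) * (∑ j : Fin N, ∑ i : Fin 3,
        pairing (fun _ => 1) Φ.1 (pauli j i (fieldB Λ j i Ψ.1))) +
      pairing (fun z => W z.1.1) Φ.1 Ψ.1 + pairing (fun z => fieldEnergy m z.2) Φ.1 Ψ.1 := by
  simp only [pairing_one]
  rfl

theorem conj_pairing_pauli_fieldB (hm : 0 ≤ m) (hΦ : Φ ∈ finiteEnergy W m)
    (hΨ : Ψ ∈ finiteEnergy W m) :
    conj (pairing (fun _ => 1) Ψ.1 (pauli j i (fieldB Λ j i Φ.1))) =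
      pairing (fun _ => 1) Φ.1 (pauli j i (fieldB Λ j i Ψ.1)) := by
  rw [conj_pairing, pairing_one, pairing_one]
  exact (integral_conj_mul_pauli_fieldOp (formFactorBound_coeffB Λ j i) (fun _ _ _ => rfl) j i
    (fieldDomain_of_mem hm hΦ) (fieldDomain_of_mem hm hΨ)).symm

theorem isHermitianForm_energyForm (hW : Measurable W) (hm : 0 ≤ m) :
    IsHermitianForm (formDomain W hW m) (energyForm α g Λ W m) where
  add_right := by
    intro Φ hΦ Ψ hΨ Ψ' hΨ'
    have fΦ := fieldDomain_of_mem hm hΦ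
    have fΨ := fieldDomain_of_mem hm hΨ
    have fΨ' := fieldDomain_of_mem hm hΨ'
    have h1 : ∀ (j : Fin N) (i : Fin 3), pairing (fun _ => 1) (kineticMomentum α Λ j i Φ.1)
        (kineticMomentum α Λ j i (Ψ + Ψ').1) = pairing (fun _ => 1) (kineticMomentum α Λ j i Φ.1)
        (kineticMomentum α Λ j i Ψ.1) + pairing (fun _ => 1) (kineticMomentum α Λ j i Φ.1)
        (kineticMomentum α Λ j i Ψ'.1) := fun j i => by
      rw [pairing_congr (ae_eq_refl _) (kineticMomentum_coe_add hm hΨ hΨ'), pairing_add_right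
        measurable_const (hasWeight_one_iff.2 (memLp_kineticMomentum fΦ))
        (hasWeight_one_iff.2 (memLp_kineticMomentum fΨ))
        (hasWeight_one_iff.2 (memLp_kineticMomentum fΨ'))]
    have h2 : ∀ (j : Fin N) (i : Fin 3), pairing (fun _ => 1) Φ.1
        (pauli j i (fieldB Λ j i (Ψ + Ψ').1)) = pairing (fun _ => 1) Φ.1
        (pauli j i (fieldB Λ j i Ψ.1)) + pairing (fun _ => 1) Φ.1
        (pauli j i (fieldB Λ j i Ψ'.1)) := fun j i => by
      rw [pairing_congr (ae_eq_refl _) (pauli_fieldB_coe_add hm hΨ hΨ'), pairing_add_right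
        measurable_const (hasWeight_one_iff.2 fΦ.memLp)
        (hasWeight_one_iff.2 (memLp_pauli_fieldB fΨ))
        (hasWeight_one_iff.2 (memLp_pauli_fieldB fΨ'))]
    have h3 : pairing (fun z => W z.1.1) Φ.1 (Ψ + Ψ').1 = pairing (fun z => W z.1.1) Φ.1 Ψ.1 +
        pairing (fun z => W z.1.1) Φ.1 Ψ'.1 := by
      rw [pairing_congr (ae_eq_refl _) (coe_add_ae Ψ Ψ').symm, pairing_add_right
        (measurable_potential hW) (hasWeight_potential hΦ) (hasWeight_potential hΨ)
        (hasWeight_potential hΨ')]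
    have h4 : pairing (fun z => fieldEnergy m z.2) Φ.1 (Ψ + Ψ').1 =
        pairing (fun z => fieldEnergy m z.2) Φ.1 Ψ.1 +
        pairing (fun z => fieldEnergy m z.2) Φ.1 Ψ'.1 := by
      rw [pairing_congr (ae_eq_refl _) (coe_add_ae Ψ Ψ').symm, pairing_add_right
        (measurable_fieldEnergy m) (hasWeight_fieldEnergy hΦ) (hasWeight_fieldEnergy hΨ)
        (hasWeight_fieldEnergy hΨ')]
    simp only [energyForm_eq, h1, h2, h3, h4, Finset.sum_add_distrib]
    ring
  smul_right := by
    intro Φ hΦ Ψ hΨ c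
    have h1 : ∀ (j : Fin N) (i : Fin 3), pairing (fun _ => 1) (kineticMomentum α Λ j i Φ.1)
        (kineticMomentum α Λ j i (c • Ψ).1) = c * pairing (fun _ => 1)
        (kineticMomentum α Λ j i Φ.1) (kineticMomentum α Λ j i Ψ.1) := fun j i => by
      rw [pairing_congr (ae_eq_refl _) (kineticMomentum_coe_smul c hΨ), pairing_const_mul_right]
    have h2 : ∀ (j : Fin N) (i : Fin 3), pairing (fun _ => 1) Φ.1
        (pauli j i (fieldB Λ j i (c • Ψ).1)) = c * pairing (fun _ => 1) Φ.1
        (pauli j i (fieldB Λ j i Ψ.1)) := fun j i => by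
      rw [pairing_congr (ae_eq_refl _) (pauli_fieldB_coe_smul c Ψ), pairing_const_mul_right]
    have h3 : ∀ w : Conf N → ℝ, pairing w Φ.1 (c • Ψ).1 = c * pairing w Φ.1 Ψ.1 := fun w => by
      rw [pairing_congr (ae_eq_refl _) (coe_smul_ae c Ψ).symm, pairing_const_mul_right]
    simp only [energyForm_eq, h1, h2, h3, ← Finset.mul_sum]
    ring
  conj_symm := by
    intro Φ hΦ Ψ hΨ
    simp only [energyForm_eq, map_add, map_mul, map_sum, Complex.conj_ofReal, conj_pairing,
      conj_pairing_pauli_fieldB hm hΦ hΨ]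

end EnergyForm

/-! ### Comparison of the energy form with its non-interacting part -/

section Coercivity

open scoped ENNReal

variable {N : ℕ} {W : (Fin N → Space) → ℝ} {m : ℝ} {α g Λ : ℝ} {j : Fin N} {i : Fin 3}
  {Φ Ψ : hilbert N}

/-- `∑_j ⟨p_j²⟩`. -/
def kineticEnergy (f : Conf N → ℂ) : ℝ :=
  ∑ j : Fin N, ∑ i : Fin 3, ∫ z, ‖weakPartial j i f z‖ ^ 2 ∂confMeasure N

/-- The negative part of `W` is infinitesimally form bounded by the kinetic energy. -/
def NegPartBounded (W : (Fin N → Space) → ℝ) : Prop :=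
  ∀ ε : ℝ, 0 < ε → ∃ a : ℝ, ∀ Ψ : hilbert N, (∀ j i, HasL2Partial j i Ψ.1) →
    HasWeight (fun z => max (-W z.1.1) 0) Ψ.1 ∧
    ∫ z, max (-W z.1.1) 0 * ‖Ψ.1 z‖ ^ 2 ∂confMeasure N ≤ ε * kineticEnergy Ψ.1 + a * ‖Ψ‖ ^ 2

/-- The expectation of `∑_j p_j² + W_+ + H_f(m)`. -/
def freeEnergy (W : (Fin N → Space) → ℝ) (m : ℝ) (f : Conf N → ℂ) : ℝ :=
  kineticEnergy f + (∫ z, max (W z.1.1) 0 * ‖f z‖ ^ 2 ∂confMeasure N) +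
    ∫ z, fieldEnergy m z.2 * ‖f z‖ ^ 2 ∂confMeasure N

theorem kineticEnergy_nonneg (f : Conf N → ℂ) : 0 ≤ kineticEnergy f :=
  Finset.sum_nonneg fun _ _ => Finset.sum_nonneg fun _ _ => integral_nonneg fun _ => sq_nonneg _

theorem integral_weight_nonneg {w : Conf N → ℝ} (hw : ∀ z, 0 ≤ w z) (f : Conf N → ℂ) :
    0 ≤ ∫ z, w z * ‖f z‖ ^ 2 ∂confMeasure N :=
  integral_nonneg fun z => mul_nonneg (hw z) (sq_nonneg _)

theorem norm_sq_coe (Ψ : hilbert N) : ‖Ψ‖ ^ 2 = ∫ z, ‖Ψ.1 z‖ ^ 2 ∂confMeasure N :=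
  norm_sq_Lp Ψ.1

theorem hasWeight_potential_iff (hW : Measurable W) {f : Conf N → ℂ} :
    HasWeight (fun z => W z.1.1) f ↔
      HasWeight (fun z => max (W z.1.1) 0) f ∧ HasWeight (fun z => max (-W z.1.1) 0) f := by
  have hm := measurable_potential hW
  refine ⟨fun hf => ⟨hf.of_le (hm.max measurable_const) fun z => ?_,
    hf.of_le (hm.neg.max measurable_const) fun z => ?_⟩, fun hf => ⟨hf.1.1, ?_⟩⟩
  · rw [abs_of_nonneg (le_max_right _ _)]
    exact max_le (le_abs_self _) (abs_nonneg _)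
  · rw [abs_of_nonneg (le_max_right _ _)]
    exact max_le (neg_le_abs _) (abs_nonneg _)
  · refine (hf.1.2.sub hf.2.2).congr (ae_of_all _ fun z => ?_)
    simp only [Pi.sub_apply, ← sub_mul]
    rw [max_zero_sub_max_neg_zero_eq_self]

theorem integral_potential_eq (hW : Measurable W) {f : Conf N → ℂ}
    (hf : HasWeight (fun z => W z.1.1) f) :
    ∫ z, W z.1.1 * ‖f z‖ ^ 2 ∂confMeasure N =
      (∫ z, max (W z.1.1) 0 * ‖f z‖ ^ 2 ∂confMeasure N) -
        ∫ z, max (-W z.1.1) 0 * ‖f z‖ ^ 2 ∂confMeasure N := by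
  obtain ⟨h1, h2⟩ := (hasWeight_potential_iff hW).1 hf
  rw [← integral_sub h1.2 h2.2]
  refine integral_congr_ae (ae_of_all _ fun z => ?_)
  simp only
  rw [← sub_mul, max_zero_sub_max_neg_zero_eq_self]

/-- The real part of the energy form: kinetic energy with field, spin-field interaction, potential
and field energy. -/
theorem re_energyForm_self (α g Λ : ℝ) (W : (Fin N → Space) → ℝ) (m : ℝ) (Ψ : hilbert N) :
    (energyForm α g Λ W m Ψ Ψ).re =
      (∑ j : Fin N, ∑ i : Fin 3, ∫ z, ‖kineticMomentum α Λ j i Ψ.1 z‖ ^ 2 ∂confMeasure N) +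
      (g / 2 * Real.sqrt α) * (∑ j : Fin N, ∑ i : Fin 3,
        (pairing (fun _ => 1) Ψ.1 (pauli j i (fieldB Λ j i Ψ.1))).re) +
      (∫ z, W z.1.1 * ‖Ψ.1 z‖ ^ 2 ∂confMeasure N) +
      ∫ z, fieldEnergy m z.2 * ‖Ψ.1 z‖ ^ 2 ∂confMeasure N := by
  rw [energyForm_eq]
  simp only [pairing_self, one_mul, Complex.add_re, Complex.re_sum, Complex.ofReal_re,
    Complex.re_ofReal_mul]

theorem abs_pairing_le {f h : Conf N → ℂ} (hf : MemLp f 2 (confMeasure N))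
    (hh : MemLp h 2 (confMeasure N)) {η : ℝ} (hη : 0 < η) (c : ℝ) :
    |c * (pairing (fun _ => 1) f h).re| ≤ η * (∫ z, ‖h z‖ ^ 2 ∂confMeasure N) +
      c ^ 2 / (4 * η) * ∫ z, ‖f z‖ ^ 2 ∂confMeasure N := by
  have i1 := (memLp_two_iff_integrable_sq_norm hf.1).1 hf
  have i2 := (memLp_two_iff_integrable_sq_norm hh.1).1 hh
  rw [pairing_one, ← Complex.re_ofReal_mul, ← integral_const_mul]
  refine (Complex.abs_re_le_norm _).trans ((norm_integral_le_integral_norm _).trans ?_)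
  rw [← integral_const_mul, ← integral_const_mul, ← integral_add (i2.const_mul _) (i1.const_mul _)]
  refine integral_mono_of_nonneg (ae_of_all _ fun z => norm_nonneg _)
    ((i2.const_mul _).add (i1.const_mul _)) (ae_of_all _ fun z => ?_)
  simp only [norm_mul, RCLike.norm_conj, Complex.norm_real, Real.norm_eq_abs]
  have h1 : 0 ≤ (2 * η * ‖h z‖ - |c| * ‖f z‖) ^ 2 / (4 * η) := by positivity
  have h2 : (2 * η * ‖h z‖ - |c| * ‖f z‖) ^ 2 / (4 * η) =
      η * ‖h z‖ ^ 2 + c ^ 2 / (4 * η) * ‖f z‖ ^ 2 - |c| * (‖f z‖ * ‖h z‖) := by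
    rw [← sq_abs c]
    field_simp
    ring
  linarith

theorem sum_sum_le {F G : Fin N → Fin 3 → ℝ} (h : ∀ j i, F j i ≤ G j i) :
    ∑ j, ∑ i, F j i ≤ ∑ j, ∑ i, G j i :=
  Finset.sum_le_sum fun j _ => Finset.sum_le_sum fun i _ => h j i

theorem sum_sum_const (N : ℕ) (c : ℝ) : ∑ _j : Fin N, ∑ _i : Fin 3, c = 3 * N * c := by
  simp; ring

theorem integral_fieldA_le {f : Conf N → ℂ} (hf : FieldDomain f) :
    ∫ z, ‖fieldA Λ j i f z‖ ^ 2 ∂confMeasure N ≤ fieldConst (coulombCutoff 4 Λ) *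
      ((∫ z, fieldEnergy 0 z.2 * ‖f z‖ ^ 2 ∂confMeasure N) +
        ∫ z, ‖f z‖ ^ 2 ∂confMeasure N) :=
  integral_fieldOp_le (formFactorBound_coeffA Λ j i) hf

theorem integral_pauli_fieldB_le {f : Conf N → ℂ} (hf : FieldDomain f) :
    ∫ z, ‖pauli j i (fieldB Λ j i f) z‖ ^ 2 ∂confMeasure N ≤
      4 * (fieldConst (coulombCutoff (16 * Λ ^ 2) Λ) *
        ((∫ z, fieldEnergy 0 z.2 * ‖f z‖ ^ 2 ∂confMeasure N) +
          ∫ z, ‖f z‖ ^ 2 ∂confMeasure N)) :=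
  (integral_pauli_le j i (measurable_fieldOp (formFactorBound_coeffB Λ j i) hf.measurable)
    (memLp_fieldOp (formFactorBound_coeffB Λ j i) hf)).trans
    (mul_le_mul_of_nonneg_left (integral_fieldOp_le (formFactorBound_coeffB Λ j i) hf)
      (by norm_num))

theorem integral_fieldEnergy_zero_le (hm : 0 ≤ m) (hΨ : Ψ ∈ finiteEnergy W m) :
    ∫ z, fieldEnergy 0 z.2 * ‖Ψ.1 z‖ ^ 2 ∂confMeasure N ≤
      ∫ z, fieldEnergy m z.2 * ‖Ψ.1 z‖ ^ 2 ∂confMeasure N :=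
  integral_mono (hasWeight_fieldEnergy_zero hm hΨ).2 (hasWeight_fieldEnergy hΨ).2 fun z =>
    mul_le_mul_of_nonneg_right (fieldEnergy_mono le_rfl hm z.2) (sq_nonneg _)

/-- The spin-field interaction is infinitesimally bounded by the field energy. -/
theorem exists_spin_bound (N : ℕ) (Λ c : ℝ) {κ : ℝ} (hκ : 0 < κ) :
    ∃ C : ℝ, 0 ≤ C ∧ ∀ f : Conf N → ℂ, FieldDomain f →
      |c * ∑ j : Fin N, ∑ i : Fin 3, (pairing (fun _ => 1) f (pauli j i (fieldB Λ j i f))).re| ≤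
        κ * (∫ z, fieldEnergy 0 z.2 * ‖f z‖ ^ 2 ∂confMeasure N) +
          C * ∫ z, ‖f z‖ ^ 2 ∂confMeasure N := by
  set b := fieldConst (coulombCutoff (16 * Λ ^ 2) Λ) with hb
  have hb0 : 0 ≤ b := fieldConst_nonneg _
  -- Each of the `3 N` components of the field costs `4 η b` of the field energy.
  set η : ℝ := κ / (12 * N * b + 1) with hη
  have hη0 : 0 < η := by positivity
  have hηle : 12 * N * b * η ≤ κ := by
    rw [hη, mul_div_assoc', div_le_iff₀ (by positivity)]
    nlinarith
  refine ⟨κ + 3 * N * (c ^ 2 / (4 * η)), by positivity, fun f hf => ?_⟩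
  set F := ∫ z, fieldEnergy 0 z.2 * ‖f z‖ ^ 2 ∂confMeasure N
  set n := ∫ z, ‖f z‖ ^ 2 ∂confMeasure N
  have hF0 : 0 ≤ F := integral_weight_nonneg (fun z => fieldEnergy_nonneg 0 z.2) f
  have hn0 : 0 ≤ n := integral_nonneg fun z => sq_nonneg _
  rw [Finset.mul_sum]
  simp only [Finset.mul_sum]
  refine (Finset.abs_sum_le_sum_abs _ _).trans ((Finset.sum_le_sum fun j _ =>
    Finset.abs_sum_le_sum_abs _ _).trans ?_)
  refine (sum_sum_le (G := fun _ _ => η * (4 * (b * (F + n))) + c ^ 2 / (4 * η) * n)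
    fun j i => ?_).trans ?_
  · refine (abs_pairing_le hf.memLp (memLp_pauli_fieldB hf) hη0 c).trans ?_
    have := integral_pauli_fieldB_le (Λ := Λ) (j := j) (i := i) hf
    have := mul_le_mul_of_nonneg_left this hη0.le
    linarith
  · rw [sum_sum_const]
    have := mul_le_mul_of_nonneg_right hηle (add_nonneg hF0 hn0)
    linarith

/-- The energy form is bounded below, and controls `∑_j p_j² + W_+ + H_f(m)`. -/
theorem exists_coercive (hW : Measurable W) (hneg : NegPartBounded W) (hm : 0 ≤ m) (hα : 0 ≤ α) :
    ∃ δ C : ℝ, 0 < δ ∧ 0 ≤ C ∧ ∀ Ψ ∈ finiteEnergy W m,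
      δ * freeEnergy W m Ψ.1 ≤ (energyForm α g Λ W m Ψ Ψ).re + C * ‖Ψ‖ ^ 2 := by
  set a := fieldConst (coulombCutoff 4 Λ) with ha
  have ha0 : 0 ≤ a := fieldConst_nonneg _
  -- The fraction `d` of the kinetic energy is used; the field energy absorbs its `A²` term.
  set d : ℝ := (12 * N * α * a + 1)⁻¹ with hd
  have hd0 : 0 < d := by positivity
  have hd1 : d ≤ 1 := inv_le_one_of_one_le₀ (by
    have : 0 ≤ 12 * N * α * a := by positivity
    linarith)
  have hdle : d * (12 * N * α * a) ≤ 1 := by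
    rw [hd, inv_mul_le_iff₀ (by positivity)]
    linarith
  obtain ⟨Cs, hCs0, hCs⟩ := exists_spin_bound N Λ (g / 2 * Real.sqrt α) (κ := 1 / 4) (by norm_num)
  obtain ⟨b, hb⟩ := hneg (d / 4) (by positivity)
  refine ⟨d / 4, Cs + 1 / 4 + |b|, by positivity, by positivity, fun Ψ hΨ => ?_⟩
  have fΨ := fieldDomain_of_mem hm hΨ
  have hS := abs_le.1 (hCs Ψ.1 fΨ)
  have hF := integral_fieldEnergy_zero_le hm hΨ
  obtain ⟨-, hV⟩ := hb Ψ hΨ.1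
  rw [re_energyForm_self, integral_potential_eq hW (hasWeight_potential hΨ), freeEnergy]
  rw [norm_sq_coe] at hV ⊢
  have hV0 : 0 ≤ ∫ z, max (W z.1.1) 0 * ‖Ψ.1 z‖ ^ 2 ∂confMeasure N :=
    integral_weight_nonneg (fun z => le_max_right _ _) _
  have hF0 : 0 ≤ ∫ z, fieldEnergy 0 z.2 * ‖Ψ.1 z‖ ^ 2 ∂confMeasure N :=
    integral_weight_nonneg (fun z => fieldEnergy_nonneg 0 z.2) _
  have hn0 : 0 ≤ ∫ z, ‖Ψ.1 z‖ ^ 2 ∂confMeasure N := integral_nonneg fun z => sq_nonneg _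
  have hP0 := kineticEnergy_nonneg (Ψ.1 : Conf N → ℂ)
  have hK0 : 0 ≤ ∑ j : Fin N, ∑ i : Fin 3,
      ∫ z, ‖kineticMomentum α Λ j i Ψ.1 z‖ ^ 2 ∂confMeasure N :=
    Finset.sum_nonneg fun _ _ => Finset.sum_nonneg fun _ _ => integral_nonneg fun _ => sq_nonneg _
  have hP : kineticEnergy (Ψ.1 : Conf N → ℂ) ≤ 2 * (∑ j : Fin N, ∑ i : Fin 3,
      ∫ z, ‖kineticMomentum α Λ j i Ψ.1 z‖ ^ 2 ∂confMeasure N) + 3 * N * (2 * (α * (a *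
      ((∫ z, fieldEnergy 0 z.2 * ‖Ψ.1 z‖ ^ 2 ∂confMeasure N) +
        ∫ z, ‖Ψ.1 z‖ ^ 2 ∂confMeasure N)))) := by
    rw [← sum_sum_const, Finset.mul_sum]
    simp only [Finset.mul_sum]
    rw [← Finset.sum_add_distrib]
    simp only [← Finset.sum_add_distrib]
    refine sum_sum_le fun j i => ?_
    have h1 := integral_weakPartial_le (α := α) (Λ := Λ) (j := j) (i := i) hα fΨ
    have h2 := mul_le_mul_of_nonneg_left (integral_fieldA_le (Λ := Λ) (j := j) (i := i) fΨ) hα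
    linarith
  set P := kineticEnergy (Ψ.1 : Conf N → ℂ)
  set K := ∑ j : Fin N, ∑ i : Fin 3,
      ∫ z, ‖kineticMomentum α Λ j i Ψ.1 z‖ ^ 2 ∂confMeasure N
  set F0 := ∫ z, fieldEnergy 0 z.2 * ‖Ψ.1 z‖ ^ 2 ∂confMeasure N
  set n := ∫ z, ‖Ψ.1 z‖ ^ 2 ∂confMeasure N
  have h1 : d * P ≤ 2 * (d * K) + (1 / 2) * (F0 + n) := by
    have h2 := mul_le_mul_of_nonneg_left hP hd0.le
    have h3 := mul_le_mul_of_nonneg_right hdle (add_nonneg hF0 hn0)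
    linarith
  have h2 : d * K ≤ K := mul_le_of_le_one_left hK0 hd1
  have h3 : b * n ≤ |b| * n := mul_le_mul_of_nonneg_right (le_abs_self b) hn0
  have h4 := mul_le_mul_of_nonneg_right hd1 hV0
  have h5 := mul_le_mul_of_nonneg_right hd1 (hF0.trans hF)
  linarith [hS.1]

/-- The energy form is bounded by `∑_j p_j² + W_+ + H_f(m)`. -/
theorem exists_energyForm_le (hW : Measurable W) (hneg : NegPartBounded W) (hm : 0 ≤ m)
    (hα : 0 ≤ α) : ∃ C : ℝ, 0 ≤ C ∧ ∀ Ψ ∈ finiteEnergy W m,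
      |(energyForm α g Λ W m Ψ Ψ).re| ≤ C * (freeEnergy W m Ψ.1 + ‖Ψ‖ ^ 2) := by
  set a := fieldConst (coulombCutoff 4 Λ) with ha
  have ha0 : 0 ≤ a := fieldConst_nonneg _
  obtain ⟨Cs, hCs0, hCs⟩ := exists_spin_bound N Λ (g / 2 * Real.sqrt α) (κ := 1) (by norm_num)
  obtain ⟨b, hb⟩ := hneg 1 (by positivity)
  refine ⟨Cs + 4 + |b| + 6 * N * α * a, by positivity, fun Ψ hΨ => ?_⟩
  have fΨ := fieldDomain_of_mem hm hΨ
  have hS := abs_le.1 (hCs Ψ.1 fΨ)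
  have hF := integral_fieldEnergy_zero_le hm hΨ
  obtain ⟨-, hV⟩ := hb Ψ hΨ.1
  rw [re_energyForm_self, integral_potential_eq hW (hasWeight_potential hΨ), freeEnergy]
  rw [norm_sq_coe] at hV ⊢
  have hV0 : 0 ≤ ∫ z, max (W z.1.1) 0 * ‖Ψ.1 z‖ ^ 2 ∂confMeasure N :=
    integral_weight_nonneg (fun z => le_max_right _ _) _
  have hV0' : 0 ≤ ∫ z, max (-W z.1.1) 0 * ‖Ψ.1 z‖ ^ 2 ∂confMeasure N :=
    integral_weight_nonneg (fun z => le_max_right _ _) _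
  have hF0 : 0 ≤ ∫ z, fieldEnergy 0 z.2 * ‖Ψ.1 z‖ ^ 2 ∂confMeasure N :=
    integral_weight_nonneg (fun z => fieldEnergy_nonneg 0 z.2) _
  have hn0 : 0 ≤ ∫ z, ‖Ψ.1 z‖ ^ 2 ∂confMeasure N := integral_nonneg fun z => sq_nonneg _
  have hP0 := kineticEnergy_nonneg (Ψ.1 : Conf N → ℂ)
  have hK0 : 0 ≤ ∑ j : Fin N, ∑ i : Fin 3,
      ∫ z, ‖kineticMomentum α Λ j i Ψ.1 z‖ ^ 2 ∂confMeasure N :=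
    Finset.sum_nonneg fun _ _ => Finset.sum_nonneg fun _ _ => integral_nonneg fun _ => sq_nonneg _
  have hK : ∑ j : Fin N, ∑ i : Fin 3,
      ∫ z, ‖kineticMomentum α Λ j i Ψ.1 z‖ ^ 2 ∂confMeasure N ≤
      2 * kineticEnergy (Ψ.1 : Conf N → ℂ) + 3 * N * (2 * (α * (a *
      ((∫ z, fieldEnergy 0 z.2 * ‖Ψ.1 z‖ ^ 2 ∂confMeasure N) +
        ∫ z, ‖Ψ.1 z‖ ^ 2 ∂confMeasure N)))) := by
    rw [← sum_sum_const, kineticEnergy, Finset.mul_sum]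
    simp only [Finset.mul_sum]
    rw [← Finset.sum_add_distrib]
    simp only [← Finset.sum_add_distrib]
    refine sum_sum_le fun j i => ?_
    have h1 := integral_kineticMomentum_le (α := α) (Λ := Λ) (j := j) (i := i) hα fΨ
    have h2 := mul_le_mul_of_nonneg_left (integral_fieldA_le (Λ := Λ) (j := j) (i := i) fΨ) hα
    linarith
  set P := kineticEnergy (Ψ.1 : Conf N → ℂ)
  set K := ∑ j : Fin N, ∑ i : Fin 3,
      ∫ z, ‖kineticMomentum α Λ j i Ψ.1 z‖ ^ 2 ∂confMeasure N
  set F0 := ∫ z, fieldEnergy 0 z.2 * ‖Ψ.1 z‖ ^ 2 ∂confMeasure N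
  set F := ∫ z, fieldEnergy m z.2 * ‖Ψ.1 z‖ ^ 2 ∂confMeasure N
  set V := ∫ z, max (W z.1.1) 0 * ‖Ψ.1 z‖ ^ 2 ∂confMeasure N
  set V' := ∫ z, max (-W z.1.1) 0 * ‖Ψ.1 z‖ ^ 2 ∂confMeasure N
  set n := ∫ z, ‖Ψ.1 z‖ ^ 2 ∂confMeasure N
  have hFm : 0 ≤ F := hF0.trans hF
  have h3 : b * n ≤ |b| * n := mul_le_mul_of_nonneg_right (le_abs_self b) hn0
  have c1 : 0 ≤ 6 * N * α * a := by positivity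
  have c2 : 6 * N * α * a * F0 ≤ 6 * N * α * a * F := mul_le_mul_of_nonneg_left hF c1
  have p1 := mul_nonneg c1 hP0
  have p2 := mul_nonneg c1 hV0
  have p4 := mul_nonneg hCs0 hP0
  have p5 := mul_nonneg hCs0 hV0
  have p6 := mul_nonneg hCs0 hFm
  have p7 := mul_nonneg (abs_nonneg b) hP0
  have p8 := mul_nonneg (abs_nonneg b) hV0
  have p9 := mul_nonneg (abs_nonneg b) hFm
  have p10 := mul_nonneg hCs0 hn0
  have p11 := mul_nonneg (abs_nonneg b) hn0
  have p12 := mul_nonneg c1 hn0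
  have p13 := mul_nonneg c1 hFm
  rw [abs_le]
  constructor <;> nlinarith [hS.1, hS.2]

end Coercivity

/-! ### Closedness of the energy form -/

section Closedness

open scoped ENNReal

variable {N : ℕ} {W : (Fin N → Space) → ℝ} {m : ℝ} {α g Λ : ℝ} {j : Fin N} {i : Fin 3}

theorem integral_norm_sub_sq (u v : Lp ℂ 2 (confMeasure N)) :
    ∫ z, ‖u z - v z‖ ^ 2 ∂confMeasure N = ‖u - v‖ ^ 2 := by
  rw [norm_sq_Lp]
  refine integral_congr_ae ?_
  filter_upwards [Lp.coeFn_sub u v] with z hz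
  rw [hz, Pi.sub_apply]

theorem lintegral_norm_sub_sq (u v : Lp ℂ 2 (confMeasure N)) :
    ∫⁻ z, ‖u z - v z‖ₑ ^ 2 ∂confMeasure N = ENNReal.ofReal (‖u - v‖ ^ 2) := by
  rw [← integral_norm_sub_sq]
  exact lintegral_sq_eq_ofReal ((Lp.memLp u).sub (Lp.memLp v))

theorem tendsto_lintegral_norm_sub_sq {u : ℕ → Lp ℂ 2 (confMeasure N)}
    {x : Lp ℂ 2 (confMeasure N)} (hu : Tendsto u atTop (𝓝 x)) :
    Tendsto (fun k => ∫⁻ z, ‖u k z - x z‖ₑ ^ 2 ∂confMeasure N) atTop (𝓝 0) := by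
  simp only [lintegral_norm_sub_sq]
  have h1 := (tendsto_iff_norm_sub_tendsto_zero.1 hu).pow 2
  simpa using ENNReal.tendsto_ofReal h1

/-- Nonnegative multiplication operators are closed, in terms of integrals. -/
theorem HasWeight.tendsto_of_cauchy {w : Conf N → ℝ} (hw : Measurable w) (hw0 : ∀ z, 0 ≤ w z)
    {u : ℕ → Lp ℂ 2 (confMeasure N)} {x : Lp ℂ 2 (confMeasure N)} (hu : Tendsto u atTop (𝓝 x))
    (hu2 : ∀ k, HasWeight w (u k))
    (hC : Tendsto (fun kl : ℕ × ℕ => ∫ z, w z * ‖(u kl.1 - u kl.2 : Lp ℂ 2 (confMeasure N)) z‖ ^ 2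
      ∂confMeasure N) atTop (𝓝 0)) :
    HasWeight w x ∧ Tendsto (fun k => ∫ z, w z * ‖(u k - x : Lp ℂ 2 (confMeasure N)) z‖ ^ 2
      ∂confMeasure N) atTop (𝓝 0) := by
  have hsub : ∀ u v : Lp ℂ 2 (confMeasure N),
      ∫⁻ z, ENNReal.ofReal (w z) * ‖u z - v z‖ₑ ^ 2 ∂confMeasure N =
        ∫⁻ z, ENNReal.ofReal (w z) * ‖(u - v : Lp ℂ 2 (confMeasure N)) z‖ₑ ^ 2
          ∂confMeasure N := by
    intro u v
    refine lintegral_congr_ae ?_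
    filter_upwards [Lp.coeFn_sub u v] with z hz
    rw [hz, Pi.sub_apply]
  have hd : ∀ u v : Lp ℂ 2 (confMeasure N), HasWeight w u → HasWeight w v →
      HasWeight w (u - v : Lp ℂ 2 (confMeasure N)) := by
    intro u v h1 h2
    refine (h1.add hw (h2.const_mul (-1))).congr ?_
    filter_upwards [Lp.coeFn_sub u v] with z hz
    rw [hz, Pi.sub_apply, Pi.add_apply]
    ring
  have h1 : Tendsto (fun kl : ℕ × ℕ => ∫⁻ z, ENNReal.ofReal (w z) * ‖u kl.1 z - u kl.2 z‖ₑ ^ 2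
      ∂confMeasure N) atTop (𝓝 0) := by
    have h2 := ENNReal.tendsto_ofReal hC
    rw [ENNReal.ofReal_zero] at h2
    refine h2.congr fun kl => ?_
    rw [hsub, lintegral_weight_eq_ofReal hw hw0 (hd _ _ (hu2 _) (hu2 _))]
  have h2 := tendsto_weight_of_cauchy hw hu h1
  simp only [hsub] at h2
  constructor
  · obtain ⟨k, hk⟩ := (h2.eventually_lt_const ENNReal.zero_lt_top).exists
    have h3 := (hasWeight_iff_lintegral hw hw0 (Lp.memLp (u k - x)).1).2 hk
    refine ((hu2 k).add hw (h3.const_mul (-1))).congr ?_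
    filter_upwards [Lp.coeFn_sub (u k) x] with z hz
    rw [Pi.add_apply, hz, Pi.sub_apply]
    ring
  · have h3 := (ENNReal.tendsto_toReal ENNReal.zero_ne_top).comp h2
    rw [ENNReal.toReal_zero] at h3
    refine h3.congr fun k => ?_
    rw [integral_weight_eq hw hw0 (Lp.memLp (u k - x)).1]
    rfl

theorem weakPartial_coe_sub {u v : Lp ℂ 2 (confMeasure N)} (hu : HasL2Partial j i u)
    (hv : HasL2Partial j i v) :
    weakPartial j i (u - v : Lp ℂ 2 (confMeasure N)) =ᵐ[confMeasure N]
      fun z => weakPartial j i u z - weakPartial j i v z := by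
  have h1 : (fun z => u z + -1 * v z) =ᵐ[confMeasure N] (u - v : Lp ℂ 2 (confMeasure N)) := by
    filter_upwards [Lp.coeFn_sub u v] with z hz
    rw [hz, Pi.sub_apply]
    ring
  have h2 := weakPartial_congr (hu.add (hv.const_mul (-1)) (Lp.memLp u)
    ((Lp.memLp v).const_mul (-1))) h1
  filter_upwards [h2, weakPartial_add hu (hv.const_mul (-1)) (Lp.memLp u)
    ((Lp.memLp v).const_mul (-1)), weakPartial_const_mul hv (-1)] with z h3 h4 h5
  rw [h3, h4, Pi.add_apply, h5]
  ring

/-- Weak differentiation is a closed operator, in terms of integrals. -/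
theorem HasL2Partial.tendsto_of_cauchy {u : ℕ → Lp ℂ 2 (confMeasure N)}
    {x : Lp ℂ 2 (confMeasure N)} (hu : Tendsto u atTop (𝓝 x)) (hu2 : ∀ k, HasL2Partial j i (u k))
    (hC : Tendsto (fun kl : ℕ × ℕ =>
      ∫ z, ‖weakPartial j i (u kl.1 - u kl.2 : Lp ℂ 2 (confMeasure N)) z‖ ^ 2
        ∂confMeasure N) atTop (𝓝 0)) :
    HasL2Partial j i x ∧ Tendsto (fun k =>
      ∫ z, ‖weakPartial j i (u k - x : Lp ℂ 2 (confMeasure N)) z‖ ^ 2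
        ∂confMeasure N) atTop (𝓝 0) := by
  set D : ℕ → Lp ℂ 2 (confMeasure N) := fun k => (memLp_weakPartial j i (u k)).toLp with hD
  have hDae : ∀ k, D k =ᵐ[confMeasure N] weakPartial j i (u k) := fun k => MemLp.coeFn_toLp _
  have hDC : Tendsto (fun kl : ℕ × ℕ => ‖D kl.1 - D kl.2‖ ^ 2) atTop (𝓝 0) := by
    refine hC.congr fun kl => ?_
    rw [← integral_norm_sub_sq]
    refine integral_congr_ae ?_
    filter_upwards [weakPartial_coe_sub (hu2 kl.1) (hu2 kl.2), hDae kl.1, hDae kl.2]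
      with z h1 h2 h3
    rw [h1, h2, h3]
  have hcs : CauchySeq D := by
    have h1 := hDC.sqrt
    simp only [Real.sqrt_sq (norm_nonneg _), Real.sqrt_zero] at h1
    rw [cauchySeq_iff_tendsto_dist_atTop_0]
    simpa only [dist_eq_norm] using h1
  obtain ⟨G, hG⟩ := cauchySeq_tendsto_of_complete hcs
  have hx : IsWeakPartial j i x G := isWeakPartial_of_tendsto (fun k => Lp.memLp (u k))
    (fun k => Lp.memLp (D k)) (Lp.memLp x) (Lp.memLp G)
    (fun k => (hu2 k).isWeakPartial.congr (ae_eq_refl _) (hDae k).symm)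
    (tendsto_lintegral_norm_sub_sq hu) (tendsto_lintegral_norm_sub_sq hG)
  have hx2 : HasL2Partial j i x := ⟨G, Lp.memLp G, hx⟩
  refine ⟨hx2, ?_⟩
  have h1 := (tendsto_iff_norm_sub_tendsto_zero.1 hG).pow 2
  rw [zero_pow two_ne_zero] at h1
  refine h1.congr fun k => ?_
  rw [← integral_norm_sub_sq]
  refine integral_congr_ae ?_
  filter_upwards [weakPartial_coe_sub (hu2 k) hx2, hDae k, weakPartial_ae_eq hx (Lp.memLp G)]
    with z h1 h2 h3
  rw [h1, h2, h3]

theorem integral_weakPartial_le_kineticEnergy (j : Fin N) (i : Fin 3) (f : Conf N → ℂ) :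
    ∫ z, ‖weakPartial j i f z‖ ^ 2 ∂confMeasure N ≤ kineticEnergy f := by
  have h0 : ∀ (j : Fin N) (i : Fin 3), 0 ≤ ∫ z, ‖weakPartial j i f z‖ ^ 2 ∂confMeasure N :=
    fun j i => integral_nonneg fun _ => sq_nonneg _
  exact (Finset.single_le_sum (f := fun i => ∫ z, ‖weakPartial j i f z‖ ^ 2 ∂confMeasure N)
    (fun i _ => h0 j i) (Finset.mem_univ i)).trans (Finset.single_le_sum
      (f := fun j => ∑ i : Fin 3, ∫ z, ‖weakPartial j i f z‖ ^ 2 ∂confMeasure N)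
      (fun j _ => Finset.sum_nonneg fun i _ => h0 j i) (Finset.mem_univ j))

theorem freeEnergy_nonneg (W : (Fin N → Space) → ℝ) (m : ℝ) (f : Conf N → ℂ) :
    0 ≤ freeEnergy W m f :=
  add_nonneg (add_nonneg (kineticEnergy_nonneg f)
    (integral_weight_nonneg (fun _ => le_max_right _ _) f))
    (integral_weight_nonneg (fun z => fieldEnergy_nonneg m z.2) f)

/-- The domain of `∑_j p_j² + W_+ + H_f(m)` is complete in the form norm. -/
theorem freeEnergy_closed (hW : Measurable W) (hneg : NegPartBounded W)
    {u : ℕ → hilbert N} {x : hilbert N} (hu : ∀ k, u k ∈ finiteEnergy W m)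
    (hlim : Tendsto u atTop (𝓝 x))
    (hC : Tendsto (fun kl : ℕ × ℕ => freeEnergy W m (u kl.1 - u kl.2).1) atTop (𝓝 0)) :
    x ∈ finiteEnergy W m ∧ Tendsto (fun k => freeEnergy W m (u k - x).1) atTop (𝓝 0) := by
  have hlim' : Tendsto (fun k => (u k).1) atTop (𝓝 x.1) :=
    (continuous_subtype_val.tendsto x).comp hlim
  have hV0 : ∀ z : Conf N, 0 ≤ max (W z.1.1) 0 := fun z => le_max_right _ _
  have hVm : Measurable fun z : Conf N => max (W z.1.1) 0 :=
    (measurable_potential hW).max measurable_const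
  have hF0 : ∀ z : Conf N, 0 ≤ fieldEnergy m z.2 := fun z => fieldEnergy_nonneg m z.2
  have hsq : ∀ {F : ℕ × ℕ → ℝ}, (∀ kl, 0 ≤ F kl) →
      (∀ kl, F kl ≤ freeEnergy W m (u kl.1 - u kl.2).1) → Tendsto F atTop (𝓝 0) := fun h0 h1 =>
    tendsto_of_tendsto_of_tendsto_of_le_of_le tendsto_const_nhds hC h0 h1
  have hp : ∀ (j : Fin N) (i : Fin 3), HasL2Partial j i x.1 ∧ Tendsto (fun k =>
      ∫ z, ‖weakPartial j i (u k - x).1 z‖ ^ 2 ∂confMeasure N) atTop (𝓝 0) := by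
    intro j i
    refine HasL2Partial.tendsto_of_cauchy hlim' (fun k => (hu k).1 j i) (hsq (fun kl =>
      integral_nonneg fun _ => sq_nonneg _) fun kl => ?_)
    refine (integral_weakPartial_le_kineticEnergy j i _).trans ?_
    have h1 := integral_weight_nonneg hV0 (u kl.1 - u kl.2).1
    have h2 := integral_weight_nonneg hF0 (u kl.1 - u kl.2).1
    change kineticEnergy ((u kl.1 - u kl.2).1 : Conf N → ℂ) ≤ _
    unfold freeEnergy
    linarith
  have hv := HasWeight.tendsto_of_cauchy hVm hV0 hlim'
    (fun k => ((hasWeight_potential_iff hW).1 (hasWeight_potential (hu k))).1)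
    (hsq (fun kl => integral_weight_nonneg hV0 _) fun kl => by
      have h1 := kineticEnergy_nonneg ((u kl.1 - u kl.2).1 : Conf N → ℂ)
      have h2 := integral_weight_nonneg hF0 (u kl.1 - u kl.2).1
      change ∫ z, max (W z.1.1) 0 * ‖(u kl.1 - u kl.2).1 z‖ ^ 2 ∂confMeasure N ≤ _
      unfold freeEnergy
      linarith)
  have hf := HasWeight.tendsto_of_cauchy (measurable_fieldEnergy m) hF0 hlim'
    (fun k => hasWeight_fieldEnergy (hu k))
    (hsq (fun kl => integral_weight_nonneg hF0 _) fun kl => by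
      have h1 := kineticEnergy_nonneg ((u kl.1 - u kl.2).1 : Conf N → ℂ)
      have h2 := integral_weight_nonneg hV0 (u kl.1 - u kl.2).1
      change ∫ z, fieldEnergy m z.2 * ‖(u kl.1 - u kl.2).1 z‖ ^ 2 ∂confMeasure N ≤ _
      unfold freeEnergy
      linarith)
  constructor
  · obtain ⟨a, ha⟩ := hneg 1 one_pos
    exact ⟨fun j i => (hp j i).1, ((hasWeight_potential_iff hW).2
      ⟨hv.1, (ha x fun j i => (hp j i).1).1⟩).2, hf.1.2⟩
  · have h1 : Tendsto (fun k => kineticEnergy ((u k - x).1 : Conf N → ℂ)) atTop (𝓝 0) := by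
      have := tendsto_finsetSum (Finset.univ : Finset (Fin N)) fun j _ =>
        tendsto_finsetSum (Finset.univ : Finset (Fin 3)) fun i _ => (hp j i).2
      simpa using! this
    have h2 := (h1.add hv.2).add hf.2
    simpa using! h2

theorem tendsto_norm_sub_prod {u : ℕ → hilbert N} {x : hilbert N} (hlim : Tendsto u atTop (𝓝 x)) :
    Tendsto (fun kl : ℕ × ℕ => ‖u kl.1 - u kl.2‖ ^ 2) atTop (𝓝 0) := by
  have h1 := cauchySeq_iff_tendsto_dist_atTop_0.1 hlim.cauchySeq
  simpa [dist_eq_norm] using h1.pow 2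

/-- Form-Cauchy sequences are Cauchy for the non-interacting form by coercivity, and convergence for
the non-interacting form implies form convergence. -/
theorem isClosedForm_energyForm (hW : Measurable W) (hneg : NegPartBounded W) (hm : 0 ≤ m)
    (hα : 0 ≤ α) : IsClosedForm (formDomain W hW m) (energyForm α g Λ W m) := by
  intro u x hu hlim hC
  obtain ⟨δ, C, hδ, hC0, hlow⟩ := exists_coercive (g := g) (Λ := Λ) hW hneg hm hα
  obtain ⟨C', hC'0, hup⟩ := exists_energyForm_le (g := g) (Λ := Λ) hW hneg hm hα
  have hre : Tendsto (fun kl : ℕ × ℕ =>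
      (energyForm α g Λ W m (u kl.1 - u kl.2) (u kl.1 - u kl.2)).re) atTop (𝓝 0) :=
    (Complex.continuous_re.tendsto 0).comp hC
  have h1 : Tendsto (fun kl : ℕ × ℕ => freeEnergy W m (u kl.1 - u kl.2).1) atTop (𝓝 0) := by
    have h2 := (hre.add ((tendsto_norm_sub_prod hlim).const_mul C)).const_mul δ⁻¹
    rw [mul_zero, add_zero, mul_zero] at h2
    refine tendsto_of_tendsto_of_tendsto_of_le_of_le tendsto_const_nhds h2
      (fun kl => freeEnergy_nonneg _ _ _) fun kl => ?_
    rw [le_inv_mul_iff₀ hδ]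
    exact hlow _ ((formDomain W hW m).sub_mem (hu _) (hu _))
  obtain ⟨hx, h2⟩ := freeEnergy_closed hW hneg hu hlim h1
  refine ⟨hx, ?_⟩
  have h3 : Tendsto (fun k => C' * (freeEnergy W m (u k - x).1 + ‖u k - x‖ ^ 2)) atTop (𝓝 0) := by
    have h4 := (h2.add ((tendsto_iff_norm_sub_tendsto_zero.1 hlim).pow 2)).const_mul C'
    simpa using h4
  have h5 : Tendsto (fun k => (energyForm α g Λ W m (u k - x) (u k - x)).re) atTop (𝓝 0) := by
    refine squeeze_zero_norm (fun k => ?_) h3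
    exact hup _ ((formDomain W hW m).sub_mem (hu k) hx)
  have h6 : ∀ k, energyForm α g Λ W m (u k - x) (u k - x) =
      (((energyForm α g Λ W m (u k - x) (u k - x)).re : ℝ) : ℂ) := fun k =>
    (Complex.conj_eq_iff_real.1 ((isHermitianForm_energyForm hW hm).conj_symm _
      ((formDomain W hW m).sub_mem (hu k) hx) _ ((formDomain W hW m).sub_mem (hu k) hx))).elim
      fun r hr => by rw [hr, Complex.ofReal_re]
  rw [show (fun k => energyForm α g Λ W m (u k - x) (u k - x)) = fun k =>
    (((energyForm α g Λ W m (u k - x) (u k - x)).re : ℝ) : ℂ) from funext h6]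
  simpa using! (Complex.continuous_ofReal.tendsto 0).comp h5

end Closedness

/-! ### A vector of finite energy -/

section TestVector

open scoped ENNReal

variable {N : ℕ}

/-- A Vandermonde determinant times a cutoff is a smooth compactly supported antisymmetric function
of `N` points. -/
theorem exists_antisymmetric_test (N : ℕ) :
    ∃ F : (Fin N → Space) → ℝ, ContDiff ℝ ∞ F ∧ HasCompactSupport F ∧ F ≠ 0 ∧
      ∀ (σ : Equiv.Perm (Fin N)) (X : Fin N → Space),
        F (X ∘ σ) = ((Equiv.Perm.sign σ : ℤ) : ℝ) * F X := by
  let b : ContDiffBump (0 : Space) := ⟨1, 2, one_pos, one_lt_two⟩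
  refine ⟨fun X => (Matrix.vandermonde fun j => X j 0).det * ∏ j, b (X j), ?_, ?_, ?_, ?_⟩
  · refine ContDiff.mul ?_ (contDiff_prod fun j _ => b.contDiff.comp (contDiff_apply ℝ Space j))
    simp only [Matrix.det_apply, Matrix.vandermonde_apply]
    refine ContDiff.sum fun σ _ => ContDiff.const_smul _ (contDiff_prod fun j _ => ContDiff.pow ?_ _)
    fun_prop
  · refine HasCompactSupport.of_support_subset_isCompact
      (K := Set.univ.pi fun _ : Fin N => Metric.closedBall (0 : Space) 2)
      (isCompact_univ_pi fun _ => isCompact_closedBall _ _) fun X hX j _ => ?_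
    have h1 : b (X j) ≠ 0 := fun h => hX (mul_eq_zero_of_right _
      (Finset.prod_eq_zero (f := fun j => b (X j)) (Finset.mem_univ j) h))
    have h2 : X j ∈ Function.support b := h1
    rw [b.support_eq] at h2
    exact Metric.ball_subset_closedBall h2
  · intro h
    -- Distinct points in the unit ball, where the cutoff is one.
    have h1 := congrFun h fun j : Fin N => EuclideanSpace.single 0 ((j : ℝ) / N)
    simp only [Pi.zero_apply, mul_eq_zero, Finset.prod_eq_zero_iff] at h1
    rcases h1 with h1 | ⟨j, -, h1⟩
    · revert h1
      rw [imp_false, ← ne_eq, Matrix.det_vandermonde_ne_zero_iff]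
      intro j l hjl
      have hN : (N : ℝ) ≠ 0 := by
        have := j.pos
        positivity
      simpa [div_left_inj' hN, Fin.ext_iff] using hjl
    · have hN : (0 : ℝ) < N := by
        have := j.pos
        exact_mod_cast this
      rw [b.one_of_mem_closedBall] at h1
      · exact one_ne_zero h1
      · rw [mem_closedBall_zero_iff, PiLp.norm_single, Real.norm_of_nonneg (by positivity)]
        change _ ≤ (1 : ℝ)
        rw [div_le_one hN]
        exact_mod_cast j.2.le
  · intro σ X
    have h1 := Matrix.det_permute σ (Matrix.vandermonde fun j => X j 0)
    have h2 : ∏ j, b ((X ∘ σ) j) = ∏ j, b (X j) := Equiv.prod_comp σ fun j => b (X j)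
    simp only [h2]
    rw [← mul_assoc, ← h1]
    rfl

theorem measurable_photonNumber : Measurable fun κ : PhotonConf => κ.1 := by
  refine fun t _ => MeasurableSpace.measurableSet_iInf.2 fun n => ?_
  change MeasurableSet {_K : Fin n → Mode | n ∈ t}
  exact MeasurableSet.const _

theorem photonMeasure_vacuum : photonMeasure {κ | κ.1 = 0} = 1 := by
  have hm : MeasurableSet {κ : PhotonConf | κ.1 = 0} :=
    measurable_photonNumber (measurableSet_singleton 0)
  rw [photonMeasure, Measure.sum_apply _ hm, tsum_eq_single 0]
  · rw [(measurableEmbedding_sigmaMk 0).map_apply]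
    simp
  · intro n hn
    rw [(measurableEmbedding_sigmaMk n).map_apply]
    simp [hn]

/-- `F ⊗` (photon vacuum), independent of the electron spins. -/
def vacuumLift (F : (Fin N → Space) → ℝ) : Conf N → ℂ :=
  fun z => if z.2.1 = 0 then (F z.1.1 : ℂ) else 0

theorem measurable_vacuumLift {F : (Fin N → Space) → ℝ} (hF : Measurable F) :
    Measurable (vacuumLift F) := by
  have h1 : Measurable fun z : Conf N => z.2.1 := measurable_photonNumber.comp measurable_snd
  exact Measurable.ite (h1 (measurableSet_singleton 0))
    (Complex.measurable_ofReal.comp (hF.comp (measurable_fst.comp measurable_fst)))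
    measurable_const

theorem lintegral_vacuumLift {F : (Fin N → Space) → ℝ} (hF : Measurable F)
    {w : (Fin N → Space) → ℝ≥0∞} (hw : Measurable w) :
    ∫⁻ z, w z.1.1 * ‖vacuumLift F z‖ₑ ^ 2 ∂confMeasure N =
      Fintype.card (Fin N → Fin 2) * ∫⁻ X, w X * ‖F X‖ₑ ^ 2 := by
  have hm : MeasurableSet {κ : PhotonConf | κ.1 = 0} :=
    measurable_photonNumber (measurableSet_singleton 0)
  have hm2 : Measurable fun z : Conf N => w z.1.1 * ‖vacuumLift F z‖ₑ ^ 2 :=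
    (hw.comp (measurable_fst.comp measurable_fst)).mul
      ((measurable_vacuumLift hF).enorm.pow_const 2)
  rw [lintegral_slice hm2]
  have h1 : ∀ κ : PhotonConf, (∑ s : Fin N → Fin 2, ∫⁻ X : Fin N → Space,
      w X * ‖vacuumLift F ((X, s), κ)‖ₑ ^ 2) = {κ : PhotonConf | κ.1 = 0}.indicator
        (fun _ => Fintype.card (Fin N → Fin 2) * ∫⁻ X, w X * ‖F X‖ₑ ^ 2) κ := by
    intro κ
    by_cases h : κ.1 = 0
    · rw [Set.indicator_of_mem (by exact h)]
      have h2 : ∀ X s, ‖vacuumLift F ((X, s), κ)‖ₑ = ‖F X‖ₑ := fun X s => by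
        simp only [vacuumLift, h, if_true]
        rw [← ofReal_norm, Complex.norm_real, ofReal_norm]
      simp only [h2, Finset.sum_const, nsmul_eq_mul, Finset.card_univ]
    · rw [Set.indicator_of_notMem (by exact h)]
      simp [vacuumLift, h]
  simp only [h1]
  rw [lintegral_indicator_const hm, photonMeasure_vacuum, mul_one]

theorem memLp_vacuumLift {F : (Fin N → Space) → ℝ} (hF : Continuous F) (hc : HasCompactSupport F) :
    MemLp (vacuumLift F) 2 (confMeasure N) := by
  rw [memLp_two_iff (measurable_vacuumLift hF.measurable).aestronglyMeasurable]
  have h1 := lintegral_vacuumLift (w := 1) hF.measurable measurable_const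
  simp only [Pi.one_apply, one_mul] at h1
  rw [h1]
  have h2 : Integrable (fun X => F X ^ 2) volume := by
    refine (hF.pow 2).integrable_of_hasCompactSupport ?_
    simpa only [sq] using! hc.mul_left (f := F)
  refine ENNReal.mul_lt_top (ENNReal.natCast_lt_top _) ?_
  simpa [HasFiniteIntegral, enorm_pow] using h2.2

theorem hasStatistics_vacuumLift {F : (Fin N → Space) → ℝ}
    (hF : ∀ (σ : Equiv.Perm (Fin N)) (X : Fin N → Space),
      F (X ∘ σ) = ((Equiv.Perm.sign σ : ℤ) : ℝ) * F X) : HasStatistics (vacuumLift F) where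
  electrons σ X s κ := by
    simp only [vacuumLift, hF σ X]
    split_ifs <;> simp
  photons n τ Z K := rfl

theorem isWeakPartial_vacuumLift {F : (Fin N → Space) → ℝ} (hF : ContDiff ℝ ∞ F)
    (hc : HasCompactSupport F) (j : Fin N) (i : Fin 3) :
    IsWeakPartial j i (vacuumLift F)
      (vacuumLift fun X => fderiv ℝ F X (Pi.single j (EuclideanSpace.single i 1))) := by
  refine ae_of_all _ fun κ s φ hφ hφc => ?_
  set e : Fin N → Space := Pi.single j (EuclideanSpace.single i 1)
  by_cases h : κ.1 = 0
  · simp only [vacuumLift, h, if_true, ← Complex.ofReal_mul]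
    rw [integral_complex_ofReal, integral_complex_ofReal, ← Complex.ofReal_neg,
      integral_mul_fderiv_eq_neg_fderiv_mul_of_integrable, neg_neg]
    · exact ((continuous_fderiv_test hφ e).mul hF.continuous).integrable_of_hasCompactSupport
        hc.mul_left
    · exact (hφ.continuous.mul (continuous_fderiv_test hF e)).integrable_of_hasCompactSupport
        hφc.mul_right
    · exact (hφ.continuous.mul hF.continuous).integrable_of_hasCompactSupport hc.mul_left
    · exact fun X _ => (hφ.differentiable (by simp)).differentiableAt
    · exact fun X _ => (hF.differentiable (by simp)).differentiableAt
  · simp [vacuumLift, h]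

theorem hasL2Partial_vacuumLift {F : (Fin N → Space) → ℝ} (hF : ContDiff ℝ ∞ F)
    (hc : HasCompactSupport F) (j : Fin N) (i : Fin 3) : HasL2Partial j i (vacuumLift F) :=
  ⟨_, memLp_vacuumLift (continuous_fderiv_test hF _) (hasCompactSupport_fderiv_test hc _),
    isWeakPartial_vacuumLift hF hc j i⟩

/-- The form domain is not trivial. -/
theorem exists_ne_zero_mem_finiteEnergy {W : (Fin N → Space) → ℝ} (hW : Measurable W)
    (hneg : NegPartBounded W) (hpos : LocallyIntegrable (fun X => max (W X) 0) volume) (m : ℝ) :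
    ∃ Ψ ∈ finiteEnergy W m, Ψ ≠ 0 := by
  obtain ⟨F, hF, hc, hF0, hanti⟩ := exists_antisymmetric_test N
  have hL := memLp_vacuumLift hF.continuous hc
  have hae : hL.toLp =ᵐ[confMeasure N] vacuumLift F := hL.coeFn_toLp
  let Ψ : hilbert N := ⟨hL.toLp, vacuumLift F, hasStatistics_vacuumLift hanti, hae⟩
  have hp : ∀ j i, HasL2Partial j i Ψ.1 := fun j i =>
    (hasL2Partial_vacuumLift hF hc j i).congr hae.symm
  refine ⟨Ψ, ⟨hp, ((hasWeight_potential_iff hW).2 ⟨?_, ?_⟩).2, ?_⟩, ?_⟩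
  · refine HasWeight.congr ?_ hae.symm
    have hWm : Measurable fun X => max (W X) 0 := hW.max measurable_const
    rw [hasWeight_iff_lintegral ((measurable_potential hW).max measurable_const)
      (fun z => le_max_right _ _) hL.1,
      lintegral_vacuumLift (w := fun X => ENNReal.ofReal (max (W X) 0)) hF.continuous.measurable
        hWm.ennreal_ofReal]
    refine ENNReal.mul_lt_top (ENNReal.natCast_lt_top _) ?_
    have h1 := hpos.integrable_smul_left_of_hasCompactSupport (g := fun X => F X ^ 2)
      (hF.continuous.pow 2) (by simpa only [sq] using! hc.mul_left (f := F))
    have h2 := h1.2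
    rw [hasFiniteIntegral_iff_ofReal (ae_of_all _ fun X =>
      smul_nonneg (sq_nonneg _) (le_max_right _ _))] at h2
    refine lt_of_eq_of_lt (lintegral_congr fun X => ?_) h2
    rw [smul_eq_mul, mul_comm, ← sq_abs, ENNReal.ofReal_mul (sq_nonneg _),
      ENNReal.ofReal_pow (abs_nonneg _), ← Real.norm_eq_abs, ofReal_norm]
  · obtain ⟨a, ha⟩ := hneg 1 one_pos
    exact (ha Ψ hp).1
  · refine (integrable_zero _ _ _).congr ?_
    filter_upwards [hae] with z hz
    have hz' : Ψ.1 z = vacuumLift F z := hz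
    rw [hz']
    by_cases h : z.2.1 = 0
    · have h3 : fieldEnergy m z.2 = 0 := by
        obtain ⟨Z, n, K⟩ := z
        obtain rfl : n = 0 := h
        simp [fieldEnergy]
      rw [h3, zero_mul]
      rfl
    · simp [vacuumLift, h]
  · intro h0
    refine hF0 ((hF.continuous.ae_eq_iff_eq (volume : Measure (Fin N → Space))
      (continuous_const (y := (0 : ℝ)))).1 ?_)
    have h1 : hL.toLp = 0 := congrArg Subtype.val h0
    have h2 : ∫⁻ z, (1 : (Fin N → Space) → ℝ≥0∞) z.1.1 * ‖vacuumLift F z‖ₑ ^ 2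
        ∂confMeasure N = 0 := by
      rw [lintegral_eq_zero_iff' (by
        simpa using (measurable_vacuumLift hF.continuous.measurable).enorm.pow_const 2
          |>.aemeasurable)]
      rw [h1] at hae
      filter_upwards [hae, Lp.coeFn_zero ℂ 2 (confMeasure N)] with z h3 h4
      rw [← h3, h4]
      simp
    rw [lintegral_vacuumLift (w := 1) hF.continuous.measurable measurable_const, mul_eq_zero] at h2
    rcases h2 with h2 | h2
    · simp at h2
    · rw [lintegral_eq_zero_iff (by
        simpa using hF.continuous.measurable.enorm.pow_const 2)] at h2
      filter_upwards [h2] with X hX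
      simpa using hX

end TestVector

/-! ### Cutting off the photon number -/

section Cutoff

open scoped ENNReal

variable {N : ℕ} {W : (Fin N → Space) → ℝ} {m : ℝ} {α g Λ : ℝ} {j : Fin N} {i : Fin 3}
  {Ψ : hilbert N}

/-- The indicator function of at most `k` photons. -/
def fewPhotons (k : ℕ) (κ : PhotonConf) : ℂ := if κ.1 ≤ k then 1 else 0

theorem measurable_fewPhotons (k : ℕ) : Measurable (fewPhotons k) :=
  Measurable.ite (measurable_photonNumber measurableSet_Iic) measurable_const measurable_const

theorem norm_fewPhotons_le (k : ℕ) (κ : PhotonConf) : ‖fewPhotons k κ‖ ≤ 1 := by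
  unfold fewPhotons
  split_ifs <;> simp

theorem norm_fewPhotons_sub_one_le (k : ℕ) (κ : PhotonConf) : ‖fewPhotons k κ - 1‖ ≤ 1 := by
  unfold fewPhotons
  split_ifs <;> simp

theorem memLp_mul_photonFunction {c : PhotonConf → ℂ} (hc : Measurable c) (hc1 : ∀ κ, ‖c κ‖ ≤ 1)
    {f : Conf N → ℂ} (hf : MemLp f 2 (confMeasure N)) :
    MemLp (fun z => c z.2 * f z) 2 (confMeasure N) := by
  refine hf.mono ((hc.comp measurable_snd).aestronglyMeasurable.mul hf.1) (ae_of_all _ fun z => ?_)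
  rw [norm_mul]
  exact mul_le_of_le_one_left (norm_nonneg _) (hc1 _)

theorem HasWeight.mul_photonFunction {c : PhotonConf → ℂ} (hc : Measurable c)
    (hc1 : ∀ κ, ‖c κ‖ ≤ 1) {w : Conf N → ℝ} (hw : Measurable w) {f : Conf N → ℂ}
    (hf : HasWeight w f) : HasWeight w (fun z => c z.2 * f z) := by
  have hm := (hc.comp measurable_snd).aestronglyMeasurable.mul hf.1
  refine ⟨hm, hf.2.mono (hw.aestronglyMeasurable.mul (hm.norm.pow 2)) (ae_of_all _ fun z => ?_)⟩
  simp only [norm_mul, norm_pow, norm_norm]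
  refine mul_le_mul_of_nonneg_left ?_ (norm_nonneg _)
  exact pow_le_pow_left₀ (by positivity) (mul_le_of_le_one_left (norm_nonneg _) (hc1 _)) 2

theorem memLp_cutoff (k : ℕ) (Ψ : hilbert N) :
    MemLp (fun z => fewPhotons k z.2 * Ψ.1 z) 2 (confMeasure N) :=
  memLp_mul_photonFunction (measurable_fewPhotons k) (norm_fewPhotons_le k) (Lp.memLp Ψ.1)

/-- The projection of `Ψ` to at most `k` photons. -/
def cutoff (k : ℕ) (Ψ : hilbert N) : hilbert N :=
  ⟨(memLp_cutoff k Ψ).toLp, by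
    obtain ⟨f, hf, hΨ⟩ := Ψ.2
    refine ⟨fun z => fewPhotons k z.2 * f z, ⟨fun σ X s κ => ?_, fun n τ Z K => ?_⟩,
      (MemLp.coeFn_toLp _).trans ?_⟩
    · simp only [hf.electrons σ X s κ]
      ring
    · simp only [hf.photons n τ Z K]
      rfl
    · filter_upwards [hΨ] with z hz
      rw [hz]⟩

theorem coe_cutoff (k : ℕ) (Ψ : hilbert N) :
    (cutoff k Ψ).1 =ᵐ[confMeasure N] fun z => fewPhotons k z.2 * Ψ.1 z :=
  (memLp_cutoff k Ψ).coeFn_toLp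

theorem coe_cutoff_sub (k : ℕ) (Ψ : hilbert N) :
    (cutoff k Ψ - Ψ).1 =ᵐ[confMeasure N] fun z => (fewPhotons k z.2 - 1) * Ψ.1 z := by
  filter_upwards [coe_cutoff k Ψ, coe_sub_ae (cutoff k Ψ) Ψ] with z h1 h2
  rw [← h2, h1]
  ring

theorem cutoff_mem (hW : Measurable W) (k : ℕ) (hΨ : Ψ ∈ finiteEnergy W m) :
    cutoff k Ψ ∈ finiteEnergy W m := by
  have h := (coe_cutoff k Ψ).symm
  refine ⟨fun j i => ?_,
    (((hasWeight_potential hΨ).mul_photonFunction (measurable_fewPhotons k)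
      (norm_fewPhotons_le k) (measurable_potential hW)).congr h).2,
    (((hasWeight_fieldEnergy hΨ).mul_photonFunction (measurable_fewPhotons k)
      (norm_fewPhotons_le k) (measurable_fieldEnergy m)).congr h).2⟩
  refine HasL2Partial.congr ⟨_, memLp_mul_photonFunction (measurable_fewPhotons k)
    (norm_fewPhotons_le k) (memLp_weakPartial j i Ψ.1),
    (hΨ.1 j i).isWeakPartial.mul_left (fewPhotons k)⟩ h

theorem weakPartial_cutoff_sub (k : ℕ) (hΨ : HasL2Partial j i Ψ.1) :
    weakPartial j i (cutoff k Ψ - Ψ).1 =ᵐ[confMeasure N]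
      fun z => (fewPhotons k z.2 - 1) * weakPartial j i Ψ.1 z :=
  weakPartial_ae_eq ((hΨ.isWeakPartial.mul_left fun κ => fewPhotons k κ - 1).congr
    (coe_cutoff_sub k Ψ).symm (ae_eq_refl _))
    (memLp_mul_photonFunction ((measurable_fewPhotons k).sub_const 1)
      (norm_fewPhotons_sub_one_le k) (memLp_weakPartial j i Ψ.1))

theorem tendsto_integral_manyPhotons {F : Conf N → ℝ} (hF : Integrable F (confMeasure N)) :
    Tendsto (fun k => ∫ z, ‖fewPhotons k z.2 - 1‖ ^ 2 * F z ∂confMeasure N) atTop (𝓝 0) := by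
  have h := tendsto_integral_of_dominated_convergence (μ := confMeasure N)
    (F := fun k z => ‖fewPhotons k z.2 - 1‖ ^ 2 * F z) (f := fun _ => 0) (fun z => |F z|)
    (fun k => ((((measurable_fewPhotons k).sub_const 1).comp
      measurable_snd).norm.pow_const 2).aestronglyMeasurable.mul hF.1) hF.abs
    (fun k => ae_of_all _ fun z => ?_) (ae_of_all _ fun z => ?_)
  · simpa using h
  · rw [norm_mul, norm_pow, norm_norm, Real.norm_eq_abs]
    exact mul_le_of_le_one_left (abs_nonneg _)
      (pow_le_one₀ (norm_nonneg _) (norm_fewPhotons_sub_one_le k z.2))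
  · refine tendsto_const_nhds.congr' ?_
    filter_upwards [eventually_ge_atTop z.2.1] with k hk
    simp [fewPhotons, hk]

theorem tendsto_weight_cutoff {w : Conf N → ℝ}
    (hw : Integrable (fun z => w z * ‖Ψ.1 z‖ ^ 2) (confMeasure N)) :
    Tendsto (fun k => ∫ z, w z * ‖(cutoff k Ψ - Ψ).1 z‖ ^ 2 ∂confMeasure N) atTop (𝓝 0) := by
  refine (tendsto_integral_manyPhotons hw).congr fun k => integral_congr_ae ?_
  filter_upwards [coe_cutoff_sub k Ψ] with z hz
  rw [hz, norm_mul]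
  ring

theorem tendsto_cutoff (Ψ : hilbert N) : Tendsto (fun k => cutoff k Ψ) atTop (𝓝 Ψ) := by
  have h1 := tendsto_weight_cutoff (Ψ := Ψ) (w := fun _ => 1)
    (by simpa using (memLp_two_iff_integrable_sq_norm (Lp.memLp Ψ.1).1).1 (Lp.memLp Ψ.1))
  simp only [one_mul, ← norm_sq_coe] at h1
  rw [tendsto_iff_norm_sub_tendsto_zero]
  simpa [Real.sqrt_sq (norm_nonneg _)] using h1.sqrt

theorem tendsto_freeEnergy_cutoff (hW : Measurable W) (hΨ : Ψ ∈ finiteEnergy W m) :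
    Tendsto (fun k => freeEnergy W m (cutoff k Ψ - Ψ).1) atTop (𝓝 0) := by
  have h1 : Tendsto (fun k => kineticEnergy ((cutoff k Ψ - Ψ).1 : Conf N → ℂ)) atTop (𝓝 0) := by
    have h2 : ∀ (j : Fin N) (i : Fin 3), Tendsto (fun k =>
        ∫ z, ‖weakPartial j i (cutoff k Ψ - Ψ).1 z‖ ^ 2 ∂confMeasure N) atTop (𝓝 0) := by
      intro j i
      have h3 := memLp_weakPartial j i (Ψ.1 : Conf N → ℂ)
      refine (tendsto_integral_manyPhotons
        ((memLp_two_iff_integrable_sq_norm h3.1).1 h3)).congr fun k => integral_congr_ae ?_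
      filter_upwards [weakPartial_cutoff_sub k (hΨ.1 j i)] with z hz
      rw [hz, norm_mul, mul_pow]
    have := tendsto_finsetSum (Finset.univ : Finset (Fin N)) fun j _ =>
      tendsto_finsetSum (Finset.univ : Finset (Fin 3)) fun i _ => h2 j i
    simpa using! this
  have h2 := (h1.add (tendsto_weight_cutoff
    ((hasWeight_potential_iff hW).1 (hasWeight_potential hΨ)).1.2)).add
    (tendsto_weight_cutoff hΨ.2.2)
  simpa using! h2

theorem dispersion_le {m : ℝ} (hm : 0 ≤ m) (k : Space) : dispersion m k ≤ dispersion 0 k + m := by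
  unfold dispersion
  rw [Real.sqrt_le_left (by positivity)]
  have h1 : Real.sqrt (‖k‖ ^ 2 + 0 ^ 2) = ‖k‖ := by simp
  rw [h1]
  nlinarith [norm_nonneg k]

theorem fieldEnergy_le {m : ℝ} (hm : 0 ≤ m) (κ : PhotonConf) :
    fieldEnergy m κ ≤ fieldEnergy 0 κ + κ.1 * m := by
  refine (Finset.sum_le_sum fun l _ => dispersion_le hm _).trans ?_
  rw [Finset.sum_add_distrib, Finset.sum_const, Finset.card_univ, Fintype.card_fin, nsmul_eq_mul]
  rfl

/-- Vectors with at most `k` photons of finite massless energy have finite energy for every photon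
mass `m`, and giving mass to the photons costs at most `k * m`. -/
theorem cutoff_massive (k : ℕ) (hW : Measurable W) (hm : 0 ≤ m) (hΨ : Ψ ∈ finiteEnergy W 0) :
    cutoff k Ψ ∈ finiteEnergy W m ∧
      (energyForm α g Λ W m (cutoff k Ψ) (cutoff k Ψ)).re ≤
        (energyForm α g Λ W 0 (cutoff k Ψ) (cutoff k Ψ)).re + k * m * ‖cutoff k Ψ‖ ^ 2 := by
  have hc := cutoff_mem hW k hΨ
  have hle : ∀ᵐ z ∂confMeasure N, fieldEnergy m z.2 * ‖(cutoff k Ψ).1 z‖ ^ 2 ≤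
      fieldEnergy 0 z.2 * ‖(cutoff k Ψ).1 z‖ ^ 2 + k * m * ‖(cutoff k Ψ).1 z‖ ^ 2 := by
    filter_upwards [coe_cutoff k Ψ] with z hz
    rw [← add_mul]
    by_cases h : z.2.1 ≤ k
    · refine mul_le_mul_of_nonneg_right ((fieldEnergy_le hm z.2).trans ?_) (sq_nonneg _)
      have : (z.2.1 : ℝ) ≤ k := by exact_mod_cast h
      have := mul_le_mul_of_nonneg_right this hm
      linarith
    · have h0 : (cutoff k Ψ).1 z = 0 := by
        rw [hz, fewPhotons, if_neg h, zero_mul]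
      simp only [h0, norm_zero, ne_eq, OfNat.ofNat_ne_zero, not_false_eq_true, zero_pow, mul_zero,
        le_refl]
  have hL := Lp.memLp (cutoff k Ψ).1
  have hi := hc.2.2.add (((memLp_two_iff_integrable_sq_norm hL.1).1 hL).const_mul ((k : ℝ) * m))
  have hi2 : Integrable (fun z => fieldEnergy m z.2 * ‖(cutoff k Ψ).1 z‖ ^ 2) (confMeasure N) := by
    refine hi.mono ((measurable_fieldEnergy m).aestronglyMeasurable.mul (hL.1.norm.pow 2)) ?_
    filter_upwards [hle] with z hz
    rw [Real.norm_of_nonneg (mul_nonneg (fieldEnergy_nonneg _ _) (sq_nonneg _))]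
    exact hz.trans (Real.le_norm_self _)
  refine ⟨⟨hc.1, hc.2.1, hi2⟩, ?_⟩
  have h1 : ∫ z, fieldEnergy m z.2 * ‖(cutoff k Ψ).1 z‖ ^ 2 ∂confMeasure N ≤
      (∫ z, fieldEnergy 0 z.2 * ‖(cutoff k Ψ).1 z‖ ^ 2 ∂confMeasure N) +
        k * m * ‖cutoff k Ψ‖ ^ 2 := by
    rw [norm_sq_coe, ← integral_const_mul, ← integral_add hc.2.2
      (((memLp_two_iff_integrable_sq_norm hL.1).1 hL).const_mul _)]
    exact integral_mono_ae hi2 hi hle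
  rw [re_energyForm_self, re_energyForm_self]
  linarith

theorem finiteEnergy_subset_massless (hm : 0 ≤ m) :
    finiteEnergy W m ⊆ (finiteEnergy W 0 : Set (hilbert N)) := fun _ hΨ =>
  ⟨hΨ.1, hΨ.2.1, (hasWeight_fieldEnergy_zero hm hΨ).2⟩

theorem energyForm_massless_le (hm : 0 ≤ m) (hΨ : Ψ ∈ finiteEnergy W m) :
    (energyForm α g Λ W 0 Ψ Ψ).re ≤ (energyForm α g Λ W m Ψ Ψ).re := by
  rw [re_energyForm_self, re_energyForm_self]
  linarith [integral_fieldEnergy_zero_le hm hΨ]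

end Cutoff

/-! ### The ground state energy and its massless limit -/

section MasslessLimit

open scoped ENNReal

variable {N : ℕ} {W : (Fin N → Space) → ℝ} {m : ℝ} {α g Λ : ℝ}

/-- The bottom of the spectrum is the infimum of the energy form. -/
theorem exists_isLeast_spectrum (hW : Measurable W) (hneg : NegPartBounded W)
    (hpos : LocallyIntegrable (fun X => max (W X) 0) volume) (hα : 0 ≤ α) (hm : 0 ≤ m) :
    ∃ E : ℝ, IsLeast (realSpectrum (friedrichsGraph (finiteEnergy W m)
        (energyForm α g Λ W m))) E ∧
      (∀ Ψ ∈ finiteEnergy W m, E * ‖Ψ‖ ^ 2 ≤ (energyForm α g Λ W m Ψ Ψ).re) ∧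
      ∀ E' > E, ∃ Ψ ∈ finiteEnergy W m, Ψ ≠ 0 ∧
        (energyForm α g Λ W m Ψ Ψ).re < E' * ‖Ψ‖ ^ 2 := by
  obtain ⟨δ, C, hδ, -, hlow⟩ := exists_coercive (g := g) (Λ := Λ) hW hneg hm hα
  exact exists_isLeast_realSpectrum (isHermitianForm_energyForm hW hm)
    (isClosedForm_energyForm hW hneg hm hα) (e := -C)
    (fun Ψ hΨ => by
      have h1 := hlow Ψ hΨ
      have h2 := mul_nonneg hδ.le (freeEnergy_nonneg W m Ψ.1)
      linarith)
    (exists_ne_zero_mem_finiteEnergy hW hneg hpos m)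

/-- The infimum of the energy form is continuous in the photon mass at zero: it increases with the
mass, and approximate massless ground states with finitely many photons have almost the same energy
for small mass. -/
theorem tendsto_infimum (hW : Measurable W) (hneg : NegPartBounded W) (hα : 0 ≤ α) {E : ℝ → ℝ}
    (hlow : ∀ m, 0 ≤ m → ∀ Ψ ∈ finiteEnergy W m,
      E m * ‖Ψ‖ ^ 2 ≤ (energyForm α g Λ W m Ψ Ψ).re)
    (hinf : ∀ m, 0 ≤ m → ∀ E' > E m, ∃ Ψ ∈ finiteEnergy W m, Ψ ≠ 0 ∧
      (energyForm α g Λ W m Ψ Ψ).re < E' * ‖Ψ‖ ^ 2) :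
    Tendsto E (𝓝[>] 0) (𝓝 (E 0)) := by
  have hge : ∀ m, 0 ≤ m → E 0 ≤ E m := by
    intro m hm
    by_contra! hlt
    obtain ⟨Ψ, hΨ, -, h1⟩ := hinf m hm _ hlt
    have h2 := hlow 0 le_rfl Ψ (finiteEnergy_subset_massless hm hΨ)
    have h3 := energyForm_massless_le (α := α) (g := g) (Λ := Λ) hm hΨ
    linarith
  rw [tendsto_order]
  refine ⟨fun a ha => ?_, fun b hb => ?_⟩
  · filter_upwards [self_mem_nhdsWithin] with m hm
    exact ha.trans_le (hge m (le_of_lt hm))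
  · obtain ⟨Ψ, hΨ, -, h1⟩ := hinf 0 le_rfl b hb
    obtain ⟨C, hC0, hC⟩ := exists_energyForm_le (g := g) (Λ := Λ) hW hneg le_rfl hα
    have hcut : ∀ k, cutoff k Ψ ∈ finiteEnergy W 0 := fun k => cutoff_mem hW k hΨ
    have hform : Tendsto (fun k =>
        (energyForm α g Λ W 0 (cutoff k Ψ - Ψ) (cutoff k Ψ - Ψ)).re) atTop (𝓝 0) := by
      have h2 := ((tendsto_freeEnergy_cutoff hW hΨ).add
        ((tendsto_iff_norm_sub_tendsto_zero.1 (tendsto_cutoff Ψ)).pow 2)).const_mul C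
      rw [zero_pow two_ne_zero, add_zero, mul_zero] at h2
      exact squeeze_zero_norm (fun k => hC _ ((formDomain W hW 0).sub_mem (hcut k) hΨ)) h2
    have h2 := (isHermitianForm_energyForm (α := α) (g := g) (Λ := Λ) hW le_rfl).tendsto_re_self
      (hlow 0 le_rfl) hcut hΨ (tendsto_cutoff Ψ) hform
    have h3 : Tendsto (fun k => b * ‖cutoff k Ψ‖ ^ 2) atTop (𝓝 (b * ‖Ψ‖ ^ 2)) :=
      (((tendsto_cutoff Ψ).norm).pow 2).const_mul b
    obtain ⟨k, hk⟩ := (h2.eventually_lt h3 h1).exists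
    have h4 : Tendsto (fun m : ℝ => (energyForm α g Λ W 0 (cutoff k Ψ) (cutoff k Ψ)).re +
        k * m * ‖cutoff k Ψ‖ ^ 2) (𝓝[>] 0)
        (𝓝 ((energyForm α g Λ W 0 (cutoff k Ψ) (cutoff k Ψ)).re)) := by
      refine tendsto_nhdsWithin_of_tendsto_nhds (Continuous.tendsto' (by fun_prop) _ _ (by simp))
    filter_upwards [h4.eventually_lt_const hk, self_mem_nhdsWithin] with m hm1 hm2
    have hm : 0 ≤ m := le_of_lt hm2
    obtain ⟨h5, h6⟩ := cutoff_massive (α := α) (g := g) (Λ := Λ) k hW hm hΨ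
    have h7 := (hlow m hm _ h5).trans_lt (h6.trans_lt hm1)
    exact lt_of_mul_lt_mul_right h7 (sq_nonneg _)

/-- For one potential `W`, the bottom of the spectrum is finite and has a massless limit. -/
theorem isGLB_and_tendsto_sInf (hW : Measurable W) (hneg : NegPartBounded W)
    (hpos : LocallyIntegrable (fun X => max (W X) 0) volume) (hα : 0 ≤ α) :
    (∀ m, 0 ≤ m → IsGLB (realSpectrum (friedrichsGraph (finiteEnergy W m) (energyForm α g Λ W m)))
      (sInf (realSpectrum (friedrichsGraph (finiteEnergy W m) (energyForm α g Λ W m))))) ∧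
    Tendsto (fun m => sInf (realSpectrum (friedrichsGraph (finiteEnergy W m)
      (energyForm α g Λ W m)))) (𝓝[>] 0)
      (𝓝 (sInf (realSpectrum (friedrichsGraph (finiteEnergy W 0) (energyForm α g Λ W 0))))) := by
  have h := fun m (hm : 0 ≤ m) =>
    exists_isLeast_spectrum (g := g) (Λ := Λ) hW hneg hpos hα hm
  refine ⟨fun m hm => ?_, tendsto_infimum (α := α) (g := g) (Λ := Λ) hW hneg hα
    (E := fun m => sInf (realSpectrum (friedrichsGraph (finiteEnergy W m)
      (energyForm α g Λ W m)))) (fun m hm => ?_) fun m hm => ?_⟩ <;>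
  obtain ⟨E, hE, h1, h2⟩ := h m hm
  · rw [hE.csInf_eq]
    exact hE.isGLB
  · simp only [hE.csInf_eq]
    exact h1
  · simp only [hE.csInf_eq]
    exact h2

end MasslessLimit

/-! ### The potentials `V + I` and `I` -/

section Potentials

variable {N : ℕ} {v : Space → ℝ} {I : (Fin N → Space) → ℝ}

theorem measurable_externalPotential (hv : Measurable v) :
    Measurable fun X : Fin N → Space => externalPotential v X :=
  Finset.measurable_sum _ fun j _ => hv.comp (measurable_pi_apply j)

theorem locallyIntegrable_comp_eval {u : Space → ℝ} (hu : LocallyIntegrable u volume) (j : Fin N) :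
    LocallyIntegrable (fun X : Fin N → Space => u (X j)) volume := by
  rw [locallyIntegrable_iff]
  intro K hK
  obtain ⟨R, hR⟩ := hK.isBounded.subset_closedBall 0
  have hsub : K ⊆ Set.univ.pi fun _ : Fin N => Metric.closedBall (0 : Space) R := by
    intro X hX l _
    have h1 := hR hX
    rw [mem_closedBall_zero_iff] at h1 ⊢
    exact (norm_le_pi_norm X l).trans h1
  refine IntegrableOn.mono_set ?_ hsub
  rw [IntegrableOn, volume_pi, Measure.restrict_pi_pi]
  have : IsFiniteMeasure ((volume : Measure Space).restrict (Metric.closedBall (0 : Space) R)) :=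
    isFiniteMeasure_restrict.2 (isCompact_closedBall _ _).measure_ne_top
  exact integrable_comp_eval
    (μ := fun _ : Fin N => (volume : Measure Space).restrict (Metric.closedBall 0 R)) (i := j)
    (hu.integrableOn_isCompact (isCompact_closedBall (0 : Space) R))

theorem max_sum_le {ι : Type*} (s : Finset ι) (a : ι → ℝ) :
    max (∑ j ∈ s, a j) 0 ≤ ∑ j ∈ s, max (a j) 0 :=
  max_le (Finset.sum_le_sum fun _ _ => le_max_left _ _)
    (Finset.sum_nonneg fun _ _ => le_max_right _ _)

theorem max_add_le (a b : ℝ) : max (a + b) 0 ≤ max a 0 + max b 0 :=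
  max_le (add_le_add (le_max_left _ _) (le_max_left _ _))
    (add_nonneg (le_max_right _ _) (le_max_right _ _))

theorem locallyIntegrable_posPart (hv : Measurable v) (hI : Measurable I)
    (hvloc : LocallyIntegrable (fun x => max (v x) 0) volume)
    (hIloc : LocallyIntegrable (fun X => max (I X) 0) volume) :
    LocallyIntegrable (fun X => max (externalPotential v X + I X) 0) volume := by
  have h1 : LocallyIntegrable (fun X : Fin N → Space => ∑ j, max (v (X j)) 0) volume :=
    locallyIntegrable_finsetSum _ fun j _ => locallyIntegrable_comp_eval hvloc j
  refine (h1.add hIloc).mono (((measurable_externalPotential hv).add hI).max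
    measurable_const).aestronglyMeasurable (ae_of_all _ fun X => ?_)
  rw [Real.norm_of_nonneg (le_max_right _ _)]
  refine le_trans ?_ (Real.le_norm_self _)
  exact (max_add_le _ _).trans (add_le_add (max_sum_le _ _) le_rfl)

/-- The kinetic bound on `V_- + I_-` serves both potentials `V + I` and `I`. -/
theorem negPartBounded_of_le {W : (Fin N → Space) → ℝ} (hbound : KineticallyBounded v I)
    (hW : Measurable W)
    (hle : ∀ X, max (-W X) 0 ≤ max (-externalPotential v X) 0 + max (-I X) 0) :
    NegPartBounded W := by
  intro ε hε
  obtain ⟨a, ha⟩ := hbound ε hε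
  refine ⟨a, fun Ψ hΨ => ?_⟩
  obtain ⟨h1, h2⟩ := ha Ψ hΨ
  have hae : ∀ z : Conf N, max (-W z.1.1) 0 * ‖Ψ.1 z‖ ^ 2 ≤
      (max (-externalPotential v z.1.1) 0 + max (-I z.1.1) 0) * ‖Ψ.1 z‖ ^ 2 := fun z =>
    mul_le_mul_of_nonneg_right (hle _) (sq_nonneg _)
  have hL := Lp.memLp Ψ.1
  have hi : Integrable (fun z => max (-W z.1.1) 0 * ‖Ψ.1 z‖ ^ 2) (confMeasure N) := by
    refine h1.mono (((measurable_potential hW).neg.max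
      measurable_const).aestronglyMeasurable.mul (hL.1.norm.pow 2)) (ae_of_all _ fun z => ?_)
    rw [Real.norm_of_nonneg (mul_nonneg (le_max_right _ _) (sq_nonneg _))]
    exact (hae z).trans (Real.le_norm_self _)
  exact ⟨⟨hL.1, hi⟩, (integral_mono hi h1 hae).trans h2⟩

end Potentials

end PauliFierz

end

theorem theorem5p1 (N : ℕ) (α g Λ : ℝ) (hα : 0 ≤ α) (hΛ : 0 < Λ)
    (v : PauliFierz.Space → ℝ) (I : (Fin N → PauliFierz.Space) → ℝ)
    (hv : Measurable v) (hI : Measurable I)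
    (hIsymm : ∀ (σ : Equiv.Perm (Fin N)) (X : Fin N → PauliFierz.Space), I (X ∘ σ) = I X)
    (hvloc : LocallyIntegrable (fun x => max (v x) 0) volume)
    (hIloc : LocallyIntegrable (fun X => max (I X) 0) volume)
    (hbound : PauliFierz.KineticallyBounded v I) :
    (∀ m : ℝ, 0 ≤ m →
      IsGLB (PauliFierz.realSpectrum (PauliFierz.hamiltonian α g Λ v I m))
        (PauliFierz.groundEnergy α g Λ v I m) ∧
      IsGLB (PauliFierz.realSpectrum (PauliFierz.hamiltonian α g Λ 0 I m))
        (PauliFierz.groundEnergy α g Λ 0 I m)) ∧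
    Tendsto (fun m : ℝ => PauliFierz.groundEnergy α g Λ v I m) (𝓝[>] 0)
      (𝓝 (PauliFierz.groundEnergy α g Λ v I 0)) ∧
    Tendsto (fun m : ℝ => PauliFierz.groundEnergy α g Λ 0 I m) (𝓝[>] 0)
      (𝓝 (PauliFierz.groundEnergy α g Λ 0 I 0)) := by
  have hW := (PauliFierz.measurable_externalPotential (N := N) hv).add hI
  have hW0 := (PauliFierz.measurable_externalPotential (N := N) (v := 0) measurable_const).add hI
  have h1 := PauliFierz.isGLB_and_tendsto_sInf (g := g) (Λ := Λ) hW
    (PauliFierz.negPartBounded_of_le hbound hW fun X => by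
      simp only [Pi.add_apply, neg_add]
      exact PauliFierz.max_add_le _ _)
    (PauliFierz.locallyIntegrable_posPart hv hI hvloc hIloc) hα
  have h2 := PauliFierz.isGLB_and_tendsto_sInf (g := g) (Λ := Λ) hW0
    (PauliFierz.negPartBounded_of_le hbound hW0 fun X => by
      have h0 : PauliFierz.externalPotential 0 X = 0 := by simp [PauliFierz.externalPotential]
      simp only [Pi.add_apply, h0, zero_add]
      exact le_add_of_nonneg_left (le_max_right _ _))
    (PauliFierz.locallyIntegrable_posPart measurable_const hI
      (by simpa using locallyIntegrable_zero) hIloc) hα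
  exact ⟨fun m hm => ⟨h1.1 m hm, h2.1 m hm⟩, h1.2, h2.2⟩
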